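/- Theorem. Consider the uplink at the base station of cell $l$ of a finite set $\Phi$ of cells, each with $K$ single-antenna users; the base station has $M$ antennas. In one coherence block it receives $$\mathbf Y_l=\sum_{\ell\in\Phi}\sum_{k'=1}^K \mathbf h_{l\ell k'}\mathbf x_{\ell k'}^T+\mathbf N ,$$ where $\mathbf h_{l\ell k'}\sim\mathcal{CN}(\mathbf 0,\mathbf R_{l\ell k'})$, the columns of $\mathbf N$ are $\mathcal{CN}(\mathbf 0,\sigma^2\mathbf I_M)$, and all these vectors are independent. User $(\ell,k')$ sends data symbols $\mathbf s_{\ell k'}\in\mathbb C^{\tau_d}$ with i.i.d. $\mathcal{CN}(0,1)$ entries, with pilot and data energies $q_{\ell k'},\rho_{\ell k'}\ge 0$ per symbol. * Regular pilots (RP): $\mathbf x_{\ell k'}=[\sqrt{q_{\ell k'}}\,\boldsymbol\phi_{\ell k'}^T\ \ \sqrt{\rho_{\ell k'}}\,\mathbf s_{\ell k'}^T]^T$ with $\boldsymbol\phi_{\ell k'}\in\mathbb C^{\tau_p}$; the block has length $\tau_p+\tau_d$. * Superimposed pilots (SP): $\mathbf x_{\ell k'}=\sqrt{q_{\ell k'}}\,\boldsymbol\varphi_{\ell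 k'}+\sqrt{\rho_{\ell k'}}\,\mathbf s_{\ell k'}$ with $\boldsymbol\varphi_{\ell k'}\in\mathbb C^{\tau_c}$ and $\tau_d=\tau_c$. The pilots are taken from a set of $\tau$ mutually orthogonal vectors of $\mathbb C^{\tau}$ with entries of modulus one ($\tau=\tau_p$ for RP, $\tau=\tau_c$ for SP), with distinct pilots for distinct users of cell $l$. Let $\mathcal P_{lk}$ be the set of users $(\ell,k')$ whose pilot is not orthogonal to that of user $(l,k)$. Assume $\tau_d>K$ and $q_{lk'}>0$ for all $k'$. In the iteration $i$ considered, $\mathbf s_{lk'}=\hat{\mathbf s}_{lk'}+\tilde{\mathbf s}_{lk'}$ for every user of cell $l$, where the entries of the data estimate $\hat{\mathbf s}_{lk'}$ are $\mathcal{CN}(0,\sigma_{lk'}^2)$, and all entries of the estimates $\hat{\mathbf s}_{lk'}$, of the errors $\tilde{\mathbf s}_{lk'}$ and of the data $\mathbf s_{\ell k'}$, $\ell\ne l$, are mutually independent. Channels and noise are independent of all data symbols and data estimates. Let $\hat{\mathbf x}_{lk'}$ be $\mathbf x_{lk'}$ with $\mathbf s_{lk'}$ replaced by $\hat{\mathbf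 s}_{lk'}$, $\tilde{\mathbf x}_{lk'}=\mathbf x_{lk'}-\hat{\mathbf x}_{lk'}$, $\hat{\mathbf X}_l=[\hat{\mathbf x}_{l1},\dots,\hat{\mathbf x}_{lK}]$, let $\mathbf u_{lk}$ be the $k$-th column of $\hat{\mathbf X}_l(\hat{\mathbf X}_l^H\hat{\mathbf X}_l)^{-1}$, let $\mathbf z_{llk}=\mathbf Y_l\mathbf u_{lk}^*$ and $\boldsymbol\Psi_{llk}=\mathbb E\{\mathbf z_{llk}\mathbf z_{llk}^H\}$. Fix a user $(l,k)$; with RP assume also $\rho_{lk}>0$ and $\sigma_{lk}^2>0$. Then, with RP and with SP, $\mathbf u_{lk}$ and $\mathbf z_{llk}$ are square integrable, $$\boldsymbol\Psi_{llk}=\mathbf R_{llk}+\sum_{k'=1}^K\mathbf R_{llk'}\mathbb E\{|\mathbf u_{lk}^H\tilde{\mathbf x}_{lk'}|^2\}+\sum_{\ell\ne l}\sum_{k'=1}^K\mathbf R_{l\ell k'}\mathbb E\{|\mathbf u_{lk}^H\mathbf x_{\ell k'}|^2\}+\sigma^2\,\mathbb E\{\|\mathbf u_{lk}\|^2\}\,\mathbf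 I_M ,$$ and, in the positive semidefinite order, the following bounds hold. Put $w=\rho_{lk}\sigma_{lk}^2$, $q=q_{lk}$ and $$\mathbf J=\sum_{k'\ne k}\mathbf R_{llk'}\rho_{lk'}(1-\sigma_{lk'}^2)+\sum_{\ell\ne l}\sum_{k'=1}^K\mathbf R_{l\ell k'}\rho_{\ell k'},\qquad \mathbf C=\sum_{(\ell,k')\in\mathcal P_{lk}\setminus\{(l,k)\}}\mathbf R_{l\ell k'}q_{\ell k'} .$$ RP: $$\boldsymbol\Psi_{llk}\succeq\mathbf R_{llk}+\frac{\rho_{lk}(1-\sigma_{lk}^2)}{d}\mathbf R_{llk}+\bar{\boldsymbol\Psi}_{llk},\qquad d=\frac{q^2\tau_p^2}{w(\tau_d-K)}+2q\tau_p+w\tau_d,$$ $$\bar{\boldsymbol\Psi}_{llk}=\frac{1}{d}\mathbf J+\frac{1}{q+\frac{2\tau_d w}{\tau_p}+\frac{w^2\tau_d(\tau_d+1)}{q\tau_p^2}}\mathbf C+\frac{\sigma^2}{q\tau_p+w\tau_d}\mathbf I_M .$$ SP: $$\boldsymbol\Psi_{llk}\succeq\mathbf R_{llk}+\frac{\rho_{lk}(1-\sigma_{lk}^2)}{\tau_c(q+w)}\mathbf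 R_{llk}+\bar{\boldsymbol\Psi}_{llk},$$ $$\bar{\boldsymbol\Psi}_{llk}=\frac{1}{\tau_c(q+w)}\mathbf J+\frac{1}{\frac{(q+w)^2}{q}+\frac{w(2q+w)}{q\tau_c}}\mathbf C+\frac{\sigma^2}{\tau_c(q+w)}\mathbf I_M .$$ -/

import Mathlib

open MeasureTheory ProbabilityTheory Matrix
open scoped NNReal ComplexOrder

noncomputable section

namespace DataAided

/-! ### Circularly symmetric complex Gaussian laws -/

/-- The law `CN(0, v)` on `ℂ`: independent real and imaginary parts, each `N(0, v / 2)`. -/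
def complexGaussian (v : ℝ≥0) : Measure ℂ :=
  ((gaussianReal 0 (v / 2)).prod (gaussianReal 0 (v / 2))).map Complex.measurableEquivRealProd.symm

/-- The random vector `X` has law `CN(0, R)`: for every `t`, the real random variable
`Re (tᴴ X)` is Gaussian with mean `0` and variance `tᴴ R t / 2`. -/
structure IsComplexGaussianVec {Ω ι : Type*} [MeasurableSpace Ω] [Fintype ι]
    (μ : Measure Ω) (X : Ω → ι → ℂ) (R : Matrix ι ι ℂ) : Prop where
  posSemidef : R.PosSemidef
  aemeasurable : AEMeasurable X μ
  law : ∀ t : ι → ℂ, HasLaw (fun ω => (star t ⬝ᵥ X ω).re)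
    (gaussianReal 0 (Real.toNNReal ((star t ⬝ᵥ R *ᵥ t).re / 2))) μ

/-! ### Pilots -/

/-- A set of `τ` mutually orthogonal pilot sequences of length `τ` with unit modulus entries. -/
structure IsPilotBook {τ : ℕ} (U : Set (Fin τ → ℂ)) : Prop where
  ncard_eq : U.ncard = τ
  unit_modulus : ∀ a ∈ U, ∀ j, ‖a j‖ = 1
  orthogonal : ∀ a ∈ U, ∀ b ∈ U, a ≠ b → star a ⬝ᵥ b = 0

open Classical in
/-- The set of all users `c` whose pilot is not orthogonal to the pilot of user `c₀`. -/
def pilotSharing {Φ : Type*} [Fintype Φ] {K τ : ℕ} (φ : Φ × Fin K → Fin τ → ℂ)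
    (c₀ : Φ × Fin K) : Finset (Φ × Fin K) :=
  Finset.univ.filter fun c => star (φ c) ⬝ᵥ φ c₀ ≠ 0

/-! ### Transmitted signals and their estimates

Users are pairs (cell, index). `q` and `ρ` are the pilot and data energies per symbol. -/

/-- Regular pilots: the stacked vector `[√q φ ; √ρ s]` over `τp` pilot and `τd` data slots. -/
def rpSignal {τp τd : ℕ} (q ρ : ℝ) (φ : Fin τp → ℂ) (s : Fin τd → ℂ) : Fin τp ⊕ Fin τd → ℂ :=
  Sum.elim (fun j => (√q : ℂ) * φ j) (fun j => (√ρ : ℂ) * s j)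

/-- Superimposed pilots: `√q φ + √ρ s`. -/
def spSignal {τc : ℕ} (q ρ : ℝ) (φ s : Fin τc → ℂ) : Fin τc → ℂ :=
  fun j => (√q : ℂ) * φ j + (√ρ : ℂ) * s j

section Signals

variable {Ω Φ : Type*} {K : ℕ}

/-- Transmitted signals of all users with regular pilots. -/
def rpTx {τp τd : ℕ} (q ρ : Φ × Fin K → ℝ) (φ : Φ × Fin K → Fin τp → ℂ)
    (s : Φ × Fin K → Fin τd → Ω → ℂ) (c : Φ × Fin K) (ω : Ω) : Fin τp ⊕ Fin τd → ℂ :=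
  rpSignal (q c) (ρ c) (φ c) (fun j => s c j ω)

/-- Signal estimates of the users of cell `l` with regular pilots. -/
def rpEst {τp τd : ℕ} (l : Φ) (q ρ : Φ × Fin K → ℝ) (φ : Φ × Fin K → Fin τp → ℂ)
    (sHat : Fin K → Fin τd → Ω → ℂ) (k : Fin K) (ω : Ω) : Fin τp ⊕ Fin τd → ℂ :=
  rpSignal (q (l, k)) (ρ (l, k)) (φ (l, k)) (fun j => sHat k j ω)

/-- Transmitted signals of all users with superimposed pilots. -/
def spTx {τc : ℕ} (q ρ : Φ × Fin K → ℝ) (φ : Φ × Fin K → Fin τc → ℂ)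
    (s : Φ × Fin K → Fin τc → Ω → ℂ) (c : Φ × Fin K) (ω : Ω) : Fin τc → ℂ :=
  spSignal (q c) (ρ c) (φ c) (fun j => s c j ω)

/-- Signal estimates of the users of cell `l` with superimposed pilots. -/
def spEst {τc : ℕ} (l : Φ) (q ρ : Φ × Fin K → ℝ) (φ : Φ × Fin K → Fin τc → ℂ)
    (sHat : Fin K → Fin τc → Ω → ℂ) (k : Fin K) (ω : Ω) : Fin τc → ℂ :=
  spSignal (q (l, k)) (ρ (l, k)) (φ (l, k)) (fun j => sHat k j ω)

end Signals

/-! ### The probabilistic model -/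

/-- The random quantities seen by the base station of cell `l` in one coherence block:
`h c` is the channel from user `c`, `N t` the noise in time slot `t`, `s c j` the `j`-th data symbol
of user `c`, and `sHat k j` the estimate of `s (l, k) j` in the current iteration;
`v k` is the variance of the data estimates of user `(l, k)`.
`T` indexes the slots of the block and `D` the data symbols of a user. -/
structure IsGaussianUplink {Ω Φ T D : Type*} [MeasurableSpace Ω] (μ : Measure Ω)
    {M K : ℕ} (l : Φ) (R : Φ × Fin K → Matrix (Fin M) (Fin M) ℂ) (noiseVar : ℝ≥0)
    (v : Fin K → ℝ≥0) (h : Φ × Fin K → Ω → Fin M → ℂ) (N : T → Ω → Fin M → ℂ)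
    (s : Φ × Fin K → D → Ω → ℂ) (sHat : Fin K → D → Ω → ℂ) : Prop where
  channel_law : ∀ c, IsComplexGaussianVec μ (h c) (R c)
  noise_law : ∀ t, IsComplexGaussianVec μ (N t) ((noiseVar : ℝ) • (1 : Matrix (Fin M) (Fin M) ℂ))
  data_law : ∀ c j, HasLaw (s c j) (complexGaussian 1) μ
  est_law : ∀ k j, HasLaw (sHat k j) (complexGaussian (v k)) μ
  /-- Channels and noise columns are mutually independent. -/
  indep_channel_noise : iIndepFun (Sum.elim h N) μ
  /-- The data estimates and estimation errors in cell `l`, and the data symbols of the other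
  cells, are mutually independent. -/
  indep_symbols : iIndepFun
    (Sum.elim (fun p : Fin K × D => sHat p.1 p.2)
      (Sum.elim (fun p : Fin K × D => fun ω => s (l, p.1) p.2 ω - sHat p.1 p.2 ω)
        (fun p : {c : Φ × Fin K // c.1 ≠ l} × D => s p.1.1 p.2))) μ
  /-- Channels and noise are independent of the data symbols and their estimates. -/
  indep_channel_symbols : IndepFun
    (fun ω => ((fun c => h c ω), (fun t => N t ω)))
    (fun ω => ((fun p : (Φ × Fin K) × D => s p.1 p.2 ω), (fun p : Fin K × D => sHat p.1 p.2 ω))) μ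

/-! ### Channel observation and its correlation matrix -/

section Observation

variable {Ω Φ T : Type*} [Fintype Φ] [Fintype T] {M K : ℕ}

/-- The received signal `Y = ∑ h_c x_cᵀ + N`. -/
def received (h : Φ × Fin K → Ω → Fin M → ℂ) (N : T → Ω → Fin M → ℂ)
    (x : Φ × Fin K → Ω → T → ℂ) (ω : Ω) : Matrix (Fin M) T ℂ :=
  (∑ c, vecMulVec (h c ω) (x c ω)) + Matrix.of fun a t => N t ω a

/-- The matrix whose columns are the signal estimates of the users in the cell. -/
def estMatrix (xHat : Fin K → Ω → T → ℂ) (ω : Ω) : Matrix T (Fin K) ℂ :=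
  Matrix.of fun t k => xHat k ω t

/-- The `k`-th column `u` of `X̂ (X̂ᴴ X̂)⁻¹`. -/
def projVec (xHat : Fin K → Ω → T → ℂ) (k : Fin K) (ω : Ω) : T → ℂ :=
  fun t => (estMatrix xHat ω * ((estMatrix xHat ω)ᴴ * estMatrix xHat ω)⁻¹) t k

/-- The data-aided channel observation `z = Y u^*`. -/
def chanObs (h : Φ × Fin K → Ω → Fin M → ℂ) (N : T → Ω → Fin M → ℂ)
    (x : Φ × Fin K → Ω → T → ℂ) (xHat : Fin K → Ω → T → ℂ) (k : Fin K) (ω : Ω) : Fin M → ℂ :=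
  received h N x ω *ᵥ star (projVec xHat k ω)

/-- The correlation matrix `E {z zᴴ}`. -/
def corrMatrix [MeasurableSpace Ω] (μ : Measure Ω) (z : Ω → Fin M → ℂ) :
    Matrix (Fin M) (Fin M) ℂ :=
  Matrix.of fun a b => ∫ ω, z ω a * star (z ω b) ∂μ

/-- The decomposition of the correlation matrix of the observation of `h_{llk}`:
`R_{llk}`, intracell interference, intercell interference, and noise. -/
def corrDecomposition [DecidableEq Φ] [MeasurableSpace Ω] (μ : Measure Ω) (l : Φ) (k : Fin K)
    (R : Φ × Fin K → Matrix (Fin M) (Fin M) ℂ) (noiseVar : ℝ≥0)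
    (x : Φ × Fin K → Ω → T → ℂ) (xHat : Fin K → Ω → T → ℂ) : Matrix (Fin M) (Fin M) ℂ :=
  R (l, k)
    + ∑ k' : Fin K, (∫ ω, ‖star (projVec xHat k ω) ⬝ᵥ (x (l, k') ω - xHat k' ω)‖ ^ 2 ∂μ) • R (l, k')
    + ∑ ℓ ∈ Finset.univ.erase l, ∑ k' : Fin K,
        (∫ ω, ‖star (projVec xHat k ω) ⬝ᵥ x (ℓ, k') ω‖ ^ 2 ∂μ) • R (ℓ, k')
    + ((noiseVar : ℝ) * ∫ ω, ∑ t, ‖projVec xHat k ω t‖ ^ 2 ∂μ) • (1 : Matrix (Fin M) (Fin M) ℂ)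

end Observation

/-! ### Closed-form bounds -/

section Bounds

variable {Φ : Type*} [Fintype Φ] [DecidableEq Φ] {M K : ℕ}

/-- Denominator of the data interference term with regular pilots;
`q`, `ρ`, `w` are the pilot energy, data energy and data-estimate variance of the user. -/
def rpDenom (K τp τd : ℕ) (q ρ w : ℝ) : ℝ :=
  q ^ 2 * (τp : ℝ) ^ 2 / (ρ * w * ((τd : ℝ) - (K : ℝ))) + 2 * q * τp + ρ * w * τd

/-- Intracell data interference of the other users of cell `l` weighted by the data-estimate
errors, plus the data interference of all other cells. -/
def dataInterference (l : Φ) (k : Fin K) (R : Φ × Fin K → Matrix (Fin M) (Fin M) ℂ)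
    (ρ : Φ × Fin K → ℝ) (v : Fin K → ℝ≥0) : Matrix (Fin M) (Fin M) ℂ :=
  ∑ k' ∈ Finset.univ.erase k, (ρ (l, k') * (1 - (v k' : ℝ))) • R (l, k')
    + ∑ ℓ ∈ Finset.univ.erase l, ∑ k' : Fin K, ρ (ℓ, k') • R (ℓ, k')

/-- Pilot contamination from the users that share the pilot of user `(l, k)`. -/
def pilotContamination {τ : ℕ} (l : Φ) (k : Fin K) (R : Φ × Fin K → Matrix (Fin M) (Fin M) ℂ)
    (q : Φ × Fin K → ℝ) (φ : Φ × Fin K → Fin τ → ℂ) : Matrix (Fin M) (Fin M) ℂ :=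
  ∑ c ∈ (pilotSharing φ (l, k)).erase (l, k), q c • R c

/-- The matrix `Ψ̄` with regular pilots. -/
def psiBarRP {τp : ℕ} (τd : ℕ) (l : Φ) (k : Fin K) (R : Φ × Fin K → Matrix (Fin M) (Fin M) ℂ)
    (noiseVar : ℝ≥0) (v : Fin K → ℝ≥0) (q ρ : Φ × Fin K → ℝ) (φ : Φ × Fin K → Fin τp → ℂ) :
    Matrix (Fin M) (Fin M) ℂ :=
  (rpDenom K τp τd (q (l, k)) (ρ (l, k)) (v k))⁻¹ • dataInterference l k R ρ v
    + (q (l, k) + 2 * τd * (ρ (l, k) * v k) / τp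
        + (ρ (l, k) * v k) ^ 2 * τd * ((τd : ℝ) + 1) / (q (l, k) * (τp : ℝ) ^ 2))⁻¹
          • pilotContamination l k R q φ
    + ((noiseVar : ℝ) / (q (l, k) * τp + ρ (l, k) * v k * τd)) • (1 : Matrix (Fin M) (Fin M) ℂ)

/-- The matrix `Ψ̄` with superimposed pilots. -/
def psiBarSP {τc : ℕ} (l : Φ) (k : Fin K) (R : Φ × Fin K → Matrix (Fin M) (Fin M) ℂ)
    (noiseVar : ℝ≥0) (v : Fin K → ℝ≥0) (q ρ : Φ × Fin K → ℝ) (φ : Φ × Fin K → Fin τc → ℂ) :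
    Matrix (Fin M) (Fin M) ℂ :=
  ((τc : ℝ) * (q (l, k) + ρ (l, k) * v k))⁻¹ • dataInterference l k R ρ v
    + ((q (l, k) + ρ (l, k) * v k) ^ 2 / q (l, k)
        + ρ (l, k) * v k * (2 * q (l, k) + ρ (l, k) * v k) / (q (l, k) * τc))⁻¹
          • pilotContamination l k R q φ
    + ((noiseVar : ℝ) / (τc * (q (l, k) + ρ (l, k) * v k))) • (1 : Matrix (Fin M) (Fin M) ℂ)

end Bounds

end DataAided

end

/-! The observation is a sum of channels and noise columns whose coefficients depend on the symbols
alone: the channel of user c enters with uᴴ x_c, and the noise of slot t with the conjugate of u_t.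
Channels and noise columns are centred, mutually independent and independent of these coefficients.
All cross terms of E zzᴴ therefore vanish and each covariance is weighted by the second moment of
its coefficient (`integral_sum_mul_star_sum`, `IsAffineSignal.corrMatrix_eq`). The vector u is the
dual vector of column k of X̂: it lies in the span of the columns and uᴴ x̂_{k'} is 1 or 0 according
to whether k' = k. Estimation errors and foreign data are white and independent of the estimates,
hence of u, so they contribute their variance times the energy of u in the data slots.

Subtracting the claimed bound leaves a combination of covariances and the identity, with nonnegative
weights once three scalar quantities are bounded below (`IsAffineSignal.posSemidef_corrMatrix_sub`):
E‖u‖², the mean energy of u in the data slots, and E|uᴴ p|², where p is the pilot part of column k.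
For E‖u‖², Cauchy-Schwarz applied to uᴴ x̂_k = 1 and Jensen for 1/x suffice. Below, w is the
variance of a data entry of column k of X̂.

Regular pilots. Let N = ‖p_k‖². The padded vector (p_k/N, 0) is also dual to column k, so uᴴ(p_k, 0)
= N‖u‖², and the pilot bound is Jensen for the square. For the data slots, let t be dual to s_k
among the data blocks s_j. Then N t + s_k has inner product 1 with the data block of u and squared
norm N²‖t‖² + 2N + ‖s_k‖² (`one_le_sqNorm_inr_mul`). An inverse moment of a Gaussian vector gives
E‖t‖² ≤ 1/(w(τd - K)), and Jensen concludes.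

Superimposed pilots. Every slot carries data, so only E|uᴴ m_k|² is new, m_k being the mean of
column k. Fix the other columns and put d = τc - K. Then u is the projection of column k onto their
orthogonal complement, of dimension d + 1, divided by its squared norm. In a basis whose first
vector is aligned with the projection of m_k, the expectation factors under a Laplace transform and
becomes a one-dimensional integral, bounded below by a rational subsolution (`lintegral_energy_ge`).
The result is (1 + d w ‖u₀‖²)⁻², where u₀ is the dual vector obtained when column k is replaced by
m_k. This is convex and decreasing in ‖u₀‖², so an upper bound of E‖u₀‖² is enough. Now u₀ is
m_k/‖m_k‖² minus one term per other column. Reflecting the Gaussian part of one of these columns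
along m_k preserves the law, flips its term and fixes the others. The terms are thus orthogonal in
L², each of energy at most 1/(‖m_k‖² d) (`lintegral_sqNorm_dualVec_of_deterministic_le`). -/

noncomputable section

namespace DataAided

set_option linter.unusedSectionVars false

/-! ### Dual vectors of a finite family -/


section Dual

variable {T ι : Type*} [Fintype T] [Fintype ι] [DecidableEq ι]

/-- The squared Euclidean norm of a complex vector. -/
def sqNorm (u : T → ℂ) : ℝ := ∑ t, ‖u t‖ ^ 2

/-- The matrix with columns `x j`. -/
def colMatrix (x : ι → T → ℂ) : Matrix T ι ℂ := Matrix.of fun t j => x j t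

/-- The Gram determinant of a family of vectors. -/
def gramDet (x : ι → T → ℂ) : ℂ := ((colMatrix x)ᴴ * colMatrix x).det

/-- The `k`-th column of `X (Xᴴ X)⁻¹` where `X` has columns `x j`. -/
def dualVec (x : ι → T → ℂ) (k : ι) : T → ℂ :=
  fun t => (colMatrix x * ((colMatrix x)ᴴ * colMatrix x)⁻¹) t k

lemma sqNorm_nonneg (u : T → ℂ) : 0 ≤ sqNorm u := Finset.sum_nonneg fun _ _ => by positivity

lemma sqNorm_eq_norm_sq (u : T → ℂ) : sqNorm u = ‖WithLp.toLp 2 u‖ ^ 2 := by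
  rw [EuclideanSpace.norm_sq_eq]; rfl

lemma inner_toLp_eq (a b : T → ℂ) :
    inner ℂ (WithLp.toLp 2 a : EuclideanSpace ℂ T) (WithLp.toLp 2 b) = star a ⬝ᵥ b := by
  rw [EuclideanSpace.inner_eq_star_dotProduct, dotProduct_comm]

lemma star_dotProduct_self (u : T → ℂ) : star u ⬝ᵥ u = (sqNorm u : ℂ) := by
  rw [← inner_toLp_eq, inner_self_eq_norm_sq_to_K, sqNorm_eq_norm_sq]
  simp

lemma sqNorm_pos {u : T → ℂ} (hu : u ≠ 0) : 0 < sqNorm u := by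
  rw [sqNorm_eq_norm_sq]
  have : (WithLp.toLp 2 u : EuclideanSpace ℂ T) ≠ 0 := by simpa using hu
  positivity

lemma sqNorm_eq_zero {u : T → ℂ} : sqNorm u = 0 ↔ u = 0 := by
  constructor
  · intro h
    by_contra hu
    exact (sqNorm_pos hu).ne' h
  · rintro rfl
    simp [sqNorm]

lemma norm_star_dotProduct_sq_le (a b : T → ℂ) : ‖star a ⬝ᵥ b‖ ^ 2 ≤ sqNorm a * sqNorm b := by
  rw [← inner_toLp_eq, sqNorm_eq_norm_sq, sqNorm_eq_norm_sq, ← mul_pow]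
  exact pow_le_pow_left₀ (norm_nonneg _) (norm_inner_le_norm _ _) 2

lemma star_dotProduct_comm (a b : T → ℂ) : star a ⬝ᵥ b = star (star b ⬝ᵥ a) := by
  rw [star_dotProduct, dotProduct_comm]

lemma norm_star_dotProduct_comm (a b : T → ℂ) : ‖star a ⬝ᵥ b‖ = ‖star b ⬝ᵥ a‖ := by
  rw [star_dotProduct_comm, norm_star]

lemma sqNorm_add (a b : T → ℂ) :
    sqNorm (a + b) = sqNorm a + 2 * (star a ⬝ᵥ b).re + sqNorm b := by
  have h : (sqNorm (a + b) : ℂ) = sqNorm a + (star a ⬝ᵥ b + star (star a ⬝ᵥ b)) + sqNorm b := by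
    rw [← star_dotProduct_self, ← star_dotProduct_self, ← star_dotProduct_self,
      ← star_dotProduct_comm b a, star_add, add_dotProduct, dotProduct_add, dotProduct_add]
    ring
  have h2 := congrArg Complex.re h
  simp only [Complex.ofReal_re, Complex.add_re] at h2
  rw [h2]
  have : (star (star a ⬝ᵥ b)).re = (star a ⬝ᵥ b).re := rfl
  rw [this]; ring

lemma sqNorm_smul (c : ℂ) (a : T → ℂ) : sqNorm (c • a) = ‖c‖ ^ 2 * sqNorm a := by
  simp [sqNorm, Finset.mul_sum, mul_pow]

lemma colMatrix_mulVec (x : ι → T → ℂ) (c : ι → ℂ) : colMatrix x *ᵥ c = ∑ j, c j • x j := by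
  ext t
  simp [colMatrix, mulVec, dotProduct, mul_comm]

lemma colMatrix_conjTranspose_mulVec (x : ι → T → ℂ) (y : T → ℂ) (j : ι) :
    ((colMatrix x)ᴴ *ᵥ y) j = star (x j) ⬝ᵥ y := rfl

/-- XᴴX and X have the same kernel. The Gram determinant serves as a continuous test for linear
independence, so that almost sure independence is a statement about a measurable set. -/
lemma gramDet_ne_zero_iff {x : ι → T → ℂ} : gramDet x ≠ 0 ↔ LinearIndependent ℂ x := by
  have h1 : LinearIndependent ℂ x ↔ Function.Injective (colMatrix x).mulVec := by
    rw [Matrix.mulVec_injective_iff]; rfl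
  have h2 : gramDet x ≠ 0 ↔ Function.Injective ((colMatrix x)ᴴ * colMatrix x).mulVec := by
    rw [Matrix.mulVec_injective_iff, Matrix.linearIndependent_cols_iff_isUnit,
      Matrix.isUnit_iff_isUnit_det, isUnit_iff_ne_zero]
    rfl
  rw [h1, h2]
  have key (A : Matrix T ι ℂ) : Function.Injective A.mulVec ↔ ∀ c, A *ᵥ c = 0 → c = 0 := by
    rw [← Matrix.coe_mulVecLin, injective_iff_map_eq_zero]
  have key' (A : Matrix ι ι ℂ) : Function.Injective A.mulVec ↔ ∀ c, A *ᵥ c = 0 → c = 0 := by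
    rw [← Matrix.coe_mulVecLin, injective_iff_map_eq_zero]
  rw [key, key']
  simp only [Matrix.conjTranspose_mul_self_mulVec_eq_zero]

variable {x : ι → T → ℂ}

lemma dualVec_eq_mulVec (x : ι → T → ℂ) (k : ι) :
    dualVec x k = colMatrix x *ᵥ (fun j => (((colMatrix x)ᴴ * colMatrix x)⁻¹) j k) := rfl

lemma dualVec_eq_sum (x : ι → T → ℂ) (k : ι) :
    dualVec x k = ∑ j, (((colMatrix x)ᴴ * colMatrix x)⁻¹) j k • x j := by
  rw [dualVec_eq_mulVec, colMatrix_mulVec]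

lemma star_dotProduct_dualVec (hx : gramDet x ≠ 0) (j k : ι) :
    star (x j) ⬝ᵥ dualVec x k = if j = k then 1 else 0 := by
  rw [← colMatrix_conjTranspose_mulVec, dualVec_eq_mulVec, mulVec_mulVec]
  have h : ((colMatrix x)ᴴ * colMatrix x) * ((colMatrix x)ᴴ * colMatrix x)⁻¹ = 1 :=
    Matrix.mul_nonsing_inv _ (isUnit_iff_ne_zero.mpr hx)
  have := congrFun (congrFun h j) k
  rw [Matrix.one_apply] at this
  rw [← this]
  rfl

lemma star_dualVec_dotProduct (hx : gramDet x ≠ 0) (j k : ι) :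
    star (dualVec x k) ⬝ᵥ x j = if j = k then 1 else 0 := by
  rw [star_dotProduct_comm, star_dotProduct_dualVec hx]
  split_ifs <;> simp

/-- Membership in the span together with the duality relations determines the dual vector; every
explicit formula for it below is verified through this characterisation. -/
lemma eq_dualVec_of_dual (hx : gramDet x ≠ 0) {k : ι} {y : T → ℂ} (c : ι → ℂ)
    (hy : y = ∑ j, c j • x j) (hd : ∀ j, star (x j) ⬝ᵥ y = if j = k then 1 else 0) :
    y = dualVec x k := by
  rw [← colMatrix_mulVec] at hy
  have h1 : ((colMatrix x)ᴴ * colMatrix x) *ᵥ c = Pi.single k 1 := by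
    ext j
    rw [← mulVec_mulVec, ← hy, colMatrix_conjTranspose_mulVec, hd, Pi.single_apply]
  have h2 : c = ((colMatrix x)ᴴ * colMatrix x)⁻¹ *ᵥ Pi.single k 1 := by
    rw [← h1, mulVec_mulVec, Matrix.nonsing_inv_mul _ (isUnit_iff_ne_zero.mpr hx), one_mulVec]
  rw [hy, h2, dualVec_eq_mulVec]
  congr 1
  ext j
  simp

/-- The dual vector lies in the span, so its inner product with y sees only the products of y with
the columns, and these agree with its own. In other words, it is the orthogonal projection of y onto
the span. -/
lemma star_dualVec_dotProduct_eq_of_dual (hx : gramDet x ≠ 0) {k : ι} {y : T → ℂ}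
    (hd : ∀ j, star (x j) ⬝ᵥ y = if j = k then 1 else 0) :
    star (dualVec x k) ⬝ᵥ y = (sqNorm (dualVec x k) : ℂ) := by
  have h (z : T → ℂ) : star (dualVec x k) ⬝ᵥ z
      = ∑ j, star ((((colMatrix x)ᴴ * colMatrix x)⁻¹) j k) • (star (x j) ⬝ᵥ z) := by
    rw [dualVec_eq_sum]
    simp only [star_sum, star_smul, sum_dotProduct, smul_dotProduct]
  rw [← star_dotProduct_self, h, h]
  simp only [hd, star_dotProduct_dualVec hx]

/-- As the projection of every vector satisfying the duality relations, the dual vector is the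
shortest of them. -/
lemma sqNorm_dualVec_le_of_dual (hx : gramDet x ≠ 0) {k : ι} {y : T → ℂ}
    (hd : ∀ j, star (x j) ⬝ᵥ y = if j = k then 1 else 0) :
    sqNorm (dualVec x k) ≤ sqNorm y := by
  have h1 := norm_star_dotProduct_sq_le (dualVec x k) y
  rw [star_dualVec_dotProduct_eq_of_dual hx hd, Complex.norm_real, Real.norm_eq_abs, sq_abs,
    sq] at h1
  rcases (sqNorm_nonneg (dualVec x k)).eq_or_lt with h0 | h0
  · rw [← h0]; exact sqNorm_nonneg _
  · exact le_of_mul_le_mul_left h1 h0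

/-- Cauchy-Schwarz for uᴴ x_k = 1. Combined with Jensen this gives the noise coefficient in both
pilot schemes. -/
lemma one_le_sqNorm_dualVec_mul (hx : gramDet x ≠ 0) (k : ι) :
    1 ≤ sqNorm (dualVec x k) * sqNorm (x k) := by
  have h := norm_star_dotProduct_sq_le (dualVec x k) (x k)
  rw [star_dualVec_dotProduct hx] at h
  simpa using h

/-- `sqNorm u = (Xᴴ X)⁻¹ k k`. -/
lemma gram_inv_apply_self (hx : gramDet x ≠ 0) (k : ι) :
    (((colMatrix x)ᴴ * colMatrix x)⁻¹) k k = (sqNorm (dualVec x k) : ℂ) := by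
  have h : star (dualVec x k) ⬝ᵥ dualVec x k
      = ∑ j, (((colMatrix x)ᴴ * colMatrix x)⁻¹) j k • (star (dualVec x k) ⬝ᵥ x j) := by
    conv_lhs => rw [dualVec_eq_sum x k, dotProduct_sum, ← dualVec_eq_sum x k]
    simp only [dotProduct_smul]
  rw [← star_dotProduct_self, h]
  simp [star_dualVec_dotProduct hx]

end Dual

/-! ### One-dimensional Gaussian integrals -/

section RealGaussian

/-- Completing the square: a Gaussian tilted by exp(-t x²) is a multiple of the Gaussian with mean
and variance both divided by 1 + 2tW. -/
lemma gaussianPDFReal_mul_exp_neg_sq (b t : ℝ) {W : ℝ≥0} (hW : W ≠ 0) (ht : 0 ≤ t) (x : ℝ) :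
    gaussianPDFReal b W x * Real.exp (-t * x ^ 2)
      = (√(1 + 2 * t * W))⁻¹ * Real.exp (-t * b ^ 2 / (1 + 2 * t * W))
        * gaussianPDFReal (b / (1 + 2 * t * W)) (W / (1 + 2 * t.toNNReal * W)) x := by
  have hW' : (0 : ℝ) < W := by positivity
  set D : ℝ := 1 + 2 * t * W with hD
  have hD0 : 0 < D := by positivity
  have hc : ((W / (1 + 2 * t.toNNReal * W) : ℝ≥0) : ℝ) = W / D := by
    push_cast [Real.coe_toNNReal t ht]; rfl
  rw [gaussianPDFReal, gaussianPDFReal, hc]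
  have h1 : √(2 * Real.pi * (W / D)) = √(2 * Real.pi * W) * (√D)⁻¹ := by
    rw [← Real.sqrt_inv, ← Real.sqrt_mul (by positivity), div_eq_mul_inv, ← mul_assoc]
  have hs : (√D) ≠ 0 := by positivity
  have hs2 : √(2 * Real.pi * W) ≠ 0 := by positivity
  rw [h1, mul_inv, inv_inv, mul_assoc, ← Real.exp_add]
  have h2 : -(x - b) ^ 2 / (2 * (W : ℝ)) + -t * x ^ 2
      = -t * b ^ 2 / D + -(x - b / D) ^ 2 / (2 * (W / D)) := by
    have : t = (D - 1) / (2 * W) := by rw [hD]; field_simp; ring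
    rw [this]
    field_simp
    ring
  rw [h2, Real.exp_add]
  field_simp

lemma lintegral_exp_neg_sq_mul_gaussianReal (b t : ℝ) {W : ℝ≥0} (hW : W ≠ 0) (ht : 0 ≤ t)
    {f : ℝ → ENNReal} (hf : Measurable f) :
    ∫⁻ x, ENNReal.ofReal (Real.exp (-t * x ^ 2)) * f x ∂gaussianReal b W
      = ENNReal.ofReal ((√(1 + 2 * t * W))⁻¹ * Real.exp (-t * b ^ 2 / (1 + 2 * t * W)))
        * ∫⁻ x, f x ∂gaussianReal (b / (1 + 2 * t * W)) (W / (1 + 2 * t.toNNReal * W)) := by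
  have hW2 : W / (1 + 2 * t.toNNReal * W) ≠ 0 := by positivity
  rw [gaussianReal_of_var_ne_zero _ hW, gaussianReal_of_var_ne_zero _ hW2,
    lintegral_withDensity_eq_lintegral_mul _ (measurable_gaussianPDF _ _) (by fun_prop),
    lintegral_withDensity_eq_lintegral_mul _ (measurable_gaussianPDF _ _) hf,
    ← lintegral_const_mul _ (by fun_prop)]
  refine lintegral_congr fun x => ?_
  simp only [Pi.mul_apply, gaussianPDF]
  rw [← mul_assoc, ← mul_assoc, ← ENNReal.ofReal_mul (gaussianPDFReal_nonneg _ _ _),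
    gaussianPDFReal_mul_exp_neg_sq b t hW ht, ENNReal.ofReal_mul (by positivity)]

lemma lintegral_sq_gaussianReal (b : ℝ) (W : ℝ≥0) :
    ∫⁻ x, ENNReal.ofReal (x ^ 2) ∂gaussianReal b W = ENNReal.ofReal (W + b ^ 2) := by
  have hm : MemLp id 2 (gaussianReal b W) := memLp_id_gaussianReal' 2 (by simp)
  rw [← ofReal_integral_eq_lintegral_ofReal (by simpa using hm.integrable_sq)
    (ae_of_all _ fun x => by positivity)]
  congr 1
  have h := variance_eq_sub hm
  simp only [variance_id_gaussianReal, Pi.pow_apply, id_eq, integral_id_gaussianReal] at h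
  linarith

lemma lintegral_exp_neg_sq_gaussianReal (b t : ℝ) {W : ℝ≥0} (hW : W ≠ 0) (ht : 0 ≤ t) :
    ∫⁻ x, ENNReal.ofReal (Real.exp (-t * x ^ 2)) ∂gaussianReal b W
      = ENNReal.ofReal ((√(1 + 2 * t * W))⁻¹ * Real.exp (-t * b ^ 2 / (1 + 2 * t * W))) := by
  have h := lintegral_exp_neg_sq_mul_gaussianReal b t hW ht (f := fun _ => 1) measurable_const
  simpa using h

lemma lintegral_exp_neg_sq_mul_sq_gaussianReal (b t : ℝ) {W : ℝ≥0} (hW : W ≠ 0) (ht : 0 ≤ t) :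
    ∫⁻ x, ENNReal.ofReal (Real.exp (-t * x ^ 2)) * ENNReal.ofReal (x ^ 2) ∂gaussianReal b W
      = ENNReal.ofReal ((√(1 + 2 * t * W))⁻¹ * Real.exp (-t * b ^ 2 / (1 + 2 * t * W))
        * (W / (1 + 2 * t * W) + b ^ 2 / (1 + 2 * t * W) ^ 2)) := by
  rw [lintegral_exp_neg_sq_mul_gaussianReal b t hW ht (by fun_prop), lintegral_sq_gaussianReal,
    ← ENNReal.ofReal_mul (by positivity)]
  push_cast [Real.coe_toNNReal t ht]
  rw [div_pow]

end RealGaussian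

/-! ### Complex Gaussian integrals -/

section ComplexGaussian

instance (v : ℝ≥0) : IsProbabilityMeasure (complexGaussian v) :=
  Measure.isProbabilityMeasure_map (by fun_prop)

/-- Passage to two independent real coordinates of equal variance, under which exponentials of the
squared modulus factor. -/
lemma lintegral_complexGaussian_affine (b : ℂ) (c : ℝ) (v : ℝ≥0) {F : ℂ → ENNReal}
    (hF : Measurable F) :
    ∫⁻ z, F (b + c * z) ∂complexGaussian v
      = ∫⁻ p : ℝ × ℝ, F ⟨p.1, p.2⟩ ∂((gaussianReal b.re (.mk (c ^ 2) (sq_nonneg c) * (v / 2))).prod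
          (gaussianReal b.im (.mk (c ^ 2) (sq_nonneg c) * (v / 2)))) := by
  have hmap (d : ℝ) : (gaussianReal 0 (v / 2)).map (fun x => d + c * x)
      = gaussianReal d (.mk (c ^ 2) (sq_nonneg c) * (v / 2)) := by
    have : (fun x : ℝ => d + c * x) = (fun x => d + x) ∘ (fun x => c * x) := rfl
    rw [this, ← Measure.map_map (by fun_prop) (by fun_prop), gaussianReal_map_const_mul,
      gaussianReal_map_const_add]
    simp
  rw [← hmap, ← hmap, Measure.map_prod_map _ _ (by fun_prop) (by fun_prop), complexGaussian,
    lintegral_map (by fun_prop) (by fun_prop), lintegral_map _ (by fun_prop)]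
  · refine lintegral_congr fun p => ?_
    congr 1
    apply Complex.ext <;> simp [Complex.measurableEquivRealProd_symm_apply]
  · exact hF.comp Complex.measurableEquivRealProd.symm.measurable

lemma ofReal_exp_neg_norm_sq (t a b : ℝ) :
    ENNReal.ofReal (Real.exp (-t * ‖(⟨a, b⟩ : ℂ)‖ ^ 2))
      = ENNReal.ofReal (Real.exp (-t * a ^ 2)) * ENNReal.ofReal (Real.exp (-t * b ^ 2)) := by
  rw [← ENNReal.ofReal_mul (by positivity), ← Real.exp_add, ← Complex.normSq_eq_norm_sq,
    Complex.normSq_mk]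
  congr 2; ring

lemma lintegral_exp_neg_norm_sq_complexGaussian (b : ℂ) (c : ℝ) (v : ℝ≥0) {t : ℝ} (ht : 0 ≤ t)
    (hw : 0 < c ^ 2 * v) :
    ∫⁻ z, ENNReal.ofReal (Real.exp (-t * ‖b + c * z‖ ^ 2)) ∂complexGaussian v
      = ENNReal.ofReal ((1 + t * (c ^ 2 * v))⁻¹
          * Real.exp (-t * ‖b‖ ^ 2 / (1 + t * (c ^ 2 * v)))) := by
  set W : ℝ≥0 := .mk (c ^ 2) (sq_nonneg c) * (v / 2) with hWdef
  have hW2 : (W : ℝ) = c ^ 2 * v / 2 := by rw [hWdef]; push_cast [NNReal.coe_mk]; ring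
  have hW : W ≠ 0 := by
    rw [← NNReal.coe_ne_zero, hW2]; positivity
  have hD : 1 + 2 * t * (W : ℝ) = 1 + t * (c ^ 2 * v) := by rw [hW2]; ring
  rw [lintegral_complexGaussian_affine b c v
    (F := fun z => ENNReal.ofReal (Real.exp (-t * ‖z‖ ^ 2))) (by fun_prop)]
  simp only [ofReal_exp_neg_norm_sq]
  rw [lintegral_prod_mul (f := fun x : ℝ => ENNReal.ofReal (Real.exp (-t * x ^ 2)))
    (g := fun x : ℝ => ENNReal.ofReal (Real.exp (-t * x ^ 2))) (by fun_prop) (by fun_prop),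
    lintegral_exp_neg_sq_gaussianReal _ _ hW ht, lintegral_exp_neg_sq_gaussianReal _ _ hW ht, hD,
    ← ENNReal.ofReal_mul (by positivity)]
  congr 1
  have hs : (√(1 + t * (c ^ 2 * v)))⁻¹ * (√(1 + t * (c ^ 2 * v)))⁻¹ = (1 + t * (c ^ 2 * v))⁻¹ := by
    rw [← mul_inv, Real.mul_self_sqrt (by positivity)]
  rw [mul_mul_mul_comm, hs, ← Real.exp_add, ← Complex.normSq_eq_norm_sq, Complex.normSq_apply]
  congr 2; ring

lemma lintegral_norm_sq_mul_exp_neg_norm_sq_complexGaussian (b : ℂ) (c : ℝ) (v : ℝ≥0) {t : ℝ}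
    (ht : 0 ≤ t) (hw : 0 < c ^ 2 * v) :
    ∫⁻ z, ENNReal.ofReal (‖b + c * z‖ ^ 2 * Real.exp (-t * ‖b + c * z‖ ^ 2)) ∂complexGaussian v
      = ENNReal.ofReal ((c ^ 2 * v / (1 + t * (c ^ 2 * v)) ^ 2
            + ‖b‖ ^ 2 / (1 + t * (c ^ 2 * v)) ^ 3)
          * Real.exp (-t * ‖b‖ ^ 2 / (1 + t * (c ^ 2 * v)))) := by
  set W : ℝ≥0 := .mk (c ^ 2) (sq_nonneg c) * (v / 2) with hWdef
  have hW2 : (W : ℝ) = c ^ 2 * v / 2 := by rw [hWdef]; push_cast [NNReal.coe_mk]; ring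
  have hW : W ≠ 0 := by
    rw [← NNReal.coe_ne_zero, hW2]; positivity
  have hD : 1 + 2 * t * (W : ℝ) = 1 + t * (c ^ 2 * v) := by rw [hW2]; ring
  rw [lintegral_complexGaussian_affine b c v
    (F := fun z => ENNReal.ofReal (‖z‖ ^ 2 * Real.exp (-t * ‖z‖ ^ 2))) (by fun_prop)]
  have hsplit (p : ℝ × ℝ) : ENNReal.ofReal (‖(⟨p.1, p.2⟩ : ℂ)‖ ^ 2
      * Real.exp (-t * ‖(⟨p.1, p.2⟩ : ℂ)‖ ^ 2))
      = (ENNReal.ofReal (Real.exp (-t * p.1 ^ 2)) * ENNReal.ofReal (p.1 ^ 2))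
          * ENNReal.ofReal (Real.exp (-t * p.2 ^ 2))
        + ENNReal.ofReal (Real.exp (-t * p.1 ^ 2))
          * (ENNReal.ofReal (Real.exp (-t * p.2 ^ 2)) * ENNReal.ofReal (p.2 ^ 2)) := by
    rw [ENNReal.ofReal_mul (by positivity), ofReal_exp_neg_norm_sq, ← Complex.normSq_eq_norm_sq,
      Complex.normSq_mk, ← sq, ← sq, ENNReal.ofReal_add (by positivity) (by positivity)]
    ring
  simp only [hsplit]
  rw [lintegral_add_left (by fun_prop),
    lintegral_prod_mul
      (f := fun x : ℝ => ENNReal.ofReal (Real.exp (-t * x ^ 2)) * ENNReal.ofReal (x ^ 2))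
      (g := fun x : ℝ => ENNReal.ofReal (Real.exp (-t * x ^ 2))) (by fun_prop) (by fun_prop),
    lintegral_prod_mul (f := fun x : ℝ => ENNReal.ofReal (Real.exp (-t * x ^ 2)))
      (g := fun x : ℝ => ENNReal.ofReal (Real.exp (-t * x ^ 2)) * ENNReal.ofReal (x ^ 2))
      (by fun_prop) (by fun_prop),
    lintegral_exp_neg_sq_gaussianReal _ _ hW ht, lintegral_exp_neg_sq_gaussianReal _ _ hW ht,
    lintegral_exp_neg_sq_mul_sq_gaussianReal _ _ hW ht,
    lintegral_exp_neg_sq_mul_sq_gaussianReal _ _ hW ht, hD, hW2,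
    ← ENNReal.ofReal_mul (by positivity), ← ENNReal.ofReal_mul (by positivity),
    ← ENNReal.ofReal_add (by positivity) (by positivity)]
  congr 1
  set D := 1 + t * (c ^ 2 * v) with hDdef
  have hD0 : 0 < D := by positivity
  have hs : (√D)⁻¹ * (√D)⁻¹ = D⁻¹ := by
    rw [← mul_inv, Real.mul_self_sqrt (by positivity)]
  have he : Real.exp (-t * ‖b‖ ^ 2 / D)
      = Real.exp (-t * b.re ^ 2 / D) * Real.exp (-t * b.im ^ 2 / D) := by
    rw [← Real.exp_add, ← Complex.normSq_eq_norm_sq, Complex.normSq_apply]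
    congr 1; ring
  have hb : ‖b‖ ^ 2 = b.re ^ 2 + b.im ^ 2 := by
    rw [← Complex.normSq_eq_norm_sq, Complex.normSq_apply]; ring
  rw [he, hb]
  calc _ = ((√D)⁻¹ * (√D)⁻¹) * (Real.exp (-t * b.re ^ 2 / D) * Real.exp (-t * b.im ^ 2 / D))
        * (c ^ 2 * v / D + (b.re ^ 2 + b.im ^ 2) / D ^ 2) := by ring
    _ = _ := by rw [hs]; field_simp

lemma lintegral_norm_sq_complexGaussian (v : ℝ≥0) :
    ∫⁻ z, ENNReal.ofReal (‖z‖ ^ 2) ∂complexGaussian v = v := by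
  have h := lintegral_complexGaussian_affine 0 1 v
    (F := fun z => ENNReal.ofReal (‖z‖ ^ 2)) (by fun_prop)
  simp only [zero_add, Complex.ofReal_one, one_mul, Complex.zero_re, Complex.zero_im] at h
  have h1 : (NNReal.mk (1 ^ 2) (sq_nonneg (1 : ℝ)) * (v / 2) : ℝ≥0) = v / 2 := by
    ext; simp
  rw [h, h1]
  have hsplit (p : ℝ × ℝ) : ENNReal.ofReal (‖(⟨p.1, p.2⟩ : ℂ)‖ ^ 2)
      = ENNReal.ofReal (p.1 ^ 2) + ENNReal.ofReal (p.2 ^ 2) := by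
    rw [← Complex.normSq_eq_norm_sq, Complex.normSq_mk, ← sq, ← sq,
      ENNReal.ofReal_add (by positivity) (by positivity)]
  simp only [hsplit]
  rw [lintegral_add_left (by fun_prop)]
  have e1 := lintegral_prod_mul (μ := gaussianReal 0 (v / 2)) (ν := gaussianReal 0 (v / 2))
    (f := fun x : ℝ => ENNReal.ofReal (x ^ 2)) (g := fun _ => 1) (by fun_prop) (by fun_prop)
  have e2 := lintegral_prod_mul (μ := gaussianReal 0 (v / 2)) (ν := gaussianReal 0 (v / 2))
    (f := fun _ => 1) (g := fun x : ℝ => ENNReal.ofReal (x ^ 2)) (by fun_prop) (by fun_prop)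
  simp only [mul_one, one_mul, lintegral_one, measure_univ, lintegral_sq_gaussianReal] at e1 e2
  rw [e1, e2, ← ENNReal.ofReal_add (by positivity) (by positivity)]
  simp

end ComplexGaussian

/-! ### Vectors with i.i.d. complex Gaussian entries -/

section GaussianVector

variable {T κ : Type*} [Fintype T] [Fintype κ] [DecidableEq T] [DecidableEq κ]

/-- The law of a vector with i.i.d. `CN(0, v)` entries. -/
def gaussVec (T : Type*) [Fintype T] (v : ℝ≥0) : Measure (T → ℂ) :=
  Measure.pi fun _ => complexGaussian v

instance (v : ℝ≥0) : IsProbabilityMeasure (gaussVec T v) := by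
  unfold gaussVec; infer_instance

lemma charFunDual_complexGaussian (v : ℝ≥0) (L : StrongDual ℝ ℂ) :
    charFunDual (complexGaussian v) L
      = Complex.exp (-(v / 4 * ((L 1) ^ 2 + (L Complex.I) ^ 2) : ℝ)) := by
  have hL (x y : ℝ) : L ⟨x, y⟩ = x * L 1 + y * L Complex.I := by
    have : (⟨x, y⟩ : ℂ) = x • (1 : ℂ) + y • Complex.I := by
      apply Complex.ext <;> simp
    rw [this, map_add, map_smul, map_smul]; rfl
  rw [charFunDual_apply, complexGaussian, integral_map (by fun_prop) (by fun_prop)]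
  have hs (p : ℝ × ℝ) : Complex.exp (L (Complex.measurableEquivRealProd.symm p) * Complex.I)
      = Complex.exp ((L 1 : ℂ) * p.1 * Complex.I)
        * Complex.exp ((L Complex.I : ℂ) * p.2 * Complex.I) := by
    rw [Complex.measurableEquivRealProd_symm_apply, hL, ← Complex.exp_add]
    congr 1; push_cast; ring
  simp only [hs]
  rw [integral_prod_mul (f := fun x : ℝ => Complex.exp ((L 1 : ℂ) * x * Complex.I))
    (g := fun x : ℝ => Complex.exp ((L Complex.I : ℂ) * x * Complex.I)),
    ← charFun_apply_real, ← charFun_apply_real, charFun_gaussianReal, charFun_gaussianReal,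
    ← Complex.exp_add]
  congr 1
  push_cast
  ring

lemma charFunDual_gaussVec (v : ℝ≥0) (L : StrongDual ℝ (T → ℂ)) (ξ : T → ℂ)
    (hL : ∀ z, L z = (star ξ ⬝ᵥ z).re) :
    charFunDual (gaussVec T v) L = Complex.exp (-(v / 4 * sqNorm ξ : ℝ)) := by
  rw [gaussVec, charFunDual_pi]
  simp only [charFunDual_complexGaussian]
  rw [← Complex.exp_sum]
  congr 1
  rw [sqNorm, Finset.mul_sum]
  push_cast
  rw [Finset.sum_neg_distrib]
  congr 1
  refine Finset.sum_congr rfl fun t _ => ?_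
  congr 1
  have h1 : L (Pi.single t 1) = (ξ t).re := by
    simp [hL, dotProduct_single]
  have h2 : L (Pi.single t Complex.I) = (ξ t).im := by
    simp [hL, dotProduct_single]
  simp only [Function.comp_apply, ContinuousLinearMap.single_apply]
  rw [h1, h2]
  have h3 : ‖ξ t‖ ^ 2 = (ξ t).re ^ 2 + (ξ t).im ^ 2 := by
    rw [← Complex.normSq_eq_norm_sq, Complex.normSq_apply]; ring
  exact_mod_cast h3.symm

lemma exists_dual_eq_re_dotProduct (L : StrongDual ℝ (T → ℂ)) :
    ∃ ξ : T → ℂ, ∀ z, L z = (star ξ ⬝ᵥ z).re := by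
  refine ⟨fun t => ⟨L (Pi.single t 1), L (Pi.single t Complex.I)⟩, fun z => ?_⟩
  have hz : z = ∑ t, ((z t).re • (Pi.single t (1 : ℂ) : T → ℂ)
      + (z t).im • (Pi.single t Complex.I : T → ℂ)) := by
    ext s
    simp only [Finset.sum_apply, Pi.add_apply, Pi.smul_apply, Pi.single_apply, smul_ite, smul_zero]
    rw [Finset.sum_add_distrib]
    simp
  conv_lhs => rw [hz]
  rw [map_sum, dotProduct, Complex.re_sum]
  refine Finset.sum_congr rfl fun t _ => ?_
  rw [map_add, map_smul, map_smul]
  simp [mul_comm]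

/-- Coordinates of a white complex Gaussian vector along an orthonormal family are again white. -/
lemma measurePreserving_orthonormal (v : ℝ≥0) (e : κ → T → ℂ)
    (he : ∀ a b, star (e a) ⬝ᵥ e b = if a = b then 1 else 0) :
    MeasurePreserving (fun (g : T → ℂ) a => star (e a) ⬝ᵥ g) (gaussVec T v) (gaussVec κ v) := by
  let A : (T → ℂ) →L[ℝ] (κ → ℂ) :=
    LinearMap.toContinuousLinearMap
      { toFun := fun g a => star (e a) ⬝ᵥ g
        map_add' := fun g g' => by ext a; simp
        map_smul' := fun c g => by ext a; simp }
  have hA : ⇑A = fun (g : T → ℂ) a => star (e a) ⬝ᵥ g := rfl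
  refine ⟨by rw [← hA]; fun_prop, ?_⟩
  rw [← hA]
  have : IsProbabilityMeasure ((gaussVec T v).map A) :=
    Measure.isProbabilityMeasure_map (by fun_prop)
  refine Measure.ext_of_charFunDual ?_
  ext L
  obtain ⟨ξ, hξ⟩ := exists_dual_eq_re_dotProduct L
  rw [charFunDual_map, charFunDual_gaussVec v L ξ hξ,
    charFunDual_gaussVec v _ (∑ a, ξ a • e a)]
  -- The characteristic functions agree because ξ ↦ ∑ ξ_a e_a is an isometry for an orthonormal
  -- family.
  · congr 4
    have h : (sqNorm (∑ a, ξ a • e a) : ℂ) = sqNorm ξ := by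
      rw [← star_dotProduct_self, ← star_dotProduct_self, dotProduct_sum]
      simp only [dotProduct]
      refine Finset.sum_congr rfl fun a _ => ?_
      change star (∑ a, ξ a • e a) ⬝ᵥ (ξ a • e a) = _
      rw [dotProduct_smul, star_sum, sum_dotProduct]
      simp only [star_smul, smul_dotProduct, he]
      simp [mul_comm]
    exact_mod_cast h
  · intro z
    rw [ContinuousLinearMap.comp_apply, hξ, hA]
    congr 1
    rw [star_sum, sum_dotProduct]
    simp only [star_smul, smul_dotProduct]
    rfl

lemma lintegral_gaussVec_prod (v : ℝ≥0) {F : T → ℂ → ENNReal} (hF : ∀ a, Measurable (F a)) :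
    ∫⁻ g, ∏ a, F a (g a) ∂gaussVec T v = ∏ a, ∫⁻ z, F a z ∂complexGaussian v := by
  have hi : iIndepFun (fun a (g : T → ℂ) => F a (g a)) (gaussVec T v) :=
    iIndepFun_pi fun a => (hF a).aemeasurable
  rw [lintegral_prod_eq_prod_lintegral_of_indepFun _ _ hi fun a => by fun_prop]
  refine Finset.prod_congr rfl fun a _ => ?_
  exact (measurePreserving_eval (fun _ : T => complexGaussian v) a).lintegral_comp (hF a)

/-! ### Laplace representations -/

/-- At N = 0 both sides are ⊤, so the formula can be used before N is known to be almost surely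
positive. -/
lemma lintegral_exp_neg_mul_Ioi {N : ℝ} (hN : 0 ≤ N) :
    ∫⁻ t in Set.Ioi (0 : ℝ), ENNReal.ofReal (Real.exp (-t * N)) = (ENNReal.ofReal N)⁻¹ := by
  rcases hN.eq_or_lt with rfl | h
  · simp
  · have hi : IntegrableOn (fun t : ℝ => Real.exp (-N * t)) (Set.Ioi 0) :=
      integrableOn_exp_mul_Ioi (by linarith) 0
    have he (t : ℝ) : -t * N = -N * t := by ring
    simp only [he]
    rw [← ofReal_integral_eq_lintegral_ofReal hi (ae_of_all _ fun _ => by positivity),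
      integral_exp_mul_Ioi (by linarith), ← ENNReal.ofReal_inv_of_pos h]
    congr 1
    simp

lemma lintegral_mul_exp_neg_mul_Ioi {N : ℝ} (hN : 0 < N) :
    ∫⁻ t in Set.Ioi (0 : ℝ), ENNReal.ofReal (t * Real.exp (-t * N)) = ENNReal.ofReal (1 / N ^ 2) := by
  have h := Real.integral_rpow_mul_exp_neg_mul_Ioi (a := 2) (r := N) (by norm_num) hN
  have hΓ : Real.Gamma 2 = 1 := by
    rw [show (2 : ℝ) = (1 : ℕ) + 1 by norm_num, Real.Gamma_nat_eq_factorial]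
    simp
  have he : ∀ t ∈ Set.Ioi (0 : ℝ), t ^ ((2 : ℝ) - 1) * Real.exp (-(N * t))
      = t * Real.exp (-t * N) := by
    intro t _
    rw [show (2 : ℝ) - 1 = 1 by norm_num, Real.rpow_one]
    congr 2; ring
  rw [setIntegral_congr_fun measurableSet_Ioi he, hΓ, mul_one] at h
  have h2 : (1 / N) ^ (2 : ℝ) = 1 / N ^ 2 := by
    rw [show (2 : ℝ) = ((2 : ℕ) : ℝ) by norm_num, Real.rpow_natCast, div_pow, one_pow]
  rw [h2] at h
  have hi : IntegrableOn (fun t : ℝ => t * Real.exp (-t * N)) (Set.Ioi 0) := by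
    -- A non-integrable function would have Bochner integral 0, against the positive value already
    -- computed.
    by_contra hc
    rw [integral_undef hc] at h
    have : 0 < 1 / N ^ 2 := by positivity
    linarith
  rw [← h, ofReal_integral_eq_lintegral_ofReal hi]
  filter_upwards [ae_restrict_mem measurableSet_Ioi] with t ht
  have : (0 : ℝ) < t := ht
  positivity

/-- Convergence needs exponent at least two. The exponent will be the dimension of the complement of
the other columns, which is where a spare slot beyond K is used. -/
lemma lintegral_one_add_mul_pow_neg {w : ℝ} (hw : 0 < w) (n : ℕ) :
    ∫⁻ t in Set.Ioi (0 : ℝ), ENNReal.ofReal (((1 + t * w) ^ (n + 2))⁻¹)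
      = ENNReal.ofReal (1 / (w * (n + 1))) := by
  have hpos : ∀ t ∈ Set.Ioi (0 : ℝ), 0 < 1 + t * w := fun t ht => by
    have : (0 : ℝ) < t := ht
    positivity
  set G : ℝ → ℝ := fun t => -(1 / (w * (n + 1))) * ((1 + t * w) ^ (n + 1))⁻¹ with hG
  have hderiv : ∀ t ∈ Set.Ici (0 : ℝ), HasDerivAt G (((1 + t * w) ^ (n + 2))⁻¹) t := by
    intro t ht
    have ht' : (0 : ℝ) ≤ t := ht
    have h0 : 0 < 1 + t * w := by positivity
    have h1 : HasDerivAt (fun t : ℝ => 1 + t * w) w t := by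
      simpa using ((hasDerivAt_id t).mul_const w).const_add 1
    have h2 := ((h1.pow (n + 1)).inv (pow_pos h0 _).ne').const_mul (-(1 / (w * (n + 1))))
    refine h2.congr_deriv ?_
    simp only [Pi.pow_apply, Nat.add_sub_cancel]
    push_cast
    field_simp
    ring
  have hlim : Filter.Tendsto G Filter.atTop (nhds 0) := by
    have h1 : Filter.Tendsto (fun t : ℝ => (1 + t * w) ^ (n + 1)) Filter.atTop Filter.atTop := by
      refine (Filter.tendsto_pow_atTop (by simp)).comp ?_
      exact Filter.tendsto_atTop_add_const_left _ _ (Filter.tendsto_id.atTop_mul_const hw)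
    have h2 := h1.inv_tendsto_atTop.const_mul (-(1 / (w * (n + 1))))
    simpa [hG] using h2
  have hnn : ∀ t ∈ Set.Ioi (0 : ℝ), 0 ≤ ((1 + t * w) ^ (n + 2))⁻¹ := fun t ht => by
    have := hpos t ht
    positivity
  have hi := integrableOn_Ioi_deriv_of_nonneg
    (hderiv 0 (by simp)).continuousAt.continuousWithinAt
    (fun t ht => hderiv t (Set.Ioi_subset_Ici_self ht)) hnn hlim
  have hint := integral_Ioi_of_hasDerivAt_of_tendsto
    (hderiv 0 (by simp)).continuousAt.continuousWithinAt
    (fun t ht => hderiv t (Set.Ioi_subset_Ici_self ht)) hi hlim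
  rw [← ofReal_integral_eq_lintegral_ofReal hi, hint]
  · congr 1; simp [hG]
  · filter_upwards [ae_restrict_mem measurableSet_Ioi] with t ht using hnn t ht

/-- Inverse moment of a noncentral complex Gaussian vector with at least two entries. -/
lemma lintegral_inv_sum_norm_sq_le (b : T → ℂ) (c : ℝ) (v : ℝ≥0) (hw : 0 < c ^ 2 * v)
    (hT : 2 ≤ Fintype.card T) :
    ∫⁻ g, (ENNReal.ofReal (∑ a, ‖b a + c * g a‖ ^ 2))⁻¹ ∂gaussVec T v
      ≤ ENNReal.ofReal (1 / (c ^ 2 * v * (Fintype.card T - 1))) := by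
  have h1 : ∀ g : T → ℂ, (ENNReal.ofReal (∑ a, ‖b a + c * g a‖ ^ 2))⁻¹
      = ∫⁻ t in Set.Ioi (0 : ℝ), ∏ a, ENNReal.ofReal (Real.exp (-t * ‖b a + c * g a‖ ^ 2)) := by
    intro g
    rw [← lintegral_exp_neg_mul_Ioi (Finset.sum_nonneg fun _ _ => by positivity)]
    refine lintegral_congr fun t => ?_
    rw [← ENNReal.ofReal_prod_of_nonneg fun _ _ => by positivity, ← Real.exp_sum, Finset.mul_sum]
  simp only [h1]
  rw [lintegral_lintegral_swap]
  swap
  · apply Measurable.aemeasurable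
    unfold Function.uncurry
    fun_prop
  obtain ⟨n, hn⟩ : ∃ n, Fintype.card T = n + 2 := ⟨_, (Nat.sub_add_cancel hT).symm⟩
  have hc : (Fintype.card T : ℝ) - 1 = n + 1 := by rw [hn]; push_cast; ring
  rw [hc, ← lintegral_one_add_mul_pow_neg hw n]
  refine setLIntegral_mono' measurableSet_Ioi fun t ht => ?_
  have ht' : (0 : ℝ) < t := ht
  rw [lintegral_gaussVec_prod v (F := fun a z => ENNReal.ofReal
    (Real.exp (-t * ‖b a + c * z‖ ^ 2))) (fun a => by fun_prop)]
  simp only [lintegral_exp_neg_norm_sq_complexGaussian _ c v ht'.le hw]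
  -- A nonzero mean only decreases the Laplace transform: the exponential factor is at most one and
  -- is dropped.
  calc ∏ a, ENNReal.ofReal ((1 + t * (c ^ 2 * v))⁻¹
          * Real.exp (-t * ‖b a‖ ^ 2 / (1 + t * (c ^ 2 * v))))
      ≤ ∏ _a : T, ENNReal.ofReal ((1 + t * (c ^ 2 * v))⁻¹) := by
        refine Finset.prod_le_prod' fun a _ => ENNReal.ofReal_le_ofReal ?_
        refine mul_le_of_le_one_right (by positivity) (Real.exp_le_one_iff.mpr ?_)
        rw [neg_mul, neg_div]
        exact neg_nonpos.mpr (by positivity)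
    _ = _ := by
        rw [Finset.prod_const, Finset.card_univ, hn, ← ENNReal.ofReal_pow (by positivity), inv_pow]

end GaussianVector

/-! ### The normalised energy of the leading coordinate -/

section LeadingCoordinate

/-- Rational factor of a subsolution for the energy integral. -/
def energyFactor (lam j s : ℝ) : ℝ :=
  (1 - s) * (1 + lam * s) / (lam * s + j) + lam * s ^ 2 / (lam * s + j) ^ 2
    - 2 * (j - 1) * ((1 - s) * (lam * s)) / (lam * s + j) ^ 3

/-- Derivative of `energyFactor` in `s`. -/
def energyFactorDeriv (lam j s : ℝ) : ℝ :=
  ((-(1 + lam * s) + (1 - s) * lam) * (lam * s + j) - (1 - s) * (1 + lam * s) * lam)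
      / (lam * s + j) ^ 2
    + (2 * lam * s * (lam * s + j) ^ 2 - lam * s ^ 2 * (2 * (lam * s + j) * lam))
      / ((lam * s + j) ^ 2) ^ 2
    - (2 * (j - 1) * (-(lam * s) + (1 - s) * lam) * (lam * s + j) ^ 3
        - 2 * (j - 1) * ((1 - s) * (lam * s)) * (3 * (lam * s + j) ^ 2 * lam))
      / ((lam * s + j) ^ 3) ^ 2

lemma hasDerivAt_energyFactor {lam j s : ℝ} (hD : lam * s + j ≠ 0) :
    HasDerivAt (energyFactor lam j) (energyFactorDeriv lam j s) s := by
  have hs : HasDerivAt (fun s : ℝ => s) 1 s := hasDerivAt_id s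
  have hl : HasDerivAt (fun s : ℝ => lam * s) lam s := by simpa using hs.const_mul lam
  have hDd : HasDerivAt (fun s : ℝ => lam * s + j) lam s := hl.add_const j
  have h1s : HasDerivAt (fun s : ℝ => 1 - s) (-1) s := hs.const_sub 1
  have h1l : HasDerivAt (fun s : ℝ => 1 + lam * s) lam s := hl.const_add 1
  have e1 := (h1s.mul h1l).div hDd hD
  have e2 := ((hs.pow 2).const_mul lam).div (hDd.pow 2) (pow_ne_zero 2 hD)
  have e3 := ((h1s.mul hl).const_mul (2 * (j - 1))).div (hDd.pow 3) (pow_ne_zero 3 hD)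
  refine ((e1.add e2).sub e3).congr_deriv ?_
  simp only [energyFactorDeriv, Pi.mul_apply, Pi.pow_apply]
  congr 1
  · congr 1
    · congr 1; ring
    · congr 1; push_cast; ring
  · congr 1; push_cast; ring

/-- Multiplied by s^(j-1) exp(-λ(1-s)), the left side is the derivative of s^j exp(-λ(1-s)) A(s)
with A the rational factor; this makes `energyBound` a subsolution. The first term of A solves the
equation with A' dropped, and the other two give the defect a sign: it is minus a sum of two
nonnegative fractions. -/
lemma energyFactor_deriv_le {lam j s : ℝ} (hl : 0 ≤ lam) (hj : 1 ≤ j) (h0 : 0 ≤ s) (h1 : s ≤ 1) :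
    (j + lam * s) * energyFactor lam j s + s * energyFactorDeriv lam j s
      ≤ (1 - s) * (1 + lam * s) := by
  have hls : 0 ≤ lam * s := mul_nonneg hl h0
  have hD : 0 < lam * s + j := by linarith
  have key : (j + lam * s) * energyFactor lam j s + s * energyFactorDeriv lam j s
      - (1 - s) * (1 + lam * s)
      = -(s * ((lam * s - (j - 1)) ^ 2 + (2 * j - 1)) / (lam * s + j) ^ 3
        + (1 - s) * (lam * s) * (j - 1)
          * ((lam * s - 1) ^ 2 + 2 * (j - 1) * (lam * s) + (j ^ 2 + 2 * j - 1))
          / (lam * s + j) ^ 4) := by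
    rw [energyFactor, energyFactorDeriv]
    field_simp
    ring
  have hp1 : 0 ≤ s * ((lam * s - (j - 1)) ^ 2 + (2 * j - 1)) / (lam * s + j) ^ 3 := by
    have : 0 ≤ 2 * j - 1 := by linarith
    positivity
  have hp2 : 0 ≤ (1 - s) * (lam * s) * (j - 1)
          * ((lam * s - 1) ^ 2 + 2 * (j - 1) * (lam * s) + (j ^ 2 + 2 * j - 1))
          / (lam * s + j) ^ 4 := by
    have a1 : 0 ≤ 1 - s := by linarith
    have a2 : 0 ≤ j - 1 := by linarith
    have a3 : 0 ≤ j ^ 2 + 2 * j - 1 := by nlinarith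
    positivity
  linarith

/-- Subsolution for the energy integral. -/
def energyBound (lam : ℝ) (j : ℕ) (s : ℝ) : ℝ :=
  s ^ (j + 1) * Real.exp (-lam * (1 - s)) * energyFactor lam (j + 1) s

lemma hasDerivAt_energyBound {lam : ℝ} (hl : 0 ≤ lam) (j : ℕ) {s : ℝ} (hs : 0 ≤ s) :
    HasDerivAt (energyBound lam j)
      (s ^ j * Real.exp (-lam * (1 - s)) * (((j + 1 : ℝ) + lam * s) * energyFactor lam (j + 1) s
        + s * energyFactorDeriv lam (j + 1) s)) s := by
  have hD : lam * s + (j + 1 : ℝ) ≠ 0 := by positivity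
  have h1 : HasDerivAt (fun s : ℝ => s ^ (j + 1)) ((j + 1 : ℝ) * s ^ j) s := by
    simpa using hasDerivAt_pow (j + 1) s
  have h2 : HasDerivAt (fun s : ℝ => Real.exp (-lam * (1 - s)))
      (Real.exp (-lam * (1 - s)) * lam) s := by
    refine HasDerivAt.exp ?_
    simpa using ((hasDerivAt_id s).const_sub 1).const_mul (-lam)
  refine ((h1.mul h2).mul (hasDerivAt_energyFactor hD)).congr_deriv ?_
  simp only [Pi.mul_apply]
  ring

lemma energyBound_one (lam : ℝ) (j : ℕ) :
    energyBound lam j 1 = lam / (lam + (j + 1)) ^ 2 := by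
  simp [energyBound, energyFactor]

/-- The substitution s = 1/(1 + t w) turns the integral into w⁻¹ ∫₀¹ s^j (1-s)(1+λs) exp(-λ(1-s))
ds. The derivative of `energyBound` stays below this integrand, while its values at 0 and 1 are 0
and λ/(λ+j+1)². The comparison is made in the variable t on [0, B], then B tends to infinity. -/
lemma lintegral_energy_ge {lam w : ℝ} (hl : 0 ≤ lam) (hw : 0 < w) (j : ℕ) :
    ENNReal.ofReal (lam / (lam + (j + 1)) ^ 2 / w)
      ≤ ∫⁻ t in Set.Ioi (0 : ℝ), ENNReal.ofReal (t * ((w / (1 + t * w) ^ 2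
          + lam * w / (1 + t * w) ^ 3) * Real.exp (-t * (lam * w) / (1 + t * w))
            * ((1 + t * w)⁻¹) ^ (j + 1))) := by
  set φ : ℝ → ℝ := fun t => t * ((w / (1 + t * w) ^ 2
          + lam * w / (1 + t * w) ^ 3) * Real.exp (-t * (lam * w) / (1 + t * w))
            * ((1 + t * w)⁻¹) ^ (j + 1)) with hφ
  set S : ℝ → ℝ := fun t => (1 + t * w)⁻¹ with hS
  set G : ℝ → ℝ := fun t => -(energyBound lam j (S t) / w) with hG
  have hpos : ∀ t, 0 ≤ t → 0 < 1 + t * w := fun t ht => by positivity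
  have hS0 : ∀ t, 0 ≤ t → 0 ≤ S t := fun t ht => (inv_pos.mpr (hpos t ht)).le
  have hS1 : ∀ t, 0 ≤ t → S t ≤ 1 := fun t ht =>
    inv_le_one_of_one_le₀ (by have := mul_nonneg ht hw.le; linarith)
  set G' : ℝ → ℝ := fun t => (S t) ^ 2 * ((S t) ^ j * Real.exp (-lam * (1 - S t))
      * (((j + 1 : ℝ) + lam * S t) * energyFactor lam (j + 1) (S t)
        + S t * energyFactorDeriv lam (j + 1) (S t))) with hG'
  have hderiv : ∀ t, 0 ≤ t → HasDerivAt G (G' t) t := by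
    intro t ht
    have h1 : HasDerivAt (fun t : ℝ => 1 + t * w) w t := by
      simpa using ((hasDerivAt_id t).mul_const w).const_add 1
    have h2 := h1.inv (hpos t ht).ne'
    have h3 := (((hasDerivAt_energyBound hl j (hS0 t ht)).comp t h2).div_const w).neg
    refine h3.congr_deriv ?_
    simp only [hG', hS]
    field_simp
  have hle : ∀ t, 0 ≤ t → G' t ≤ φ t := by
    intro t ht
    have h := energyFactor_deriv_le (lam := lam) (j := j + 1) hl (by simp)
      (hS0 t ht) (hS1 t ht)
    have hexp : -t * (lam * w) / (1 + t * w) = -lam * (1 - S t) := by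
      have := (hpos t ht).ne'
      simp only [hS]
      field_simp
      ring
    have h2 : φ t = (S t) ^ 2 * ((S t) ^ j * Real.exp (-lam * (1 - S t))
        * ((1 - S t) * (1 + lam * S t))) := by
      simp only [hφ]
      rw [hexp]
      have := (hpos t ht).ne'
      have hSe : 1 - S t = t * w * S t := by
        simp only [hS]; field_simp; ring
      nth_rewrite 3 [hSe]
      have hSt : (1 + t * w)⁻¹ = S t := rfl
      rw [div_eq_mul_inv, div_eq_mul_inv, ← inv_pow, ← inv_pow, hSt]
      ring
    rw [h2]
    have := hS0 t ht
    simp only [hG']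
    gcongr
  have hφc : ContinuousOn φ (Set.Ici 0) := by
    intro t ht
    have h0 := hpos t ht
    have : ContinuousAt φ t := by
      simp only [hφ]
      fun_prop (disch := positivity)
    exact this.continuousWithinAt
  have hφ0 : ∀ t, 0 ≤ t → 0 ≤ φ t := by
    intro t ht
    have h0 := hpos t ht
    simp only [hφ]
    positivity
  have hB : ∀ B : ℝ, 0 ≤ B → ENNReal.ofReal (G B - G 0)
      ≤ ∫⁻ t in Set.Ioi (0 : ℝ), ENNReal.ofReal (φ t) := by
    intro B hB
    have hint : IntegrableOn φ (Set.Icc 0 B) :=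
      (hφc.mono Set.Icc_subset_Ici_self).integrableOn_Icc
    have h1 : G B - G 0 ≤ ∫ t in (0 : ℝ)..B, φ t :=
      intervalIntegral.sub_le_integral_of_hasDeriv_right_of_le hB
        (fun t ht => (hderiv t ht.1).continuousAt.continuousWithinAt)
        (fun t ht => (hderiv t ht.1.le).hasDerivWithinAt) hint (fun t ht => hle t ht.1.le)
    rw [intervalIntegral.integral_of_le hB] at h1
    calc ENNReal.ofReal (G B - G 0) ≤ ENNReal.ofReal (∫ t in Set.Ioc 0 B, φ t) :=
          ENNReal.ofReal_le_ofReal h1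
      _ = ∫⁻ t in Set.Ioc 0 B, ENNReal.ofReal (φ t) := by
          refine ofReal_integral_eq_lintegral_ofReal (hint.mono_set Set.Ioc_subset_Icc_self) ?_
          filter_upwards [ae_restrict_mem measurableSet_Ioc] with t ht using hφ0 t ht.1.le
      _ ≤ _ := lintegral_mono_set Set.Ioc_subset_Ioi_self
  have hlim : Filter.Tendsto (fun B => ENNReal.ofReal (G B - G 0)) Filter.atTop
      (nhds (ENNReal.ofReal (lam / (lam + (j + 1)) ^ 2 / w))) := by
    refine ENNReal.tendsto_ofReal ?_
    have hS' : Filter.Tendsto S Filter.atTop (nhds 0) :=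
      (Filter.tendsto_atTop_add_const_left _ 1
        (Filter.tendsto_id.atTop_mul_const hw)).inv_tendsto_atTop
    have hQ : Filter.Tendsto (fun B => energyBound lam j (S B)) Filter.atTop
        (nhds (energyBound lam j 0)) :=
      (hasDerivAt_energyBound hl j le_rfl).continuousAt.tendsto.comp hS'
    have hQ0 : energyBound lam j 0 = 0 := by simp [energyBound]
    rw [hQ0] at hQ
    have h := ((hQ.div_const w).neg).sub_const (G 0)
    have hG0 : G 0 = -(lam / (lam + (j + 1)) ^ 2 / w) := by
      simp [hG, hS, energyBound_one]
    rw [hG0] at h ⊢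
    simpa using h
  exact le_of_tendsto hlim (Filter.eventually_atTop.mpr ⟨0, hB⟩)

variable {κ : Type*} [Fintype κ] [DecidableEq κ]

/-- Writing 1/N² = ∫ t exp(-tN) dt makes the expectation a product over independent coordinates: the
leading one gives a tilted second moment, the j + 1 centred ones a factor (1 + t w)⁻¹ each. What
remains is `lintegral_energy_ge` with λ = ‖β‖²/w. -/
lemma lintegral_leading_energy_ge (a₀ : κ) (β : ℂ) (c : ℝ) (v : ℝ≥0) (hw : 0 < c ^ 2 * v) {j : ℕ}
    (hj : Fintype.card κ = j + 2) :
    ENNReal.ofReal (‖β‖ ^ 2 / (‖β‖ ^ 2 + (j + 1) * (c ^ 2 * v)) ^ 2)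
      ≤ ∫⁻ g, ENNReal.ofReal (‖β + c * g a₀‖ ^ 2
          / (∑ a, ‖(Pi.single a₀ β : κ → ℂ) a + c * g a‖ ^ 2) ^ 2) ∂gaussVec κ v := by
  set b : κ → ℂ := Pi.single a₀ β with hb
  have hb0 : b a₀ = β := by simp [hb]
  set w := c ^ 2 * (v : ℝ) with hwdef
  let F : ℝ → κ → ℂ → ENNReal := fun t a z =>
    if a = a₀ then ENNReal.ofReal (‖b a + c * z‖ ^ 2 * Real.exp (-t * ‖b a + c * z‖ ^ 2))
    else ENNReal.ofReal (Real.exp (-t * ‖b a + c * z‖ ^ 2))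
  have hFp (t : ℝ) (g : κ → ℂ) : ∏ a, F t a (g a) = ENNReal.ofReal (‖b a₀ + c * g a₀‖ ^ 2
      * Real.exp (-t * ∑ a, ‖b a + c * g a‖ ^ 2)) := by
    rw [← Finset.mul_prod_erase Finset.univ _ (Finset.mem_univ a₀)]
    have h2 : ∏ a ∈ Finset.univ.erase a₀, F t a (g a)
        = ∏ a ∈ Finset.univ.erase a₀, ENNReal.ofReal (Real.exp (-t * ‖b a + c * g a‖ ^ 2)) :=
      Finset.prod_congr rfl fun a ha => if_neg (Finset.ne_of_mem_erase ha)
    rw [h2, ← ENNReal.ofReal_prod_of_nonneg fun _ _ => by positivity, ← Real.exp_sum]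
    simp only [F, if_true]
    rw [← ENNReal.ofReal_mul (by positivity), mul_assoc, ← Real.exp_add, ← Finset.mul_sum,
      ← mul_add, Finset.add_sum_erase _ (fun a => ‖b a + c * g a‖ ^ 2) (Finset.mem_univ a₀)]
  have hlap (g : κ → ℂ) : ENNReal.ofReal (‖β + c * g a₀‖ ^ 2 / (∑ a, ‖b a + c * g a‖ ^ 2) ^ 2)
      = ∫⁻ t in Set.Ioi (0 : ℝ), ENNReal.ofReal t * ∏ a, F t a (g a) := by
    have hle : ‖b a₀ + c * g a₀‖ ^ 2 ≤ ∑ a, ‖b a + c * g a‖ ^ 2 :=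
      Finset.single_le_sum (f := fun a => ‖b a + c * g a‖ ^ 2) (fun _ _ => by positivity)
        (Finset.mem_univ a₀)
    set N := ∑ a, ‖b a + c * g a‖ ^ 2 with hN
    simp only [hFp]
    rw [← hN]
    have hN0 : 0 ≤ N := le_trans (by positivity) hle
    -- At N = 0 the numerator vanishes too, and with x / 0 = 0 both sides are zero.
    rcases hN0.eq_or_lt with h0 | h0
    · have hz : ‖b a₀ + c * g a₀‖ ^ 2 = 0 := le_antisymm (by rw [h0]; exact hle) (by positivity)
      rw [← h0, hz]
      simp
    · have h3 := lintegral_mul_exp_neg_mul_Ioi h0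
      rw [div_eq_mul_one_div, ENNReal.ofReal_mul (by positivity), ← h3,
        ← lintegral_const_mul _ (by fun_prop), ← hb0]
      refine setLIntegral_congr_fun measurableSet_Ioi fun t ht => ?_
      have ht' : (0 : ℝ) < t := ht
      rw [← ENNReal.ofReal_mul (by positivity), ← ENNReal.ofReal_mul (by positivity)]
      congr 1; ring
  have hFm (t : ℝ) (a : κ) : Measurable (F t a) := by
    simp only [F]
    split_ifs <;> fun_prop
  have hF1 {t : ℝ} (ht : 0 ≤ t) : ∏ a, ∫⁻ z, F t a z ∂complexGaussian v
      = ENNReal.ofReal ((w / (1 + t * w) ^ 2 + ‖β‖ ^ 2 / (1 + t * w) ^ 3)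
          * Real.exp (-t * ‖β‖ ^ 2 / (1 + t * w)) * ((1 + t * w)⁻¹) ^ (j + 1)) := by
    have hw0 : 0 < 1 + t * w := by positivity
    rw [← Finset.mul_prod_erase Finset.univ _ (Finset.mem_univ a₀)]
    have h2 : ∏ a ∈ Finset.univ.erase a₀, ∫⁻ z, F t a z ∂complexGaussian v
        = ∏ _a ∈ Finset.univ.erase a₀, ENNReal.ofReal ((1 + t * w)⁻¹) := by
      refine Finset.prod_congr rfl fun a ha => ?_
      simp only [F, if_neg (Finset.ne_of_mem_erase ha)]
      rw [lintegral_exp_neg_norm_sq_complexGaussian _ c v ht hw]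
      have : b a = 0 := by simp [hb, Finset.ne_of_mem_erase ha]
      simp [this, hwdef]
    rw [h2, Finset.prod_const, Finset.card_erase_of_mem (Finset.mem_univ a₀), Finset.card_univ, hj]
    simp only [F, if_true]
    rw [lintegral_norm_sq_mul_exp_neg_norm_sq_complexGaussian _ c v ht hw, hb0,
      ← ENNReal.ofReal_pow (by positivity), ← ENNReal.ofReal_mul (by positivity)]
    rfl
  simp only [hlap]
  rw [lintegral_lintegral_swap]
  swap
  · apply Measurable.aemeasurable
    simp only [hFp, Function.uncurry_def]
    fun_prop
  have hmain := lintegral_energy_ge (lam := ‖β‖ ^ 2 / w) (w := w) (by positivity) hw j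
  have hβ : ‖β‖ ^ 2 / w * w = ‖β‖ ^ 2 := by field_simp
  rw [hβ] at hmain
  have hval : ‖β‖ ^ 2 / w / (‖β‖ ^ 2 / w + (j + 1)) ^ 2 / w
      = ‖β‖ ^ 2 / (‖β‖ ^ 2 + (j + 1) * w) ^ 2 := by
    field_simp
  rw [hval] at hmain
  refine hmain.trans_eq (setLIntegral_congr_fun measurableSet_Ioi fun t ht => ?_)
  have ht' : (0 : ℝ) < t := ht
  rw [lintegral_const_mul _ (by fun_prop), lintegral_gaussVec_prod v (hFm t), hF1 ht'.le,
    ← ENNReal.ofReal_mul ht'.le]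

end LeadingCoordinate

/-! ### Orthogonal complements of all but one column -/

section Complement

variable {T ι : Type*} [Fintype T] [Fintype ι] [DecidableEq ι]

/-- The span of the columns other than the `k`-th. -/
def otherSpan (x : ι → T → ℂ) (k : ι) : Submodule ℂ (EuclideanSpace ℂ T) :=
  Submodule.span ℂ (Set.range fun j : {j // j ≠ k} => WithLp.toLp 2 (x j))

lemma star_dotProduct_eq_zero_of_mem_orthogonal {x : ι → T → ℂ} {k : ι} {e : EuclideanSpace ℂ T}
    (he : e ∈ (otherSpan x k)ᗮ) {j : ι} (hj : j ≠ k) : star e.ofLp ⬝ᵥ x j = 0 := by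
  rw [← inner_toLp_eq]
  exact Submodule.inner_left_of_mem_orthogonal
    (Submodule.subset_span (Set.mem_range_self (⟨j, hj⟩ : {j // j ≠ k}))) he

/-- There are many orthonormal vectors orthogonal to all columns but one. -/
lemma exists_orthonormal_complement (x : ι → T → ℂ) (k : ι) {d : ℕ}
    (hd : Fintype.card T = Fintype.card ι + d) :
    ∃ e : Fin (d + 1) → T → ℂ, (∀ a b, star (e a) ⬝ᵥ e b = if a = b then 1 else 0) ∧
      ∀ a j, j ≠ k → star (e a) ⬝ᵥ x j = 0 := by
  have h1 := (otherSpan x k).finrank_add_finrank_orthogonal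
  -- An upper bound on the dimension is enough: dependent columns only enlarge the complement, so no
  -- independence is required here.
  have h2 : Module.finrank ℂ (otherSpan x k) ≤ Fintype.card ι - 1 := by
    refine (finrank_range_le_card _).trans ?_
    rw [Fintype.card_subtype_compl, Fintype.card_subtype_eq]
  have hι : 0 < Fintype.card ι := Fintype.card_pos_iff.mpr ⟨k⟩
  rw [finrank_euclideanSpace] at h1
  have h3 : d + 1 ≤ Module.finrank ℂ (otherSpan x k)ᗮ := by omega
  let b := stdOrthonormalBasis ℂ (otherSpan x k)ᗮ
  refine ⟨fun a => (b (Fin.castLE h3 a) : EuclideanSpace ℂ T).ofLp, fun a a' => ?_,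
    fun a j hj => star_dotProduct_eq_zero_of_mem_orthogonal (b _).2 hj⟩
  rw [← inner_toLp_eq]
  have := orthonormal_iff_ite.mp b.orthonormal (Fin.castLE h3 a) (Fin.castLE h3 a')
  rw [Submodule.coe_inner] at this
  simpa using this

/-- The properties of an orthonormal basis of the orthogonal complement of the columns other than
the `k`-th. -/
structure IsComplementBasis {κ : Type*} [Fintype κ] [DecidableEq κ] (x : ι → T → ℂ) (k : ι)
    (e : κ → T → ℂ) : Prop where
  orthonormal : ∀ a b, star (e a) ⬝ᵥ e b = if a = b then 1 else 0
  orthogonal : ∀ a j, j ≠ k → star (e a) ⬝ᵥ x j = 0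
  complete : ∀ y : T → ℂ, ∃ c : ι → ℂ, c k = 0 ∧
    y = ∑ a, (star (e a) ⬝ᵥ y) • e a + ∑ j, c j • x j

/-- A basis of the complement whose first vector is aligned with a given vector. -/
lemma exists_complementBasis {x : ι → T → ℂ} (hx : LinearIndependent ℂ x) (k : ι) {d : ℕ}
    (hd : Fintype.card T = Fintype.card ι + d) (m : T → ℂ) :
    ∃ e : Fin (d + 1) → T → ℂ, IsComplementBasis x k e ∧ ∀ a, a ≠ 0 → star (e a) ⬝ᵥ m = 0 := by
  have h1 := (otherSpan x k).finrank_add_finrank_orthogonal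
  have hx' : LinearIndependent ℂ fun j : {j // j ≠ k} =>
      (WithLp.toLp 2 (x j) : EuclideanSpace ℂ T) := by
    have h := (hx.comp (fun j : {j // j ≠ k} => (j : ι)) Subtype.val_injective).map'
      (WithLp.linearEquiv 2 ℂ (T → ℂ)).symm.toLinearMap (LinearEquiv.ker _)
    exact h
  have h2 : Module.finrank ℂ (otherSpan x k) = Fintype.card ι - 1 := by
    rw [otherSpan, finrank_span_eq_card hx', Fintype.card_subtype_compl, Fintype.card_subtype_eq]
  have hι : 0 < Fintype.card ι := Fintype.card_pos_iff.mpr ⟨k⟩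
  rw [finrank_euclideanSpace] at h1
  have h3 : Module.finrank ℂ (otherSpan x k)ᗮ = Fintype.card (Fin (d + 1)) := by
    rw [Fintype.card_fin]; omega
  set p : (otherSpan x k)ᗮ := (otherSpan x k)ᗮ.orthogonalProjectionOnto (WithLp.toLp 2 m) with hp
  obtain ⟨b, hb⟩ : ∃ b : OrthonormalBasis (Fin (d + 1)) ℂ (otherSpan x k)ᗮ,
      ∀ a, a ≠ 0 → inner ℂ (b a) p = 0 := by
    -- If the projection of m vanishes any orthonormal basis will do; otherwise p/‖p‖ is taken as
    -- the vector of index 0 and completed.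
    by_cases hp0 : p = 0
    · obtain ⟨b, -⟩ := Orthonormal.exists_orthonormalBasis_extension_of_card_eq h3
        (v := fun _ => 0) (s := ∅) (by constructor <;> simp)
      exact ⟨b, fun a _ => by rw [hp0, inner_zero_right]⟩
    · obtain ⟨b, hb⟩ := Orthonormal.exists_orthonormalBasis_extension_of_card_eq h3
        (v := fun _ => ((‖p‖ : ℂ)⁻¹) • p) (s := {0}) (by
          constructor
          · intro i
            have : ‖p‖ ≠ 0 := norm_ne_zero_iff.mpr hp0
            change ‖((‖p‖ : ℂ)⁻¹) • p‖ = 1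
            rw [norm_smul, norm_inv, Complex.norm_real, norm_norm, inv_mul_cancel₀ this]
          · intro i j hij
            exact absurd (Subsingleton.elim i j) hij)
      refine ⟨b, fun a ha => ?_⟩
      have hpe : p = (‖p‖ : ℂ) • b 0 := by
        rw [hb 0 rfl, smul_smul, mul_inv_cancel₀, one_smul]
        exact_mod_cast norm_ne_zero_iff.mpr hp0
      have h4 := b.orthonormal.2 ha
      rw [hpe, inner_smul_right, h4, mul_zero]
  have hin (a : Fin (d + 1)) (y : T → ℂ) : star (b a : EuclideanSpace ℂ T).ofLp ⬝ᵥ y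
      = inner ℂ (b a) ((otherSpan x k)ᗮ.orthogonalProjectionOnto (WithLp.toLp 2 y)) := by
    rw [← inner_toLp_eq, Submodule.coe_inner]
    exact (Submodule.inner_orthogonalProjectionOnto_eq_of_mem_left _ _).symm
  refine ⟨fun a => (b a : EuclideanSpace ℂ T).ofLp, ⟨fun a a' => ?_,
    fun a j hj => star_dotProduct_eq_zero_of_mem_orthogonal (b _).2 hj, fun y => ?_⟩,
    fun a ha => ?_⟩
  · rw [← inner_toLp_eq]
    have := orthonormal_iff_ite.mp b.orthonormal a a'
    rw [Submodule.coe_inner] at this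
    simpa using this
  · have hW := (Submodule.mem_span_range_iff_exists_fun ℂ).mp
      ((otherSpan x k).orthogonalProjectionOnto (WithLp.toLp 2 y)).2
    obtain ⟨c, hc⟩ := hW
    refine ⟨fun j => if hj : j ≠ k then c ⟨j, hj⟩ else 0, by simp, ?_⟩
    have hsum : ∑ j, (if hj : j ≠ k then c ⟨j, hj⟩ else 0) • x j
        = ∑ j : {j // j ≠ k}, c j • x j := by
      rw [Fintype.sum_eq_add_sum_subtype_ne _ k]
      simp only [ne_eq, not_true_eq_false, dif_neg, not_false_eq_true, zero_smul, zero_add]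
      refine Finset.sum_congr rfl fun j _ => ?_
      rw [dif_pos j.2]
    have h4 := (otherSpan x k).starProjection_add_starProjection_orthogonal (WithLp.toLp 2 y)
    have h5 := b.sum_repr' ((otherSpan x k)ᗮ.orthogonalProjectionOnto (WithLp.toLp 2 y))
    rw [hsum]
    rw [Submodule.starProjection_apply, Submodule.starProjection_apply, ← hc, ← h5] at h4
    have h6 := congrArg WithLp.ofLp h4
    simp only [← hin, Submodule.coe_sum, Submodule.coe_smul, WithLp.ofLp_add, WithLp.ofLp_sum,
      WithLp.ofLp_smul] at h6
    rw [add_comm]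
    exact h6.symm
  · simp only
    rw [hin]
    exact hb a ha

variable {κ : Type*} [Fintype κ] [DecidableEq κ] {x : ι → T → ℂ} {k : ι} {e : κ → T → ℂ}

lemma IsComplementBasis.linearIndependent_update (he : IsComplementBasis x k e)
    (hx : LinearIndependent ℂ x) {y : T → ℂ} {a : κ} (ha : star (e a) ⬝ᵥ y ≠ 0) :
    LinearIndependent ℂ (Function.update x k y) := by
  rw [Fintype.linearIndependent_iff] at hx ⊢
  intro g hg
  have hk : g k = 0 := by
    have h := congrArg (fun z => star (e a) ⬝ᵥ z) hg
    simp only [dotProduct_sum, dotProduct_smul, dotProduct_zero] at h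
    rw [Finset.sum_eq_single k] at h
    · simp only [Function.update_self, smul_eq_mul] at h
      exact (mul_eq_zero.mp h).resolve_right ha
    · intro j _ hj
      rw [Function.update_of_ne hj, he.orthogonal a j hj, smul_zero]
    · simp
  apply hx
  rw [← hg]
  refine Finset.sum_congr rfl fun j _ => ?_
  by_cases hj : j = k
  · rw [hj, hk, zero_smul, zero_smul]
  · rw [Function.update_of_ne hj]

lemma star_dotProduct_sum_smul (e : κ → T → ℂ) (y z : T → ℂ) :
    star z ⬝ᵥ (∑ a, (star (e a) ⬝ᵥ y) • e a)
      = ∑ a, (star (e a) ⬝ᵥ y) * star (star (e a) ⬝ᵥ z) := by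
  rw [dotProduct_sum]
  refine Finset.sum_congr rfl fun a _ => ?_
  rw [dotProduct_smul, smul_eq_mul, ← star_dotProduct_comm]

/-- Explicit form of the dual vector of the `k`-th column. -/
lemma IsComplementBasis.dualVec_update (he : IsComplementBasis x k e)
    (hx : LinearIndependent ℂ x) {y : T → ℂ} (hy : ∑ a, ‖star (e a) ⬝ᵥ y‖ ^ 2 ≠ 0) :
    gramDet (Function.update x k y) ≠ 0 ∧
    dualVec (Function.update x k y) k
      = ((∑ a, ‖star (e a) ⬝ᵥ y‖ ^ 2 : ℝ) : ℂ)⁻¹ • ∑ a, (star (e a) ⬝ᵥ y) • e a := by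
  obtain ⟨a, ha⟩ : ∃ a, star (e a) ⬝ᵥ y ≠ 0 := by
    by_contra hc
    push Not at hc
    exact hy (Finset.sum_eq_zero fun a _ => by rw [hc a]; simp)
  have hg : gramDet (Function.update x k y) ≠ 0 :=
    gramDet_ne_zero_iff.mpr (he.linearIndependent_update hx ha)
  refine ⟨hg, ?_⟩
  set S : ℝ := ∑ a, ‖star (e a) ⬝ᵥ y‖ ^ 2 with hS
  have hS' : (S : ℂ) ≠ 0 := by exact_mod_cast hy
  obtain ⟨c, hck, hc⟩ := he.complete y
  symm
  -- Since c k = 0, the projection is y minus a combination of the other columns, hence in the span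
  -- of the updated family; dividing by S normalises its product with y.
  refine eq_dualVec_of_dual hg (fun j => (S : ℂ)⁻¹ * (if j = k then 1 else -c j)) ?_ ?_
  · have h1 : ∑ a, (star (e a) ⬝ᵥ y) • e a = y - ∑ j, c j • x j := by
      nth_rewrite 2 [hc]; simp
    have h2 : ∑ j, (if j = k then (1 : ℂ) else -c j) • Function.update x k y j
        = y - ∑ j, c j • x j := by
      rw [← Finset.add_sum_erase _ _ (Finset.mem_univ k),
        ← Finset.add_sum_erase (Finset.univ) (fun j => c j • x j) (Finset.mem_univ k), hck]
      simp only [if_true, Function.update_self, one_smul, zero_smul, zero_add]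
      rw [sub_eq_add_neg, ← Finset.sum_neg_distrib]
      congr 1
      refine Finset.sum_congr rfl fun j hj => ?_
      have hj' := Finset.ne_of_mem_erase hj
      rw [if_neg hj', Function.update_of_ne hj', neg_smul]
    rw [h1, ← h2, Finset.smul_sum]
    simp only [smul_smul]
  · intro j
    rw [dotProduct_smul, star_dotProduct_sum_smul]
    split_ifs with hj
    · rw [hj, Function.update_self, smul_eq_mul, hS]
      rw [hS] at hS'
      push_cast at hS' ⊢
      rw [inv_mul_eq_one₀ hS']
      exact Finset.sum_congr rfl fun a _ => (Complex.mul_conj' _).symm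
    · rw [Function.update_of_ne hj, Finset.sum_eq_zero, smul_zero]
      intro a _
      rw [he.orthogonal a j hj]
      simp

/-- Within the complement m has a single nonzero coordinate, so only that coordinate of y survives
in the numerator. -/
lemma IsComplementBasis.norm_star_dualVec_dotProduct_sq (he : IsComplementBasis x k e)
    (hx : LinearIndependent ℂ x) {y m : T → ℂ} {a₀ : κ} (hm : ∀ a, a ≠ a₀ → star (e a) ⬝ᵥ m = 0)
    (hy : ∑ a, ‖star (e a) ⬝ᵥ y‖ ^ 2 ≠ 0) :
    ‖star (dualVec (Function.update x k y) k) ⬝ᵥ m‖ ^ 2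
      = ‖star (e a₀) ⬝ᵥ m‖ ^ 2
        * (‖star (e a₀) ⬝ᵥ y‖ ^ 2 / (∑ a, ‖star (e a) ⬝ᵥ y‖ ^ 2) ^ 2) := by
  have h1 : ∑ a, (star (e a) ⬝ᵥ y) * star (star (e a) ⬝ᵥ m)
      = (star (e a₀) ⬝ᵥ y) * star (star (e a₀) ⬝ᵥ m) := by
    refine Finset.sum_eq_single a₀ (fun a _ ha => ?_) (by simp)
    rw [hm a ha]; simp
  rw [(he.dualVec_update hx hy).2, norm_star_dotProduct_comm, dotProduct_smul,
    star_dotProduct_sum_smul, h1, smul_eq_mul, norm_mul, norm_mul, norm_star,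
    norm_inv, Complex.norm_real, Real.norm_eq_abs, mul_pow, mul_pow, inv_pow, sq_abs]
  ring

lemma IsComplementBasis.sqNorm_dualVec_update (he : IsComplementBasis x k e)
    (hx : LinearIndependent ℂ x) {y : T → ℂ} (hy : ∑ a, ‖star (e a) ⬝ᵥ y‖ ^ 2 ≠ 0) :
    sqNorm (dualVec (Function.update x k y) k) = (∑ a, ‖star (e a) ⬝ᵥ y‖ ^ 2)⁻¹ := by
  have h1 : (sqNorm (∑ a, (star (e a) ⬝ᵥ y) • e a) : ℂ)
      = ((∑ a, ‖star (e a) ⬝ᵥ y‖ ^ 2 : ℝ) : ℂ) := by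
    rw [← star_dotProduct_self, star_dotProduct_sum_smul]
    push_cast
    refine Finset.sum_congr rfl fun a _ => ?_
    have h2 : star (e a) ⬝ᵥ (∑ b, (star (e b) ⬝ᵥ y) • e b) = star (e a) ⬝ᵥ y := by
      rw [dotProduct_sum]
      simp [dotProduct_smul, he.orthonormal]
    rw [h2]
    exact Complex.mul_conj' _
  have h1' : sqNorm (∑ a, (star (e a) ⬝ᵥ y) • e a) = ∑ a, ‖star (e a) ⬝ᵥ y‖ ^ 2 := by
    exact_mod_cast h1
  rw [(he.dualVec_update hx hy).2, sqNorm_smul, h1', norm_inv, Complex.norm_real,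
    Real.norm_eq_abs, inv_pow, sq_abs, sq, mul_inv, mul_assoc, inv_mul_cancel₀ hy, mul_one]

end Complement

/-! ### Dual vectors of a family with one Gaussian column -/

section OneColumn

variable {T ι : Type*} [Fintype T] [DecidableEq T] [Fintype ι] [DecidableEq ι]

lemma star_dotProduct_affine (e m g : T → ℂ) (c : ℝ) :
    star e ⬝ᵥ (m + (c : ℂ) • g) = star e ⬝ᵥ m + c * (star e ⬝ᵥ g) := by
  rw [dotProduct_add, dotProduct_smul, smul_eq_mul]

lemma lintegral_inv_orthonormal_energy_le {d : ℕ} (hd : 1 ≤ d) (e : Fin (d + 1) → T → ℂ)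
    (he : ∀ a b, star (e a) ⬝ᵥ e b = if a = b then 1 else 0) (m : T → ℂ) (c : ℝ) (v : ℝ≥0)
    (hw : 0 < c ^ 2 * v) :
    ∫⁻ g, (ENNReal.ofReal (∑ a, ‖star (e a) ⬝ᵥ (m + (c : ℂ) • g)‖ ^ 2))⁻¹ ∂gaussVec T v
      ≤ ENNReal.ofReal (1 / (c ^ 2 * v * d)) := by
  simp only [star_dotProduct_affine]
  have h := lintegral_inv_sum_norm_sq_le (fun a => star (e a) ⬝ᵥ m) c v hw
    (by rw [Fintype.card_fin]; omega)
  rw [← (measurePreserving_orthonormal v e he).lintegral_comp (by fun_prop)] at h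
  simpa using h

/-- A finite inverse moment forces the energy to be almost surely nonzero. -/
lemma ae_orthonormal_energy_ne_zero {d : ℕ} (hd : 1 ≤ d) (e : Fin (d + 1) → T → ℂ)
    (he : ∀ a b, star (e a) ⬝ᵥ e b = if a = b then 1 else 0) (m : T → ℂ) (c : ℝ) (v : ℝ≥0)
    (hw : 0 < c ^ 2 * v) :
    ∀ᵐ g ∂gaussVec T v, ∑ a, ‖star (e a) ⬝ᵥ (m + (c : ℂ) • g)‖ ^ 2 ≠ 0 := by
  have h := lintegral_inv_orthonormal_energy_le hd e he m c v hw
  have hm : Measurable fun g : T → ℂ =>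
      (ENNReal.ofReal (∑ a, ‖star (e a) ⬝ᵥ (m + (c : ℂ) • g)‖ ^ 2))⁻¹ := by
    simp only [dotProduct]
    fun_prop
  filter_upwards [ae_lt_top hm (h.trans_lt ENNReal.ofReal_lt_top).ne] with g hg h0
  rw [h0] at hg
  simp at hg

variable {x : ι → T → ℂ} {k : ι} {d : ℕ}

lemma ae_gramDet_update_ne_zero (hx : gramDet x ≠ 0) (hd : 1 ≤ d)
    (hT : Fintype.card T = Fintype.card ι + d) (m : T → ℂ) (c : ℝ) (v : ℝ≥0)
    (hw : 0 < c ^ 2 * v) :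
    ∀ᵐ g ∂gaussVec T v, gramDet (Function.update x k (m + (c : ℂ) • g)) ≠ 0 := by
  obtain ⟨e, he, -⟩ := exists_complementBasis (gramDet_ne_zero_iff.mp hx) k hT 0
  filter_upwards [ae_orthonormal_energy_ne_zero hd e he.orthonormal m c v hw] with g hg
  exact (he.dualVec_update (gramDet_ne_zero_iff.mp hx) hg).1

lemma lintegral_sqNorm_dualVec_update_le (hx : gramDet x ≠ 0) (hd : 1 ≤ d)
    (hT : Fintype.card T = Fintype.card ι + d) (m : T → ℂ) (c : ℝ) (v : ℝ≥0)
    (hw : 0 < c ^ 2 * v) :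
    ∫⁻ g, ENNReal.ofReal (sqNorm (dualVec (Function.update x k (m + (c : ℂ) • g)) k)) ∂gaussVec T v
      ≤ ENNReal.ofReal (1 / (c ^ 2 * v * d)) := by
  obtain ⟨e, he, -⟩ := exists_complementBasis (gramDet_ne_zero_iff.mp hx) k hT 0
  refine le_trans (lintegral_mono_ae ?_)
    (lintegral_inv_orthonormal_energy_le hd e he.orthonormal m c v hw)
  filter_upwards [ae_orthonormal_energy_ne_zero hd e he.orthonormal m c v hw] with g hg
  rw [he.sqNorm_dualVec_update (gramDet_ne_zero_iff.mp hx) hg, ENNReal.ofReal_inv_of_pos]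
  exact lt_of_le_of_ne (Finset.sum_nonneg fun _ _ => by positivity) (Ne.symm hg)

/-- If another column `x i` is orthogonal to the mean of the Gaussian column `k`, then the
correlation of the Gaussian column with `x i` is independent of the dual vector. -/
lemma lintegral_sqNorm_dualVec_update_mul_le (hx : gramDet x ≠ 0) (hd : 1 ≤ d)
    (hT : Fintype.card T = Fintype.card ι + d) {m : T → ℂ} {c : ℝ} {v : ℝ≥0}
    (hw : 0 < c ^ 2 * v) {i : ι} (hik : i ≠ k) (hm : star (x i) ⬝ᵥ m = 0) :
    ∫⁻ g, ENNReal.ofReal (sqNorm (dualVec (Function.update x k (m + (c : ℂ) • g)) k)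
        * ‖star (x i) ⬝ᵥ (m + (c : ℂ) • g)‖ ^ 2) ∂gaussVec T v
      ≤ ENNReal.ofReal (sqNorm (x i) / d) := by
  have hLI := gramDet_ne_zero_iff.mp hx
  obtain ⟨e, he, -⟩ := exists_complementBasis hLI k hT 0
  have hxi : 0 < sqNorm (x i) := sqNorm_pos (hLI.ne_zero i)
  set r : ℝ := √(sqNorm (x i)) with hr
  have hr0 : 0 < r := Real.sqrt_pos.mpr hxi
  have hr2 : r ^ 2 = sqNorm (x i) := Real.sq_sqrt hxi.le
  set f : T → ℂ := ((r : ℂ)⁻¹) • x i with hf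
  have hrC : (r : ℂ) ≠ 0 := by exact_mod_cast hr0.ne'
  have hxf : x i = (r : ℂ) • f := by rw [hf, smul_smul, mul_inv_cancel₀ hrC, one_smul]
  have hff : star f ⬝ᵥ f = 1 := by
    rw [hf, star_smul, smul_dotProduct, dotProduct_smul, star_dotProduct_self, ← hr2]
    simp only [smul_eq_mul, star_inv₀, RCLike.star_def, Complex.conj_ofReal]
    push_cast
    field_simp
  have hef (a) : star (e a) ⬝ᵥ f = 0 := by
    rw [hf, dotProduct_smul, he.orthogonal a i hik, smul_zero]
  have hfe (a) : star f ⬝ᵥ e a = 0 := by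
    rw [star_dotProduct_comm, hef, star_zero]
  -- The normalised x i is orthogonal to the complement, so it extends e to d + 2 orthonormal
  -- vectors. The coordinate along it is then independent of those that determine the norm of the
  -- dual vector.
  let e' : Fin (d + 2) → T → ℂ := Fin.cons f e
  have he' : ∀ a b, star (e' a) ⬝ᵥ e' b = if a = b then 1 else 0 := by
    intro a b
    refine Fin.cases ?_ (fun a => ?_) a <;> refine Fin.cases ?_ (fun b => ?_) b
    · simpa [e'] using hff
    · simpa [e', (Fin.succ_ne_zero b).symm] using hfe b
    · simpa [e', Fin.succ_ne_zero a] using hef a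
    · simpa [e'] using he.orthonormal a b
  let b : Fin (d + 1) → ℂ := fun a => star (e a) ⬝ᵥ m
  have hfm : star f ⬝ᵥ m = 0 := by
    rw [hf, star_smul, smul_dotProduct, hm, smul_zero]
  have hbound : ∀ᵐ g ∂gaussVec T v, ENNReal.ofReal
      (sqNorm (dualVec (Function.update x k (m + (c : ℂ) • g)) k)
        * ‖star (x i) ⬝ᵥ (m + (c : ℂ) • g)‖ ^ 2)
      ≤ ENNReal.ofReal (r ^ 2 * c ^ 2) * (ENNReal.ofReal (‖star (e' 0) ⬝ᵥ g‖ ^ 2)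
        * (ENNReal.ofReal (∑ a : Fin (d + 1), ‖b a + c * (star (e' a.succ) ⬝ᵥ g)‖ ^ 2))⁻¹) := by
    filter_upwards [ae_orthonormal_energy_ne_zero hd e he.orthonormal m c v hw] with g hg
    have hpos : 0 < ∑ a, ‖star (e a) ⬝ᵥ (m + (c : ℂ) • g)‖ ^ 2 :=
      lt_of_le_of_ne (Finset.sum_nonneg fun _ _ => by positivity) (Ne.symm hg)
    rw [he.sqNorm_dualVec_update hLI hg, mul_comm, ENNReal.ofReal_mul (by positivity),
      ENNReal.ofReal_inv_of_pos hpos]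
    have h1 : ‖star (x i) ⬝ᵥ (m + (c : ℂ) • g)‖ ^ 2 = r ^ 2 * c ^ 2 * ‖star (e' 0) ⬝ᵥ g‖ ^ 2 := by
      rw [star_dotProduct_affine, hm, zero_add, hxf, star_smul, smul_dotProduct]
      simp only [e', Fin.cons_zero, smul_eq_mul, norm_mul, Complex.norm_real, norm_star,
        Real.norm_eq_abs, mul_pow, sq_abs]
      ring
    have h2 : ∑ a, ‖star (e a) ⬝ᵥ (m + (c : ℂ) • g)‖ ^ 2
        = ∑ a : Fin (d + 1), ‖b a + c * (star (e' a.succ) ⬝ᵥ g)‖ ^ 2 := by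
      simp only [star_dotProduct_affine, e', Fin.cons_succ, b]
    rw [h1, h2, ENNReal.ofReal_mul (by positivity), mul_assoc]
  refine (lintegral_mono_ae hbound).trans ?_
  rw [(measurePreserving_orthonormal v e' he').lintegral_comp
    (f := fun y : Fin (d + 2) → ℂ => ENNReal.ofReal (r ^ 2 * c ^ 2) * (ENNReal.ofReal (‖y 0‖ ^ 2)
      * (ENNReal.ofReal (∑ a : Fin (d + 1), ‖b a + c * y a.succ‖ ^ 2))⁻¹)) (by fun_prop),
    lintegral_const_mul _ (by fun_prop)]
  have hprod : ∫⁻ y, ENNReal.ofReal (‖y 0‖ ^ 2)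
      * (ENNReal.ofReal (∑ a : Fin (d + 1), ‖b a + c * y a.succ‖ ^ 2))⁻¹ ∂gaussVec (Fin (d + 2)) v
      = (∫⁻ z, ENNReal.ofReal (‖z‖ ^ 2) ∂complexGaussian v)
        * ∫⁻ y, (ENNReal.ofReal (∑ a : Fin (d + 1), ‖b a + c * y a‖ ^ 2))⁻¹
          ∂gaussVec (Fin (d + 1)) v := by
    have hmp := measurePreserving_piFinSuccAbove (fun _ : Fin (d + 2) => complexGaussian v) 0
    rw [← lintegral_prod_mul (f := fun z : ℂ => ENNReal.ofReal (‖z‖ ^ 2)) (by fun_prop)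
      (Measurable.aemeasurable (by fun_prop))]
    exact (hmp.lintegral_comp (f := fun z : ℂ × (Fin (d + 1) → ℂ) => ENNReal.ofReal (‖z.1‖ ^ 2)
      * (ENNReal.ofReal (∑ a : Fin (d + 1), ‖b a + c * z.2 a‖ ^ 2))⁻¹) (by fun_prop))
  rw [hprod, lintegral_norm_sq_complexGaussian]
  have h3 := lintegral_inv_sum_norm_sq_le b c v hw (by rw [Fintype.card_fin]; omega)
  rw [Fintype.card_fin] at h3
  calc _ ≤ ENNReal.ofReal (r ^ 2 * c ^ 2) * (v * ENNReal.ofReal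
        (1 / (c ^ 2 * v * (((d + 1 : ℕ) : ℝ) - 1)))) := by gcongr
    _ = ENNReal.ofReal (sqNorm (x i) / d) := by
      have hd0 : (0 : ℝ) < d := by exact_mod_cast hd
      rw [← ENNReal.ofReal_coe_nnreal, ← ENNReal.ofReal_mul (by positivity),
        ← ENNReal.ofReal_mul (by positivity), hr2]
      congr 1
      have hc : c ≠ 0 := by rintro rfl; simp at hw
      have hv : (v : ℝ) ≠ 0 := by intro h; simp [h] at hw
      push_cast
      rw [add_sub_cancel_right]
      field_simp

/-- The correlation of the dual vector with the mean of the Gaussian column. -/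
lemma lintegral_norm_star_dualVec_update_dotProduct_ge (hx : gramDet x ≠ 0) (hd : 1 ≤ d)
    (hT : Fintype.card T = Fintype.card ι + d) {m : T → ℂ} (c : ℝ) (v : ℝ≥0)
    (hw : 0 < c ^ 2 * v) (hm : gramDet (Function.update x k m) ≠ 0) :
    ENNReal.ofReal (1 / (1 + d * (c ^ 2 * v) * sqNorm (dualVec (Function.update x k m) k)) ^ 2)
      ≤ ∫⁻ g, ENNReal.ofReal
          (‖star (dualVec (Function.update x k (m + (c : ℂ) • g)) k) ⬝ᵥ m‖ ^ 2) ∂gaussVec T v := by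
  have hLI := gramDet_ne_zero_iff.mp hx
  obtain ⟨e, he, hem⟩ := exists_complementBasis hLI k hT m
  set P : ℝ := ‖star (e 0) ⬝ᵥ m‖ ^ 2 with hP
  have hsum : ∑ a, ‖star (e a) ⬝ᵥ m‖ ^ 2 = P := by
    rw [Finset.sum_eq_single 0]
    · intro a _ ha
      rw [hem a ha]; simp
    · simp
  -- A vanishing projection would put m in the span of the other columns, contradicting the
  -- independence of the family with m in place of column k.
  have hP0 : P ≠ 0 := by
    intro h0
    obtain ⟨c', hck, hc'⟩ := he.complete m
    have hz : ∀ a, star (e a) ⬝ᵥ m = 0 := by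
      intro a
      by_cases ha : a = 0
      · rw [hP] at h0
        rw [ha]
        simpa using h0
      · exact hem a ha
    simp only [hz, zero_smul, Finset.sum_const_zero, zero_add] at hc'
    have hLI' := Fintype.linearIndependent_iff.mp (gramDet_ne_zero_iff.mp hm)
      (fun j => if j = k then 1 else -c' j) ?_ k
    · simp at hLI'
    · rw [← Finset.add_sum_erase _ _ (Finset.mem_univ k)]
      simp only [if_true, Function.update_self, one_smul]
      nth_rewrite 1 [hc']
      rw [← Finset.add_sum_erase Finset.univ (fun j => c' j • x j) (Finset.mem_univ k), hck,
        zero_smul, zero_add, ← Finset.sum_add_distrib]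
      refine Finset.sum_eq_zero fun j hj => ?_
      have hj' := Finset.ne_of_mem_erase hj
      rw [if_neg hj', Function.update_of_ne hj', neg_smul, add_neg_cancel]
  have hPpos : 0 < P := lt_of_le_of_ne (by positivity) (Ne.symm hP0)
  have hs : sqNorm (dualVec (Function.update x k m) k) = P⁻¹ := by
    rw [he.sqNorm_dualVec_update hLI (by rw [hsum]; exact hP0), hsum]
  obtain ⟨j, rfl⟩ : ∃ j, d = j + 1 := ⟨d - 1, by omega⟩
  have h1 := lintegral_leading_energy_ge (κ := Fin (j + 1 + 1)) 0 (star (e 0) ⬝ᵥ m) c v hw (j := j)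
    (by simp)
  rw [← (measurePreserving_orthonormal v e he.orthonormal).lintegral_comp (by fun_prop)] at h1
  have hsingle : ∀ a, (Pi.single 0 (star (e 0) ⬝ᵥ m) : Fin (j + 1 + 1) → ℂ) a
      = star (e a) ⬝ᵥ m := by
    intro a
    by_cases ha : a = 0
    · rw [ha]; simp
    · rw [hem a ha]; simp [ha]
  simp only [hsingle] at h1
  have h2 : ∫⁻ g, ENNReal.ofReal
        (‖star (dualVec (Function.update x k (m + (c : ℂ) • g)) k) ⬝ᵥ m‖ ^ 2) ∂gaussVec T v
      = ∫⁻ g, ENNReal.ofReal P * ENNReal.ofReal (‖star (e 0) ⬝ᵥ m + c * (star (e 0) ⬝ᵥ g)‖ ^ 2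
        / (∑ a, ‖star (e a) ⬝ᵥ m + c * (star (e a) ⬝ᵥ g)‖ ^ 2) ^ 2) ∂gaussVec T v := by
    refine lintegral_congr_ae ?_
    filter_upwards [ae_orthonormal_energy_ne_zero hd e he.orthonormal m c v hw] with g hg
    rw [he.norm_star_dualVec_dotProduct_sq hLI hem hg, ← ENNReal.ofReal_mul hPpos.le]
    simp only [star_dotProduct_affine]
    rfl
  rw [h2, lintegral_const_mul' _ _ ENNReal.ofReal_ne_top]
  refine le_trans ?_ (mul_le_mul_right h1 (ENNReal.ofReal P))
  -- With w = c²v, the bound is P · P/(P + d w)² = 1/(1 + d w P⁻¹)², and P⁻¹ is the squared norm of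
  -- the dual vector at the mean.
  rw [← ENNReal.ofReal_mul hPpos.le, hs, ← hP]
  refine ENNReal.ofReal_le_ofReal (le_of_eq ?_)
  push_cast
  field_simp

end OneColumn

/-! ### Jensen-type bounds -/

section Jensen

variable {α : Type*} [MeasurableSpace α] {ν : Measure α} [IsProbabilityMeasure ν]

lemma integrable_of_lintegral_ofReal_le {X : α → ℝ} (hX : AEStronglyMeasurable X ν)
    (hX0 : ∀ a, 0 ≤ X a) {D : ENNReal} (hD : D ≠ ⊤) (h : ∫⁻ a, ENNReal.ofReal (X a) ∂ν ≤ D) :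
    Integrable X ν :=
  (lintegral_ofReal_ne_top_iff_integrable hX (ae_of_all _ hX0)).mp (h.trans_lt hD.lt_top).ne

lemma integral_le_of_lintegral_ofReal_le {X : α → ℝ} (hX : AEStronglyMeasurable X ν)
    (hX0 : ∀ a, 0 ≤ X a) {D : ℝ} (hD : 0 ≤ D)
    (h : ∫⁻ a, ENNReal.ofReal (X a) ∂ν ≤ ENNReal.ofReal D) : ∫ a, X a ∂ν ≤ D := by
  rw [integral_eq_lintegral_of_nonneg_ae (ae_of_all _ hX0) hX]
  exact ENNReal.toReal_le_of_le_ofReal hD h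

/-- An affine lower bound of `Y` in terms of `X` passes to expectations. -/
lemma ofReal_le_lintegral_of_affine {X Y : α → ℝ} (hX : Integrable X ν)
    (hY : AEStronglyMeasurable Y ν) (hY0 : ∀ a, 0 ≤ Y a) {A B D : ℝ} (hB : 0 ≤ B)
    (hD : ∫ a, X a ∂ν ≤ D) (h : ∀ᵐ a ∂ν, A - B * X a ≤ Y a) :
    ENNReal.ofReal (A - B * D) ≤ ∫⁻ a, ENNReal.ofReal (Y a) ∂ν := by
  by_cases hY' : Integrable Y ν
  · rw [← ofReal_integral_eq_lintegral_ofReal hY' (ae_of_all _ hY0)]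
    refine ENNReal.ofReal_le_ofReal ?_
    calc A - B * D ≤ A - B * ∫ a, X a ∂ν := by gcongr
      _ = ∫ a, (A - B * X a) ∂ν := by
        rw [integral_sub (integrable_const _) (hX.const_mul _), integral_const_mul]
        simp
      _ ≤ _ := integral_mono_ae ((integrable_const _).sub (hX.const_mul _)) hY' h
  · have : ∫⁻ a, ENNReal.ofReal (Y a) ∂ν = ⊤ := by
      by_contra hc
      exact hY' ((lintegral_ofReal_ne_top_iff_integrable hY (ae_of_all _ hY0)).mp hc)
    rw [this]
    exact le_top

/-- Jensen for 1/x by its tangent 2/D - x/D² at D. The tangent is decreasing, so an upper bound on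
the mean of X suffices, and Y need not be integrable. -/
lemma ofReal_inv_le_lintegral {X Y : α → ℝ} (hX : AEStronglyMeasurable X ν)
    (hX0 : ∀ a, 0 ≤ X a) (hY : AEStronglyMeasurable Y ν) (hY0 : ∀ a, 0 ≤ Y a) {D : ℝ}
    (hD : 0 < D) (hXD : ∫⁻ a, ENNReal.ofReal (X a) ∂ν ≤ ENNReal.ofReal D)
    (h : ∀ᵐ a ∂ν, 1 ≤ Y a * X a) :
    ENNReal.ofReal (1 / D) ≤ ∫⁻ a, ENNReal.ofReal (Y a) ∂ν := by
  have h1 := ofReal_le_lintegral_of_affine (A := 2 / D) (B := 1 / D ^ 2)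
    (integrable_of_lintegral_ofReal_le hX hX0 ENNReal.ofReal_ne_top hXD) hY hY0 (by positivity)
    (integral_le_of_lintegral_ofReal_le hX hX0 hD.le hXD) ?_
  · have : 2 / D - 1 / D ^ 2 * D = 1 / D := by field_simp; ring
    rwa [this] at h1
  · filter_upwards [h] with a ha
    have hXp : 0 < X a := by
      rcases (hX0 a).eq_or_lt with h0 | h0
      · rw [← h0] at ha; simp at ha; linarith
      · exact h0
    have h2 : 1 / X a ≤ Y a := by rwa [div_le_iff₀ hXp]
    refine le_trans ?_ h2
    have h3 : 1 / X a - (2 / D - 1 / D ^ 2 * X a) = (D - X a) ^ 2 / (D ^ 2 * X a) := by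
      field_simp; ring
    have h4 : 0 ≤ (D - X a) ^ 2 / (D ^ 2 * X a) := by positivity
    linarith

/-- Jensen for the square by the tangent 2xy - x² at x; passing to -Y makes it decreasing, as
`ofReal_le_lintegral_of_affine` requires. -/
lemma ofReal_sq_le_lintegral_sq {Y : α → ℝ} (hY : AEStronglyMeasurable Y ν) {x : ℝ} (hx : 0 ≤ x)
    (hYi : Integrable Y ν) (hY0 : ∀ a, 0 ≤ Y a)
    (h : ENNReal.ofReal x ≤ ∫⁻ a, ENNReal.ofReal (Y a) ∂ν) :
    ENNReal.ofReal (x ^ 2) ≤ ∫⁻ a, ENNReal.ofReal (Y a ^ 2) ∂ν := by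
  have hx' : x ≤ ∫ a, Y a ∂ν := by
    rw [← ofReal_integral_eq_lintegral_ofReal hYi (ae_of_all _ hY0)] at h
    exact (ENNReal.ofReal_le_ofReal_iff (integral_nonneg hY0)).mp h
  have h1 := ofReal_le_lintegral_of_affine (X := fun a => -Y a) (Y := fun a => Y a ^ 2)
    (A := -x ^ 2) (B := 2 * x) (D := -x) hYi.neg (hY.pow 2) (fun a => by positivity) (by positivity)
    (by rw [integral_neg]; linarith) (ae_of_all _ fun a => by nlinarith [sq_nonneg (Y a - x)])
  have : -x ^ 2 - 2 * x * -x = x ^ 2 := by ring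
  rwa [this] at h1

end Jensen

/-! ### Families with independent Gaussian columns -/

section Family

variable {T ι : Type*} [Fintype T] [DecidableEq T] [Fintype ι] [DecidableEq ι]

/-- The law of a family of independent vectors with i.i.d. `CN(0, v k)` entries. -/
def gaussFam (T : Type*) [Fintype T] (v : ι → ℝ≥0) : Measure (ι → T → ℂ) :=
  Measure.pi fun k => gaussVec T (v k)

instance (v : ι → ℝ≥0) : IsProbabilityMeasure (gaussFam T v) := by
  unfold gaussFam; infer_instance

/-- Gaussian columns with means `m k` and scale factors `c k`. -/
def gaussCols (m : ι → T → ℂ) (c : ι → ℝ) (g : ι → T → ℂ) : ι → T → ℂ :=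
  fun k => m k + (c k : ℂ) • g k

lemma gaussCols_update (m : ι → T → ℂ) (c : ι → ℝ) (g : ι → T → ℂ) (k : ι) (y : T → ℂ) :
    gaussCols m c (Function.update g k y)
      = Function.update (gaussCols m c g) k (m k + (c k : ℂ) • y) := by
  ext j t
  by_cases hj : j = k
  · subst hj; simp [gaussCols]
  · simp [gaussCols, Function.update_of_ne hj]

lemma continuous_gramDet : Continuous (gramDet : (ι → T → ℂ) → ℂ) := by
  unfold gramDet
  refine Continuous.matrix_det ?_
  refine Continuous.matrix_mul (Continuous.matrix_conjTranspose ?_) ?_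
  all_goals
    refine continuous_matrix fun i j => ?_
    simp only [colMatrix, Matrix.of_apply]
    fun_prop

lemma measurable_gramInv (i j : ι) :
    Measurable fun x : ι → T → ℂ => (((colMatrix x)ᴴ * colMatrix x)⁻¹) i j := by
  have h1 : Continuous fun x : ι → T → ℂ => colMatrix x :=
    continuous_matrix fun i j => by simp only [colMatrix, Matrix.of_apply]; fun_prop
  have h2 : Continuous fun x : ι → T → ℂ => ((colMatrix x)ᴴ * colMatrix x).adjugate :=
    (Continuous.matrix_mul h1.matrix_conjTranspose h1).matrix_adjugate
  have h3 : (fun x : ι → T → ℂ => (((colMatrix x)ᴴ * colMatrix x)⁻¹) i j)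
      = fun x => (gramDet x)⁻¹ * ((colMatrix x)ᴴ * colMatrix x).adjugate i j := by
    ext x
    rw [Matrix.inv_def, Matrix.smul_apply, Ring.inverse_eq_inv', smul_eq_mul]
    rfl
  rw [h3]
  exact (continuous_gramDet.measurable.inv).mul (h2.matrix_elem i j).measurable

@[fun_prop]
lemma measurable_dualVec (k : ι) : Measurable fun x : ι → T → ℂ => dualVec x k := by
  simp only [dualVec_eq_sum]
  refine measurable_pi_lambda _ fun t => ?_
  simp only [Finset.sum_apply, Pi.smul_apply, smul_eq_mul]
  refine Finset.measurable_sum _ fun j _ => (measurable_gramInv j k).mul ?_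
  fun_prop

@[fun_prop]
lemma continuous_gaussCols (m : ι → T → ℂ) (c : ι → ℝ) : Continuous (gaussCols m c) := by
  unfold gaussCols; fun_prop

@[fun_prop]
lemma measurable_gaussCols (m : ι → T → ℂ) (c : ι → ℝ) : Measurable (gaussCols m c) :=
  (continuous_gaussCols m c).measurable

@[fun_prop]
lemma continuous_sqNorm : Continuous (sqNorm : (T → ℂ) → ℝ) := by
  unfold sqNorm; fun_prop

@[fun_prop]
lemma measurable_sqNorm : Measurable (sqNorm : (T → ℂ) → ℝ) := continuous_sqNorm.measurable

/-- Replacing column k by an independent copy leaves the law unchanged. This is how conditioning on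
the other columns is expressed throughout. -/
lemma measurePreserving_update (v : ι → ℝ≥0) (k : ι) :
    MeasurePreserving (fun p : (ι → T → ℂ) × (T → ℂ) => Function.update p.1 k p.2)
      ((gaussFam T v).prod (gaussVec T (v k))) (gaussFam T v) := by
  have hm : Measurable fun p : (ι → T → ℂ) × (T → ℂ) => Function.update p.1 k p.2 := by
    refine measurable_pi_lambda _ fun j => ?_
    by_cases hj : j = k
    · subst hj; simp only [Function.update_self]; fun_prop
    · simp only [Function.update_of_ne hj]; fun_prop
  refine ⟨hm, ?_⟩
  symm
  refine Measure.pi_eq fun s hs => ?_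
  rw [Measure.map_apply hm (MeasurableSet.univ_pi hs)]
  have hpre : (fun p : (ι → T → ℂ) × (T → ℂ) => Function.update p.1 k p.2) ⁻¹' Set.univ.pi s
      = (Set.univ.pi (Function.update s k Set.univ)) ×ˢ s k := by
    ext p
    simp only [Set.mem_preimage, Set.mem_pi, Set.mem_univ, true_implies, Set.mem_prod]
    constructor
    · intro h
      refine ⟨fun j => ?_, by simpa using h k⟩
      by_cases hj : j = k
      · subst hj; simp
      · rw [Function.update_of_ne hj]; simpa [Function.update_of_ne hj] using h j
    · rintro ⟨h1, h2⟩ j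
      by_cases hj : j = k
      · subst hj; simpa using h2
      · have := h1 j
        rw [Function.update_of_ne hj] at this ⊢
        exact this
  rw [hpre, Measure.prod_prod, gaussFam, Measure.pi_pi,
    ← Finset.mul_prod_erase Finset.univ _ (Finset.mem_univ k),
    ← Finset.mul_prod_erase Finset.univ (fun j => gaussVec T (v j) (s j)) (Finset.mem_univ k)]
  simp only [Function.update_self, measure_univ, one_mul]
  rw [mul_comm]
  congr 1
  refine Finset.prod_congr rfl fun j hj => ?_
  rw [Function.update_of_ne (Finset.ne_of_mem_erase hj)]

lemma lintegral_gaussFam_update (v : ι → ℝ≥0) (k : ι) {F : (ι → T → ℂ) → ENNReal}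
    (hF : Measurable F) :
    ∫⁻ g, F g ∂gaussFam T v
      = ∫⁻ g, ∫⁻ y, F (Function.update g k y) ∂gaussVec T (v k) ∂gaussFam T v := by
  have h := measurePreserving_update (T := T) v k
  rw [← h.lintegral_comp hF]
  exact lintegral_prod (fun p : (ι → T → ℂ) × (T → ℂ) => F (Function.update p.1 k p.2))
    (hF.comp h.measurable).aemeasurable

lemma ae_gaussFam_of_update (v : ι → ℝ≥0) (k : ι) {p : (ι → T → ℂ) → Prop}
    (hp : MeasurableSet {g | p g})
    (h : ∀ᵐ g ∂gaussFam T v, ∀ᵐ y ∂gaussVec T (v k), p (Function.update g k y)) :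
    ∀ᵐ g ∂gaussFam T v, p g := by
  have hmp := measurePreserving_update (T := T) v k
  rw [← hmp.map_eq, ae_map_iff hmp.aemeasurable hp]
  exact (Measure.ae_prod_iff_ae_ae (hmp.measurable hp)).mpr h

lemma ae_gaussVec_eq_zero {v : ℝ≥0} (hv : v = 0) : ∀ᵐ g ∂gaussVec T v, g = 0 := by
  have h1 : ∀ᵐ z ∂complexGaussian v, z = 0 := by
    have h := lintegral_norm_sq_complexGaussian v
    rw [hv] at h ⊢
    rw [ENNReal.coe_zero, lintegral_eq_zero_iff (by fun_prop)] at h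
    filter_upwards [h] with z hz
    simpa using hz
  have h2 : ∀ t, ∀ᵐ g ∂gaussVec T v, g t = 0 := fun t =>
    (measurePreserving_eval (fun _ : T => complexGaussian v) t).quasiMeasurePreserving.ae h1
  filter_upwards [ae_all_iff.mpr h2] with g hg using funext hg

lemma lintegral_norm_sq_apply_gaussVec (v : ℝ≥0) (t : T) :
    ∫⁻ g, ENNReal.ofReal (‖g t‖ ^ 2) ∂gaussVec T v = v := by
  rw [← lintegral_norm_sq_complexGaussian v]
  exact (measurePreserving_eval (fun _ : T => complexGaussian v) t).lintegral_comp
    (f := fun z : ℂ => ENNReal.ofReal (‖z‖ ^ 2)) (by fun_prop)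

variable {m : ι → T → ℂ}

lemma linearIndependent_of_orthogonal (hm : ∀ i j, i ≠ j → star (m i) ⬝ᵥ m j = 0)
    (hm0 : ∀ i, m i ≠ 0) : LinearIndependent ℂ m := by
  rw [Fintype.linearIndependent_iff]
  intro g hg i
  have h := congrArg (fun z => star (m i) ⬝ᵥ z) hg
  simp only [dotProduct_sum, dotProduct_smul, dotProduct_zero] at h
  rw [Finset.sum_eq_single i (fun j _ hj => by rw [hm i j hj.symm, smul_zero]) (by simp),
    star_dotProduct_self, smul_eq_mul] at h
  refine (mul_eq_zero.mp h).resolve_right ?_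
  exact_mod_cast (sqNorm_pos (hm0 i)).ne'

/-- The columns are almost surely linearly independent. -/
lemma ae_gramDet_gaussCols_ne_zero (hm : ∀ i j, i ≠ j → star (m i) ⬝ᵥ m j = 0)
    (hm0 : ∀ i, m i ≠ 0) {d : ℕ} (hd : 1 ≤ d) (hT : Fintype.card T = Fintype.card ι + d)
    (c : ι → ℝ) (v : ι → ℝ≥0) : ∀ᵐ g ∂gaussFam T v, gramDet (gaussCols m c g) ≠ 0 := by
  -- S is the set of columns whose Gaussian part is switched on. For S empty the columns are the
  -- orthogonal nonzero means; switching on one more column keeps independence almost surely, and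
  -- changes nothing when its scale or variance is zero.
  have key : ∀ S : Finset ι, ∀ᵐ g ∂gaussFam T v,
      gramDet (gaussCols m (fun j => if j ∈ S then c j else 0) g) ≠ 0 := by
    intro S
    induction S using Finset.induction_on with
    | empty =>
      refine ae_of_all _ fun g => ?_
      have : gaussCols m (fun j => if j ∈ (∅ : Finset ι) then c j else 0) g = m := by
        ext j t; simp [gaussCols]
      rw [this]
      exact gramDet_ne_zero_iff.mpr (linearIndependent_of_orthogonal hm hm0)
    | insert k S hk ih =>
      refine ae_gaussFam_of_update v k ?_ ?_
      · exact ((continuous_gramDet.comp (continuous_gaussCols _ _)).measurable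
          (measurableSet_singleton 0)).compl
      · filter_upwards [ih] with g hg
        have hup (y : T → ℂ) : gaussCols m (fun j => if j ∈ insert k S then c j else 0)
              (Function.update g k y)
            = Function.update (gaussCols m (fun j => if j ∈ S then c j else 0) g) k
              (m k + (c k : ℂ) • y) := by
          rw [gaussCols_update]
          simp only [Finset.mem_insert_self, if_true]
          ext j t
          by_cases hj : j = k
          · subst hj; simp
          · simp [gaussCols, hj]
        have hdeg {y : T → ℂ} (hy : (c k : ℂ) • y = 0) :
            gramDet (gaussCols m (fun j => if j ∈ insert k S then c j else 0)
              (Function.update g k y)) ≠ 0 := by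
          have : m k = gaussCols m (fun j => if j ∈ S then c j else 0) g k := by
            simp [gaussCols, hk]
          rw [hup, hy, add_zero, this, Function.update_eq_self]
          exact hg
        by_cases hw : 0 < c k ^ 2 * (v k : ℝ)
        · filter_upwards [ae_gramDet_update_ne_zero hg hd hT (m k) (c k) (v k) hw] with y hy
          rw [hup]; exact hy
        · by_cases hc : c k = 0
          · exact ae_of_all _ fun y => hdeg (by simp [hc])
          · have hv : v k = 0 := by
              by_contra hv
              exact hw (by positivity)
            filter_upwards [ae_gaussVec_eq_zero hv] with y hy
            exact hdeg (by simp [hy])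
  simpa using key Finset.univ

variable {c : ι → ℝ} {v : ι → ℝ≥0} {d : ℕ} {k : ι}

lemma lintegral_sqNorm_dualVec_gaussCols_le (hm : ∀ i j, i ≠ j → star (m i) ⬝ᵥ m j = 0)
    (hm0 : ∀ i, m i ≠ 0) (hd : 1 ≤ d) (hT : Fintype.card T = Fintype.card ι + d)
    (hw : 0 < c k ^ 2 * v k) :
    ∫⁻ g, ENNReal.ofReal (sqNorm (dualVec (gaussCols m c g) k)) ∂gaussFam T v
      ≤ ENNReal.ofReal (1 / (c k ^ 2 * v k * d)) := by
  rw [lintegral_gaussFam_update v k (by fun_prop)]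
  calc _ ≤ ∫⁻ _g, ENNReal.ofReal (1 / (c k ^ 2 * v k * d)) ∂gaussFam T v := by
        refine lintegral_mono_ae ?_
        filter_upwards [ae_gramDet_gaussCols_ne_zero hm hm0 hd hT c v] with g hg
        simp only [gaussCols_update]
        exact lintegral_sqNorm_dualVec_update_le hg hd hT (m k) (c k) (v k) hw
    _ = _ := by simp

/-- Given the columns other than j, column k is m k, which is orthogonal to the mean of column j, so
the one-column estimate applies. If column j has no randomness the product is zero by the same
orthogonality. -/
lemma lintegral_sqNorm_dualVec_gaussCols_mul_le (hm : ∀ i j, i ≠ j → star (m i) ⬝ᵥ m j = 0)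
    (hm0 : ∀ i, m i ≠ 0) (hd : 1 ≤ d) (hT : Fintype.card T = Fintype.card ι + d)
    (hk : c k = 0) {j : ι} (hj : j ≠ k) :
    ∫⁻ g, ENNReal.ofReal (sqNorm (dualVec (gaussCols m c g) j)
        * ‖star (m k) ⬝ᵥ gaussCols m c g j‖ ^ 2) ∂gaussFam T v
      ≤ ENNReal.ofReal (sqNorm (m k) / d) := by
  rw [lintegral_gaussFam_update v j (by simp only [dotProduct]; fun_prop)]
  calc _ ≤ ∫⁻ _g, ENNReal.ofReal (sqNorm (m k) / d) ∂gaussFam T v := by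
        refine lintegral_mono_ae ?_
        filter_upwards [ae_gramDet_gaussCols_ne_zero hm hm0 hd hT c v] with g hg
        simp only [gaussCols_update, Function.update_self]
        by_cases hw : 0 < c j ^ 2 * (v j : ℝ)
        · have hk' : gaussCols m c g k = m k := by simp [gaussCols, hk]
          have h := lintegral_sqNorm_dualVec_update_mul_le (k := j) (i := k) (m := m j) hg hd hT hw
            hj.symm (by rw [hk']; exact hm k j hj.symm)
          rwa [hk'] at h
        · have h0 : ∀ᵐ y ∂gaussVec T (v j), (c j : ℂ) • y = 0 := by
            by_cases hc : c j = 0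
            · exact ae_of_all _ fun y => by simp [hc]
            · have hv : v j = 0 := by
                by_contra hv
                exact hw (by positivity)
              filter_upwards [ae_gaussVec_eq_zero hv] with y hy
              simp [hy]
          refine le_trans (le_of_eq ?_) (zero_le)
          rw [lintegral_eq_zero_iff' (by
            apply Measurable.aemeasurable
            have hmeas : Measurable fun y : T → ℂ => Function.update (gaussCols m c g) j
                (m j + (c j : ℂ) • y) := by
              refine measurable_pi_lambda _ fun i => ?_
              by_cases hi : i = j
              · subst hi; simp only [Function.update_self]; fun_prop
              · simp only [Function.update_of_ne hi]; fun_prop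
            have h2 := (measurable_dualVec j).comp hmeas
            simp only [Function.comp_def] at h2
            simp only [dotProduct]
            fun_prop)]
          filter_upwards [h0] with y hy
          rw [hy, add_zero, hm k j hj.symm]
          simp
    _ = _ := by simp

end Family

/-! ### The dual vector of a deterministic column -/

section DeterministicColumn

variable {T ι : Type*} [Fintype T] [DecidableEq T] [Fintype ι] [DecidableEq ι]

lemma integral_eq_zero_of_measurePreserving_neg {α : Type*} [MeasurableSpace α] {ν : Measure α}
    {f : α → ℂ} (hf : Measurable f) {S : α → α} (hS : MeasurePreserving S ν ν)
    (h : ∀ᵐ a ∂ν, f (S a) = -f a) : ∫ a, f a ∂ν = 0 := by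
  have h1 : ∫ a, f a ∂ν = ∫ a, f (S a) ∂ν := by
    conv_lhs => rw [← hS.map_eq]
    exact integral_map hS.aemeasurable hf.aestronglyMeasurable
  rw [integral_congr_ae h, integral_neg] at h1
  exact self_eq_neg.mp h1

/-- Reflection along `m`. -/
def reflectVec (m y : T → ℂ) : T → ℂ := y - (2 / (sqNorm m : ℂ) * (star m ⬝ᵥ y)) • m

/-- The coordinate functionals of a reflection come from an orthonormal family, so invariance
follows from `measurePreserving_orthonormal`. -/
lemma measurePreserving_reflectVec (v : ℝ≥0) {m : T → ℂ} (hm : m ≠ 0) :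
    MeasurePreserving (reflectVec m) (gaussVec T v) (gaussVec T v) := by
  have hN : (sqNorm m : ℂ) ≠ 0 := by exact_mod_cast (sqNorm_pos hm).ne'
  let e : T → T → ℂ := fun a => Pi.single a 1 - (2 / (sqNorm m : ℂ) * star (m a)) • m
  have hstar (a : T) : star (e a) = Pi.single a 1 - (2 / (sqNorm m : ℂ) * m a) • star m := by
    ext t
    simp only [e, Pi.star_apply, Pi.sub_apply, Pi.smul_apply, smul_eq_mul, star_sub, star_mul',
      star_star, Pi.single_apply]
    congr 1
    · split_ifs <;> simp
    · have : star (2 / (sqNorm m : ℂ)) = 2 / (sqNorm m : ℂ) := by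
        rw [star_div₀, RCLike.star_def, Complex.conj_ofReal, map_ofNat]
      rw [this]
  have hdot (a : T) (y : T → ℂ) : star (e a) ⬝ᵥ y = reflectVec m y a := by
    rw [hstar, sub_dotProduct, smul_dotProduct, single_dotProduct, one_mul]
    simp only [reflectVec, Pi.sub_apply, Pi.smul_apply, smul_eq_mul]
    ring
  have h := measurePreserving_orthonormal v e (fun a b => by
    rw [hdot]
    simp only [reflectVec, Pi.sub_apply, Pi.smul_apply, smul_eq_mul, e, dotProduct_sub,
      dotProduct_smul, star_dotProduct_self, dotProduct_single, Pi.star_apply, Pi.single_apply]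
    field_simp
    ring)
  have : (fun (g : T → ℂ) a => star (e a) ⬝ᵥ g) = reflectVec m := by
    ext g a
    exact hdot a g
  rwa [this] at h

variable {m : ι → T → ℂ} {c : ι → ℝ} {v : ι → ℝ≥0} {d : ℕ} {k : ι}

/-- Reflection of the `j`-th vector of a family. -/
def reflectAt (f : T → ℂ) (j : ι) (g : ι → T → ℂ) : ι → T → ℂ :=
  Function.update g j (reflectVec f (g j))

lemma measurePreserving_reflectAt (v : ι → ℝ≥0) {f : T → ℂ} (hf : f ≠ 0) (j : ι) :
    MeasurePreserving (reflectAt f j) (gaussFam T v) (gaussFam T v) := by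
  have h := measurePreserving_pi (fun i => gaussVec T (v i)) (fun i => gaussVec T (v i))
    (f := fun i => if i = j then reflectVec f else id) (fun i => by
      split_ifs
      · exact measurePreserving_reflectVec _ hf
      · exact MeasurePreserving.id _)
  have he : (fun (g : ι → T → ℂ) i => (if i = j then reflectVec f else id) (g i))
      = reflectAt f j := by
    ext g i t
    by_cases hi : i = j
    · subst hi; simp [reflectAt]
    · simp [reflectAt, hi]
  rwa [he] at h

/-- A column plus a multiple of another column leaves the remaining dual vectors unchanged. -/
lemma dualVec_update_add_smul {x : ι → T → ℂ} (hx : gramDet x ≠ 0) {j k i : ι} (hjk : j ≠ k)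
    (hik : i ≠ k) (b : ℂ) (hx' : gramDet (Function.update x j (x j + b • x k)) ≠ 0) :
    dualVec (Function.update x j (x j + b • x k)) i = dualVec x i := by
  symm
  set x' := Function.update x j (x j + b • x k) with hx'def
  have hxj : x j = x' j - b • x' k := by
    simp [hx'def, Function.update_of_ne hjk.symm]
  -- Substituting x j = x' j - b x' k moves -b times the j-th coefficient onto column k. The
  -- relation at column j survives because i ≠ k.
  refine eq_dualVec_of_dual hx' (fun l => (((colMatrix x)ᴴ * colMatrix x)⁻¹) l i
    - if l = k then (((colMatrix x)ᴴ * colMatrix x)⁻¹) j i * b else 0) ?_ ?_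
  · rw [dualVec_eq_sum]
    simp only [sub_smul, Finset.sum_sub_distrib, ite_smul, zero_smul, Finset.sum_ite_eq',
      Finset.mem_univ, if_true]
    rw [← Finset.add_sum_erase _ _ (Finset.mem_univ j),
      ← Finset.add_sum_erase Finset.univ
        (fun l => (((colMatrix x)ᴴ * colMatrix x)⁻¹) l i • x' l) (Finset.mem_univ j)]
    have : ∑ l ∈ Finset.univ.erase j, (((colMatrix x)ᴴ * colMatrix x)⁻¹) l i • x l
        = ∑ l ∈ Finset.univ.erase j, (((colMatrix x)ᴴ * colMatrix x)⁻¹) l i • x' l := by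
      refine Finset.sum_congr rfl fun l hl => ?_
      rw [hx'def, Function.update_of_ne (Finset.ne_of_mem_erase hl)]
    rw [this]
    nth_rewrite 1 [hxj]
    rw [smul_sub, smul_smul]
    abel
  · intro l
    by_cases hl : l = j
    · subst hl
      simp only [hx'def, Function.update_self, star_add, star_smul, add_dotProduct,
        smul_dotProduct, star_dotProduct_dualVec hx]
      rw [if_neg (Ne.symm hik), smul_zero, add_zero]
    · rw [hx'def, Function.update_of_ne hl, star_dotProduct_dualVec hx]

/-- Since m k is orthogonal to m j, reflecting the Gaussian part reflects the whole column, that is,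
adds to column j a multiple of the deterministic column k. -/
lemma gaussCols_reflectAt (hm : ∀ i j, i ≠ j → star (m i) ⬝ᵥ m j = 0) {j : ι} (hjk : j ≠ k)
    (g : ι → T → ℂ) (hk : c k = 0) :
    gaussCols m c (reflectAt (m k) j g) = Function.update (gaussCols m c g) j
      (gaussCols m c g j
        + (-(2 / (sqNorm (m k) : ℂ) * (star (m k) ⬝ᵥ gaussCols m c g j))) • gaussCols m c g k) := by
  rw [reflectAt, gaussCols_update]
  congr 1
  simp only [gaussCols, reflectVec, hk, dotProduct_add, dotProduct_smul, hm k j hjk.symm]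
  simp only [Complex.ofReal_zero, zero_smul, add_zero, zero_add, smul_sub, smul_smul, neg_smul,
    smul_eq_mul]
  rw [← sub_eq_add_neg, add_sub_assoc]
  congr 3
  ring

/-- The contribution of column `j` to the dual vector of the deterministic column `k`. -/
def crossTerm (m : ι → T → ℂ) (c : ι → ℝ) (k j : ι) (g : ι → T → ℂ) : T → ℂ :=
  ((star (gaussCols m c g j) ⬝ᵥ m k) / (sqNorm (m k) : ℂ)) • dualVec (gaussCols m c g) j

lemma measurable_crossTerm (j : ι) : Measurable (crossTerm m c k j) := by
  unfold crossTerm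
  have : Measurable fun g : ι → T → ℂ => dualVec (gaussCols m c g) j := by fun_prop
  refine measurable_pi_lambda _ fun t => ?_
  simp only [Pi.smul_apply, smul_eq_mul, dotProduct, Pi.star_apply]
  fun_prop

/-- Adding a multiple of column k to column j leaves the dual vectors of columns other than k
unchanged, while the component of column j along m k changes sign. -/
lemma crossTerm_reflectAt (hm : ∀ i j, i ≠ j → star (m i) ⬝ᵥ m j = 0) (hm0 : ∀ i, m i ≠ 0)
    (hk : c k = 0) {i j : ι} (hi : i ≠ k) (hj : j ≠ k) {g : ι → T → ℂ}
    (hg : gramDet (gaussCols m c g) ≠ 0)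
    (hg' : gramDet (gaussCols m c (reflectAt (m k) j g)) ≠ 0) :
    crossTerm m c k i (reflectAt (m k) j g)
      = if i = j then -crossTerm m c k i g else crossTerm m c k i g := by
  have hN : (sqNorm (m k) : ℂ) ≠ 0 := by exact_mod_cast (sqNorm_pos (hm0 k)).ne'
  have hxk : gaussCols m c g k = m k := by simp [gaussCols, hk]
  have hd : dualVec (gaussCols m c (reflectAt (m k) j g)) i = dualVec (gaussCols m c g) i := by
    rw [gaussCols_reflectAt hm hj g hk] at hg' ⊢
    exact dualVec_update_add_smul hg hj hi _ hg'
  rw [crossTerm, crossTerm, hd]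
  rw [gaussCols_reflectAt hm hj g hk]
  split_ifs with hij
  · subst hij
    rw [Function.update_self, hxk, ← neg_smul]
    congr 1
    rw [star_add, add_dotProduct, star_smul, smul_dotProduct, star_dotProduct_self,
      star_dotProduct_comm (gaussCols m c g i) (m k)]
    have : star (2 / (sqNorm (m k) : ℂ)) = 2 / (sqNorm (m k) : ℂ) := by
      rw [star_div₀, RCLike.star_def, Complex.conj_ofReal, map_ofNat]
    rw [star_neg, star_mul', this, smul_eq_mul]
    field_simp
    ring
  · rw [Function.update_of_ne hij]

/-- The vector m_k/‖m_k‖² has the right product with column k and product (x_jᴴ m_k)/‖m_k‖² with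
column j; subtracting these multiples of the other dual vectors restores duality. -/
lemma dualVec_eq_sub_crossTerm (hm0 : ∀ i, m i ≠ 0) (hk : c k = 0) {g : ι → T → ℂ}
    (hg : gramDet (gaussCols m c g) ≠ 0) :
    dualVec (gaussCols m c g) k
      = (sqNorm (m k) : ℂ)⁻¹ • m k - ∑ j ∈ Finset.univ.erase k, crossTerm m c k j g := by
  have hN : (sqNorm (m k) : ℂ) ≠ 0 := by exact_mod_cast (sqNorm_pos (hm0 k)).ne'
  set x := gaussCols m c g with hx
  have hxk : x k = m k := by simp [hx, gaussCols, hk]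
  symm
  refine eq_dualVec_of_dual hg (fun i => (if i = k then (sqNorm (m k) : ℂ)⁻¹ else 0)
    - ∑ j ∈ Finset.univ.erase k, ((star (x j) ⬝ᵥ m k) / (sqNorm (m k) : ℂ))
      * (((colMatrix x)ᴴ * colMatrix x)⁻¹) i j) ?_ ?_
  · simp only [sub_smul, Finset.sum_sub_distrib, ite_smul, zero_smul, Finset.sum_ite_eq',
      Finset.mem_univ, if_true, hxk]
    congr 1
    simp only [Finset.sum_smul]
    rw [Finset.sum_comm]
    refine Finset.sum_congr rfl fun j _ => ?_
    rw [crossTerm, ← hx, dualVec_eq_sum, Finset.smul_sum]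
    simp only [smul_smul]
  · intro i
    rw [dotProduct_sub, dotProduct_smul, dotProduct_sum]
    simp only [crossTerm, ← hx, dotProduct_smul, star_dotProduct_dualVec hg, smul_eq_mul, mul_ite,
      mul_one, mul_zero]
    rw [Finset.sum_ite_eq]
    by_cases hi : i = k
    · subst hi
      rw [hxk, star_dotProduct_self]
      simp [inv_mul_cancel₀ hN]
    · rw [if_pos (Finset.mem_erase.mpr ⟨hi, Finset.mem_univ i⟩), if_neg hi]
      field_simp
      ring

/-- Pythagoras: column k equals m k, to which the dual vectors of the other columns are orthogonal.
-/
lemma sqNorm_dualVec_eq_add (hm0 : ∀ i, m i ≠ 0) (hk : c k = 0) {g : ι → T → ℂ}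
    (hg : gramDet (gaussCols m c g) ≠ 0) :
    sqNorm (dualVec (gaussCols m c g) k)
      = 1 / sqNorm (m k) + sqNorm (∑ j ∈ Finset.univ.erase k, crossTerm m c k j g) := by
  have hN : sqNorm (m k) ≠ 0 := (sqNorm_pos (hm0 k)).ne'
  have hxk : gaussCols m c g k = m k := by simp [gaussCols, hk]
  rw [dualVec_eq_sub_crossTerm hm0 hk hg, sub_eq_add_neg, sqNorm_add]
  have h0 : star ((sqNorm (m k) : ℂ)⁻¹ • m k)
      ⬝ᵥ (-∑ j ∈ Finset.univ.erase k, crossTerm m c k j g) = 0 := by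
    rw [star_smul, smul_dotProduct, dotProduct_neg, dotProduct_sum, Finset.sum_eq_zero]
    · simp
    · intro j hj
      have h := star_dotProduct_dualVec hg k j
      rw [hxk, if_neg (Finset.ne_of_mem_erase hj).symm] at h
      rw [crossTerm, dotProduct_smul, h, smul_zero]
  have h1 : sqNorm (-∑ j ∈ Finset.univ.erase k, crossTerm m c k j g)
      = sqNorm (∑ j ∈ Finset.univ.erase k, crossTerm m c k j g) := by
    generalize ∑ j ∈ Finset.univ.erase k, crossTerm m c k j g = y
    simp [sqNorm]
  rw [h0, h1, sqNorm_smul, norm_inv, Complex.norm_real, Real.norm_eq_abs, inv_pow, sq_abs]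
  simp only [Complex.zero_re, mul_zero, add_zero]
  congr 1
  field_simp

lemma lintegral_sqNorm_crossTerm_le (hm : ∀ i j, i ≠ j → star (m i) ⬝ᵥ m j = 0)
    (hm0 : ∀ i, m i ≠ 0) (hd : 1 ≤ d) (hT : Fintype.card T = Fintype.card ι + d)
    (hk : c k = 0) {j : ι} (hj : j ≠ k) :
    ∫⁻ g, ENNReal.ofReal (sqNorm (crossTerm m c k j g)) ∂gaussFam T v
      ≤ ENNReal.ofReal (1 / (sqNorm (m k) * d)) := by
  have hN := sqNorm_pos (hm0 k)
  have h1 (g : ι → T → ℂ) : ENNReal.ofReal (sqNorm (crossTerm m c k j g))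
      = ENNReal.ofReal (1 / sqNorm (m k) ^ 2) * ENNReal.ofReal
        (sqNorm (dualVec (gaussCols m c g) j) * ‖star (m k) ⬝ᵥ gaussCols m c g j‖ ^ 2) := by
    rw [← ENNReal.ofReal_mul (by positivity), crossTerm, sqNorm_smul, norm_div,
      norm_star_dotProduct_comm, Complex.norm_real, Real.norm_eq_abs, div_pow, sq_abs]
    congr 1
    ring
  simp only [h1]
  rw [lintegral_const_mul' _ _ ENNReal.ofReal_ne_top]
  calc _ ≤ ENNReal.ofReal (1 / sqNorm (m k) ^ 2) * ENNReal.ofReal (sqNorm (m k) / d) := by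
        gcongr
        exact lintegral_sqNorm_dualVec_gaussCols_mul_le hm hm0 hd hT hk hj
    _ = _ := by
        rw [← ENNReal.ofReal_mul (by positivity)]
        congr 1
        field_simp

/-- The expected energy is 1/‖m_k‖² plus that of card ι - 1 cross terms, uncorrelated and each at
most 1/(‖m_k‖² d). The total follows from 1 + (card ι - 1)/d = (card T - 1)/d. -/
lemma lintegral_sqNorm_dualVec_of_deterministic_le
    (hm : ∀ i j, i ≠ j → star (m i) ⬝ᵥ m j = 0) (hm0 : ∀ i, m i ≠ 0) (hd : 1 ≤ d)
    (hT : Fintype.card T = Fintype.card ι + d) (hk : c k = 0) :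
    ∫⁻ g, ENNReal.ofReal (sqNorm (dualVec (gaussCols m c g) k)) ∂gaussFam T v
      ≤ ENNReal.ofReal ((Fintype.card T - 1) / (sqNorm (m k) * d)) := by
  have hN := sqNorm_pos (hm0 k)
  have hd0 : (0 : ℝ) < d := by exact_mod_cast hd
  have hdet := ae_gramDet_gaussCols_ne_zero hm hm0 hd hT c v
  set ν := gaussFam T v with hν
  set s : Finset ι := Finset.univ.erase k with hs
  have hmeas (j : ι) : Measurable (crossTerm m c k j) := measurable_crossTerm j
  have hint (j : ι) (hj : j ∈ s) : Integrable (fun g => sqNorm (crossTerm m c k j g)) ν :=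
    integrable_of_lintegral_ofReal_le
      (by have := hmeas j; exact (measurable_sqNorm.comp this).aestronglyMeasurable)
      (fun g => sqNorm_nonneg _) ENNReal.ofReal_ne_top
      (lintegral_sqNorm_crossTerm_le hm hm0 hd hT hk (Finset.ne_of_mem_erase hj))
  have hint_le (j : ι) (hj : j ∈ s) : ∫ g, sqNorm (crossTerm m c k j g) ∂ν
      ≤ 1 / (sqNorm (m k) * d) :=
    integral_le_of_lintegral_ofReal_le
      (by have := hmeas j; exact (measurable_sqNorm.comp this).aestronglyMeasurable)
      (fun g => sqNorm_nonneg _) (by positivity)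
      (lintegral_sqNorm_crossTerm_le hm hm0 hd hT hk (Finset.ne_of_mem_erase hj))
  have hL2 (j : ι) (hj : j ∈ s) (t : T) : MemLp (fun g => crossTerm m c k j g t) 2 ν := by
    have hmt : Measurable fun g => crossTerm m c k j g t := (measurable_pi_apply t).comp (hmeas j)
    rw [memLp_two_iff_integrable_sq_norm hmt.aestronglyMeasurable]
    refine (hint j hj).mono' (by fun_prop) (ae_of_all _ fun g => ?_)
    rw [Real.norm_eq_abs, abs_of_nonneg (by positivity)]
    exact Finset.single_le_sum (f := fun t => ‖crossTerm m c k j g t‖ ^ 2)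
      (fun _ _ => by positivity) (Finset.mem_univ t)
  have hcross_int (i j : ι) (hi : i ∈ s) (hj : j ∈ s) :
      Integrable (fun g => star (crossTerm m c k i g) ⬝ᵥ crossTerm m c k j g) ν := by
    simp only [dotProduct]
    refine integrable_finsetSum _ fun t _ => ?_
    exact (hL2 i hi t).star.integrable_mul (hL2 j hj t)
  -- Reflecting column j along m k preserves the law, flips the j-th term and fixes the i-th, so the
  -- integrand is odd.
  have hcross (i j : ι) (hi : i ∈ s) (hj : j ∈ s) (hij : i ≠ j) :
      ∫ g, star (crossTerm m c k i g) ⬝ᵥ crossTerm m c k j g ∂ν = 0 := by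
    have hR := measurePreserving_reflectAt v (hm0 k) j
    refine integral_eq_zero_of_measurePreserving_neg ?_ hR ?_
    · have h1 := hmeas i
      have h2 := hmeas j
      simp only [dotProduct, Pi.star_apply]
      fun_prop
    · filter_upwards [hdet, hR.quasiMeasurePreserving.ae hdet] with g hg hg'
      rw [crossTerm_reflectAt hm hm0 hk (Finset.ne_of_mem_erase hi) (Finset.ne_of_mem_erase hj)
        hg hg', crossTerm_reflectAt hm hm0 hk (Finset.ne_of_mem_erase hj)
        (Finset.ne_of_mem_erase hj) hg hg', if_neg hij, if_pos rfl, dotProduct_neg]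
  have hexp (g : ι → T → ℂ) : (sqNorm (∑ j ∈ s, crossTerm m c k j g) : ℂ)
      = ∑ i ∈ s, ∑ j ∈ s, star (crossTerm m c k i g) ⬝ᵥ crossTerm m c k j g := by
    rw [← star_dotProduct_self, star_sum, sum_dotProduct]
    simp only [dotProduct_sum]
  have hsum : ∫ g, sqNorm (∑ j ∈ s, crossTerm m c k j g) ∂ν
      = ∑ j ∈ s, ∫ g, sqNorm (crossTerm m c k j g) ∂ν := by
    have h : ((∫ g, sqNorm (∑ j ∈ s, crossTerm m c k j g) ∂ν : ℝ) : ℂ)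
        = ((∑ j ∈ s, ∫ g, sqNorm (crossTerm m c k j g) ∂ν : ℝ) : ℂ) := by
      rw [← integral_complex_ofReal]
      simp only [hexp]
      rw [integral_finsetSum _ fun i hi => integrable_finsetSum _ fun j hj =>
        hcross_int i j hi hj]
      push_cast
      refine Finset.sum_congr rfl fun i hi => ?_
      rw [integral_finsetSum _ fun j hj => hcross_int i j hi hj,
        Finset.sum_eq_single_of_mem i hi fun j hj hji => hcross i j hi hj hji.symm,
        ← integral_complex_ofReal]
      simp only [star_dotProduct_self]
    exact_mod_cast h
  have hint_sum : Integrable (fun g => sqNorm (∑ j ∈ s, crossTerm m c k j g)) ν := by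
    have h : Integrable (fun g => ((sqNorm (∑ j ∈ s, crossTerm m c k j g) : ℝ) : ℂ)) ν := by
      simp only [hexp]
      exact integrable_finsetSum _ fun i hi => integrable_finsetSum _ fun j hj =>
        hcross_int i j hi hj
    simpa using h.re
  have hint_add : Integrable
      (fun g => 1 / sqNorm (m k) + sqNorm (∑ j ∈ s, crossTerm m c k j g)) ν :=
    (integrable_const _).add hint_sum
  have hle : ∫ g, sqNorm (∑ j ∈ s, crossTerm m c k j g) ∂ν
      ≤ (Fintype.card ι - 1) * (1 / (sqNorm (m k) * d)) := by
    rw [hsum]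
    refine (Finset.sum_le_sum hint_le).trans (le_of_eq ?_)
    rw [Finset.sum_const, hs, Finset.card_erase_of_mem (Finset.mem_univ k), Finset.card_univ,
      nsmul_eq_mul, Nat.cast_sub (Fintype.card_pos_iff.mpr ⟨k⟩)]
    simp
  rw [lintegral_congr_ae (g := fun g => ENNReal.ofReal
    (1 / sqNorm (m k) + sqNorm (∑ j ∈ s, crossTerm m c k j g)))
    (by filter_upwards [hdet] with g hg; rw [sqNorm_dualVec_eq_add hm0 hk hg]),
    ← ofReal_integral_eq_lintegral_ofReal hint_add
      (ae_of_all _ fun g => add_nonneg (by positivity) (sqNorm_nonneg _)),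
    integral_add (integrable_const _) hint_sum]
  refine ENNReal.ofReal_le_ofReal ?_
  have hTr : (Fintype.card T : ℝ) = Fintype.card ι + d := by exact_mod_cast hT
  rw [integral_const, hTr]
  simp only [probReal_univ, one_smul]
  refine (add_le_add_right hle _).trans (le_of_eq ?_)
  field_simp
  ring

/-- The correlation of the dual vector with the mean of its column, averaged over all columns. -/
lemma lintegral_norm_star_dualVec_dotProduct_ge
    (hm : ∀ i j, i ≠ j → star (m i) ⬝ᵥ m j = 0) (hm0 : ∀ i, m i ≠ 0) (hd : 1 ≤ d)
    (hT : Fintype.card T = Fintype.card ι + d) (hw : 0 < c k ^ 2 * v k) :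
    ENNReal.ofReal (1 / (1 + c k ^ 2 * v k * (Fintype.card T - 1) / sqNorm (m k)) ^ 2)
      ≤ ∫⁻ g, ENNReal.ofReal (‖star (dualVec (gaussCols m c g) k) ⬝ᵥ m k‖ ^ 2) ∂gaussFam T v := by
  have hN := sqNorm_pos (hm0 k)
  have hd0 : (0 : ℝ) < d := by exact_mod_cast hd
  have hT1 : (0 : ℝ) ≤ Fintype.card T - 1 := by
    have : (1 : ℝ) ≤ Fintype.card T := by
      rw [hT]; exact_mod_cast hd.trans (Nat.le_add_left _ _)
    linarith
  set w := c k ^ 2 * (v k : ℝ) with hwdef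
  -- c₀ switches off the Gaussian part of column k: the conditional bound involves the dual vector
  -- with that column at its mean.
  set c₀ : ι → ℝ := Function.update c k 0 with hc₀
  have hck : c₀ k = 0 := by simp [hc₀]
  have hcols (g : ι → T → ℂ) : Function.update (gaussCols m c g) k (m k) = gaussCols m c₀ g := by
    ext j t
    by_cases hj : j = k
    · subst hj; simp [gaussCols, hck]
    · simp [gaussCols, hc₀, hj]
  rw [lintegral_gaussFam_update v k (by
    have := measurable_dualVec (T := T) k
    have h2 : Measurable fun g : ι → T → ℂ => dualVec (gaussCols m c g) k := by fun_prop
    simp only [dotProduct, Pi.star_apply]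
    fun_prop)]
  have hstep : ∫⁻ g, ENNReal.ofReal
        (1 / (1 + d * w * sqNorm (dualVec (gaussCols m c₀ g) k)) ^ 2) ∂gaussFam T v
      ≤ ∫⁻ g, ∫⁻ y, ENNReal.ofReal (‖star (dualVec (gaussCols m c (Function.update g k y)) k)
          ⬝ᵥ m k‖ ^ 2) ∂gaussVec T (v k) ∂gaussFam T v := by
    refine lintegral_mono_ae ?_
    filter_upwards [ae_gramDet_gaussCols_ne_zero hm hm0 hd hT c v,
      ae_gramDet_gaussCols_ne_zero hm hm0 hd hT c₀ v] with g hg hg0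
    simp only [gaussCols_update]
    rw [← hcols] at hg0 ⊢
    exact lintegral_norm_star_dualVec_update_dotProduct_ge hg hd hT (c k) (v k) hw hg0
  refine le_trans ?_ hstep
  have hS := lintegral_sqNorm_dualVec_of_deterministic_le (v := v) hm hm0 hd hT hck
  have hSm : Measurable fun g : ι → T → ℂ => sqNorm (dualVec (gaussCols m c₀ g) k) := by fun_prop
  set z₀ := w * (Fintype.card T - 1) / sqNorm (m k) with hz₀
  have hz0 : 0 ≤ z₀ := by positivity
  have hS0 : (0 : ℝ) ≤ (Fintype.card T - 1) / (sqNorm (m k) * d) := by positivity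
  -- A - B X is the tangent of z ↦ 1/(1+z)² at z₀, where z = d w X and z₀ is the upper bound found
  -- for its mean. The tangent at z₀ has value 1/(1+z₀)², the claimed bound.
  have h := ofReal_le_lintegral_of_affine (ν := gaussFam T v)
    (X := fun g => sqNorm (dualVec (gaussCols m c₀ g) k))
    (Y := fun g => 1 / (1 + d * w * sqNorm (dualVec (gaussCols m c₀ g) k)) ^ 2)
    (A := 1 / (1 + z₀) ^ 2 + 2 * z₀ / (1 + z₀) ^ 3) (B := 2 / (1 + z₀) ^ 3 * (d * w))
    (integrable_of_lintegral_ofReal_le hSm.aestronglyMeasurable (fun g => sqNorm_nonneg _)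
      ENNReal.ofReal_ne_top hS)
    (Measurable.aestronglyMeasurable (by fun_prop)) (fun g => by positivity) (by positivity)
    (integral_le_of_lintegral_ofReal_le hSm.aestronglyMeasurable (fun g => sqNorm_nonneg _)
      hS0 hS)
    (ae_of_all _ fun g => by
      have hs := sqNorm_nonneg (dualVec (gaussCols m c₀ g) k)
      have hz : 0 ≤ d * w * sqNorm (dualVec (gaussCols m c₀ g) k) := by positivity
      rw [mul_assoc (2 / (1 + z₀) ^ 3)]
      generalize d * w * sqNorm (dualVec (gaussCols m c₀ g) k) = z at hz
      have hid : 1 / (1 + z) ^ 2 - (1 / (1 + z₀) ^ 2 + 2 * z₀ / (1 + z₀) ^ 3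
          - 2 / (1 + z₀) ^ 3 * z)
          = (z - z₀) ^ 2 * (3 + z₀ + 2 * z) / ((1 + z) ^ 2 * (1 + z₀) ^ 3) := by
        field_simp
        ring
      have hnn : 0 ≤ (z - z₀) ^ 2 * (3 + z₀ + 2 * z) / ((1 + z) ^ 2 * (1 + z₀) ^ 3) := by
        positivity
      linarith)
  refine le_trans (ENNReal.ofReal_le_ofReal (le_of_eq ?_)) h
  have hz' : d * w * ((Fintype.card T - 1) / (sqNorm (m k) * d)) = z₀ := by
    rw [hz₀]; field_simp
  rw [mul_assoc (2 / (1 + z₀) ^ 3), hz']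
  field_simp
  ring

end DeterministicColumn

/-! ### Columns made of a deterministic and a Gaussian block -/

section Stacked

variable {P D ι : Type*} [Fintype P] [DecidableEq P] [Fintype D] [DecidableEq D] [Fintype ι]
  [DecidableEq ι]

/-- Columns with blocks `p k` and `s k`. -/
def stackCols (p : ι → P → ℂ) (s : ι → D → ℂ) : ι → P ⊕ D → ℂ := fun k => Sum.elim (p k) (s k)

lemma star_sumElim_dotProduct (a c : P → ℂ) (b d : D → ℂ) :
    star (Sum.elim a b) ⬝ᵥ Sum.elim c d = star a ⬝ᵥ c + star b ⬝ᵥ d := by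
  simp [dotProduct]

lemma star_sumElim_dotProduct' (a : P → ℂ) (b : D → ℂ) (u : P ⊕ D → ℂ) :
    star (Sum.elim a b) ⬝ᵥ u = star a ⬝ᵥ (u ∘ Sum.inl) + star b ⬝ᵥ (u ∘ Sum.inr) := by
  simp [dotProduct]

lemma sqNorm_sumElim (a : P → ℂ) (b : D → ℂ) :
    sqNorm (Sum.elim a b) = sqNorm a + sqNorm b := by
  simp [sqNorm]

variable {p : ι → P → ℂ}

/-- The pilot blocks alone are independent, so with regular pilots the columns are independent
surely, whatever the data blocks. -/
lemma gramDet_stackCols_ne_zero (hp : ∀ i j, i ≠ j → star (p i) ⬝ᵥ p j = 0) (hp0 : ∀ i, p i ≠ 0)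
    (s : ι → D → ℂ) : gramDet (stackCols p s) ≠ 0 := by
  rw [gramDet_ne_zero_iff]
  refine LinearIndependent.of_comp (LinearMap.funLeft ℂ ℂ (Sum.inl : P → P ⊕ D)) ?_
  have : LinearMap.funLeft ℂ ℂ (Sum.inl : P → P ⊕ D) ∘ stackCols p s = p := by
    ext k j
    simp [stackCols, LinearMap.funLeft_apply]
  rw [this]
  exact linearIndependent_of_orthogonal hp hp0

/-- By pilot orthogonality the normalised padded pilot satisfies the duality relations, though it
need not lie in the span; the dual vector is its projection. -/
lemma star_stackCols_dotProduct_pilot (hp : ∀ i j, i ≠ j → star (p i) ⬝ᵥ p j = 0)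
    (hp0 : ∀ i, p i ≠ 0) (s : ι → D → ℂ) (j k : ι) :
    star (stackCols p s j) ⬝ᵥ Sum.elim ((sqNorm (p k) : ℂ)⁻¹ • p k) 0 = if j = k then 1 else 0 := by
  rw [stackCols, star_sumElim_dotProduct, dotProduct_zero, add_zero, dotProduct_smul, smul_eq_mul]
  split_ifs with h
  · rw [h, star_dotProduct_self, inv_mul_cancel₀]
    exact_mod_cast (sqNorm_pos (hp0 k)).ne'
  · rw [hp j k h, mul_zero]

/-- Minimality of the dual vector against the padded pilot. The bound is deterministic, so square
integrability is immediate. -/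
lemma sqNorm_dualVec_stackCols_le (hp : ∀ i j, i ≠ j → star (p i) ⬝ᵥ p j = 0)
    (hp0 : ∀ i, p i ≠ 0) (s : ι → D → ℂ) (k : ι) :
    sqNorm (dualVec (stackCols p s) k) ≤ 1 / sqNorm (p k) := by
  have hN := sqNorm_pos (hp0 k)
  refine (sqNorm_dualVec_le_of_dual (gramDet_stackCols_ne_zero hp hp0 s)
    fun j => star_stackCols_dotProduct_pilot hp hp0 s j k).trans (le_of_eq ?_)
  rw [sqNorm_sumElim, sqNorm_smul, norm_inv, Complex.norm_real, Real.norm_eq_abs, inv_pow, sq_abs]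
  have : sqNorm (0 : D → ℂ) = 0 := sqNorm_eq_zero.mpr rfl
  rw [this]
  field_simp
  ring

lemma star_dualVec_stackCols_dotProduct_pilot (hp : ∀ i j, i ≠ j → star (p i) ⬝ᵥ p j = 0)
    (hp0 : ∀ i, p i ≠ 0) (s : ι → D → ℂ) (k : ι) :
    star (dualVec (stackCols p s) k) ⬝ᵥ Sum.elim (p k) 0
      = (sqNorm (p k) : ℂ) * (sqNorm (dualVec (stackCols p s) k) : ℂ) := by
  have hN : (sqNorm (p k) : ℂ) ≠ 0 := by exact_mod_cast (sqNorm_pos (hp0 k)).ne'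
  have h := star_dualVec_dotProduct_eq_of_dual (gramDet_stackCols_ne_zero hp hp0 s)
    fun j => star_stackCols_dotProduct_pilot hp hp0 s j k
  have h2 : (Sum.elim (p k) 0 : P ⊕ D → ℂ)
      = (sqNorm (p k) : ℂ) • Sum.elim ((sqNorm (p k) : ℂ)⁻¹ • p k) 0 := by
    ext (j | j)
    · simp [mul_inv_cancel_left₀ hN]
    · simp
  rw [h2, dotProduct_smul, h, smul_eq_mul]

/-- A vector dual to the lower block of column `k` bounds the energy of the lower block of the dual
vector from below. -/
lemma one_le_sqNorm_inr_mul (hp : ∀ i j, i ≠ j → star (p i) ⬝ᵥ p j = 0) (hp0 : ∀ i, p i ≠ 0)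
    (s : ι → D → ℂ) {k : ι} {t : D → ℂ}
    (ht : ∀ j, star t ⬝ᵥ s j = if j = k then 1 else 0) :
    1 ≤ sqNorm (dualVec (stackCols p s) k ∘ Sum.inr)
      * (sqNorm (p k) ^ 2 * sqNorm t + 2 * sqNorm (p k) + sqNorm (s k)) := by
  have hdet := gramDet_stackCols_ne_zero hp hp0 s
  set u := dualVec (stackCols p s) k with hu
  set N := sqNorm (p k) with hN
  -- The lower block of u combines the s j with the k-th column of the inverse Gram matrix; t
  -- extracts its diagonal entry, which is ‖u‖².
  have h1 : star t ⬝ᵥ (u ∘ Sum.inr) = (sqNorm u : ℂ) := by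
    have h : u ∘ Sum.inr = ∑ j, (((colMatrix (stackCols p s))ᴴ * colMatrix (stackCols p s))⁻¹) j k
        • s j := by
      ext a
      rw [hu, dualVec_eq_sum]
      simp [Finset.sum_apply, stackCols]
    rw [h, dotProduct_sum, ← gram_inv_apply_self hdet]
    simp [dotProduct_smul, ht]
  have h2 : star (p k) ⬝ᵥ (u ∘ Sum.inl) = (N : ℂ) * (sqNorm u : ℂ) := by
    have h := star_dualVec_stackCols_dotProduct_pilot hp hp0 s k
    rw [star_dotProduct_comm, star_sumElim_dotProduct'] at h
    have h' := congrArg star h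
    simpa [← hu, ← hN] using h'
  have h3 : star (s k) ⬝ᵥ (u ∘ Sum.inr) = 1 - (N : ℂ) * (sqNorm u : ℂ) := by
    have h := star_dotProduct_dualVec hdet k k
    rw [if_pos rfl, ← hu] at h
    have h' := (star_sumElim_dotProduct' (p k) (s k) u).symm.trans h
    rw [h2] at h'
    rw [← h']; ring
  -- The unknown N‖u‖² cancels in the combination N t + s k, so Cauchy-Schwarz involves only known
  -- vectors.
  have h4 : star ((N : ℂ) • t + s k) ⬝ᵥ (u ∘ Sum.inr) = 1 := by
    rw [star_add, star_smul, add_dotProduct, smul_dotProduct, h1, h3]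
    simp
  have h5 := norm_star_dotProduct_sq_le ((N : ℂ) • t + s k) (u ∘ Sum.inr)
  rw [h4, sqNorm_add, sqNorm_smul, star_smul, smul_dotProduct, ht k, if_pos rfl] at h5
  simp only [norm_one, one_pow, Complex.norm_real, Real.norm_eq_abs, sq_abs, RCLike.star_def,
    Complex.conj_ofReal, smul_eq_mul, mul_one, Complex.ofReal_re] at h5
  rwa [mul_comm] at h5

/-- Here t is the projection of s k onto the span of e divided by its squared norm S, so ‖t‖² = 1/S.
The e need not fill the complement of the other data blocks. -/
lemma one_le_sqNorm_inr_mul_of_orthonormal (hp : ∀ i j, i ≠ j → star (p i) ⬝ᵥ p j = 0)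
    (hp0 : ∀ i, p i ≠ 0) (s : ι → D → ℂ) {k : ι} {κ : Type*} [Fintype κ] [DecidableEq κ]
    {e : κ → D → ℂ} (he : ∀ a b, star (e a) ⬝ᵥ e b = if a = b then 1 else 0)
    (hes : ∀ a j, j ≠ k → star (e a) ⬝ᵥ s j = 0) (hS : ∑ a, ‖star (e a) ⬝ᵥ s k‖ ^ 2 ≠ 0) :
    1 ≤ sqNorm (dualVec (stackCols p s) k ∘ Sum.inr)
      * (sqNorm (p k) ^ 2 * (∑ a, ‖star (e a) ⬝ᵥ s k‖ ^ 2)⁻¹ + 2 * sqNorm (p k)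
        + sqNorm (s k)) := by
  set S := ∑ a, ‖star (e a) ⬝ᵥ s k‖ ^ 2 with hSdef
  have hSC : (S : ℂ) ≠ 0 := by exact_mod_cast hS
  set y : D → ℂ := ∑ a, (star (e a) ⬝ᵥ s k) • e a with hy
  have hyz (z : D → ℂ) : star y ⬝ᵥ z = ∑ a, star (star (e a) ⬝ᵥ s k) * (star (e a) ⬝ᵥ z) := by
    simp only [hy, star_sum, star_smul, sum_dotProduct, smul_dotProduct, smul_eq_mul]
  have hys : star y ⬝ᵥ s k = S := by
    rw [hyz, hSdef]
    push_cast
    refine Finset.sum_congr rfl fun a _ => ?_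
    rw [mul_comm]
    exact Complex.mul_conj' _
  have hyy : sqNorm y = S := by
    have h : (sqNorm y : ℂ) = S := by
      rw [← star_dotProduct_self, hyz, ← hys, hyz]
      refine Finset.sum_congr rfl fun a _ => ?_
      rw [hy, dotProduct_sum]
      simp [dotProduct_smul, he]
    exact_mod_cast h
  have hstar : star ((S : ℂ)⁻¹) = (S : ℂ)⁻¹ := by
    rw [star_inv₀, RCLike.star_def, Complex.conj_ofReal]
  have h := one_le_sqNorm_inr_mul hp hp0 s (k := k) (t := (S : ℂ)⁻¹ • y) fun j => by
    rw [star_smul, smul_dotProduct, hstar]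
    split_ifs with hj
    · rw [hj, hys, smul_eq_mul, inv_mul_cancel₀ hSC]
    · rw [hyz, Finset.sum_eq_zero fun a _ => by rw [hes a j hj, mul_zero], smul_zero]
  rw [sqNorm_smul, hyy, norm_inv, Complex.norm_real, Real.norm_eq_abs, inv_pow, sq_abs] at h
  have h' : (S ^ 2)⁻¹ * S = S⁻¹ := by field_simp
  rwa [h'] at h

/-! ### Expectations for stacked columns -/

lemma lintegral_sqNorm_gaussVec (v : ℝ≥0) :
    ∫⁻ g, ENNReal.ofReal (sqNorm g) ∂gaussVec D v = ENNReal.ofReal (v * Fintype.card D) := by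
  simp only [sqNorm]
  simp_rw [ENNReal.ofReal_sum_of_nonneg fun (i : D) _ => sq_nonneg _]
  rw [lintegral_finsetSum _ fun i _ => by fun_prop]
  simp only [lintegral_norm_sq_apply_gaussVec, Finset.sum_const, Finset.card_univ, nsmul_eq_mul]
  rw [mul_comm, ENNReal.ofReal_mul (NNReal.coe_nonneg v)]
  simp

lemma lintegral_gaussFam_apply (v : ι → ℝ≥0) (k : ι) {F : (D → ℂ) → ENNReal} (hF : Measurable F) :
    ∫⁻ g, F (g k) ∂gaussFam D v = ∫⁻ y, F y ∂gaussVec D (v k) :=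
  (measurePreserving_eval (fun k => gaussVec D (v k)) k).lintegral_comp hF

variable {c : ι → ℝ} {v : ι → ℝ≥0} {k : ι} {d : ℕ}

/-- Columns with deterministic blocks `p k` and Gaussian blocks `c k • g k`. -/
def stackGaussCols (p : ι → P → ℂ) (c : ι → ℝ) (g : ι → D → ℂ) : ι → P ⊕ D → ℂ :=
  stackCols p fun k => (c k : ℂ) • g k

@[fun_prop]
lemma measurable_stackGaussCols :
    Measurable (stackGaussCols p c : (ι → D → ℂ) → ι → P ⊕ D → ℂ) := by
  refine measurable_pi_lambda _ fun j => measurable_pi_lambda _ fun t => ?_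
  rcases t with t | t
  · simp only [stackGaussCols, stackCols, Sum.elim_inl]; fun_prop
  · simp only [stackGaussCols, stackCols, Sum.elim_inr]; fun_prop

lemma sqNorm_stackGaussCols (g : ι → D → ℂ) :
    sqNorm (stackGaussCols p c g k) = sqNorm (p k) + c k ^ 2 * sqNorm (g k) := by
  rw [stackGaussCols, stackCols, sqNorm_sumElim, sqNorm_smul, Complex.norm_real,
    Real.norm_eq_abs, sq_abs]

lemma lintegral_sqNorm_dualVec_stack_ge (hp : ∀ i j, i ≠ j → star (p i) ⬝ᵥ p j = 0)
    (hp0 : ∀ i, p i ≠ 0) :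
    ENNReal.ofReal (1 / (sqNorm (p k) + c k ^ 2 * v k * Fintype.card D))
      ≤ ∫⁻ g, ENNReal.ofReal (sqNorm (dualVec (stackGaussCols p c g) k)) ∂gaussFam D v := by
  have hN := sqNorm_pos (hp0 k)
  refine ofReal_inv_le_lintegral
    (X := fun g : ι → D → ℂ => sqNorm (p k) + c k ^ 2 * sqNorm (g k))
    (Measurable.aestronglyMeasurable (by fun_prop))
    (fun g => by have := sqNorm_nonneg (g k); positivity)
    (Measurable.aestronglyMeasurable (by fun_prop))
    (fun g => sqNorm_nonneg _) (by positivity) (le_of_eq ?_) (ae_of_all _ fun g => ?_)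
  · have h (g : ι → D → ℂ) : ENNReal.ofReal (sqNorm (p k) + c k ^ 2 * sqNorm (g k))
        = ENNReal.ofReal (sqNorm (p k))
          + ENNReal.ofReal (c k ^ 2) * ENNReal.ofReal (sqNorm (g k)) := by
      rw [ENNReal.ofReal_add hN.le (by have := sqNorm_nonneg (g k); positivity),
        ENNReal.ofReal_mul (by positivity)]
    simp only [h]
    rw [lintegral_add_left measurable_const, lintegral_const_mul' _ _ ENNReal.ofReal_ne_top,
      lintegral_gaussFam_apply v k (F := fun y => ENNReal.ofReal (sqNorm y)) (by fun_prop),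
      lintegral_sqNorm_gaussVec, ← ENNReal.ofReal_mul (by positivity), lintegral_const,
      measure_univ, mul_one, ← ENNReal.ofReal_add hN.le (by positivity), mul_assoc]
  · rw [← sqNorm_stackGaussCols]
    exact one_le_sqNorm_dualVec_mul (gramDet_stackCols_ne_zero hp hp0 _) k

lemma integrable_sqNorm_dualVec_stack (hp : ∀ i j, i ≠ j → star (p i) ⬝ᵥ p j = 0)
    (hp0 : ∀ i, p i ≠ 0) :
    Integrable (fun g => sqNorm (dualVec (stackGaussCols p c g) k)) (gaussFam D v) :=
  (integrable_const (1 / sqNorm (p k))).mono' (Measurable.aestronglyMeasurable (by fun_prop))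
    (ae_of_all _ fun g => by
      rw [Real.norm_eq_abs, abs_of_nonneg (sqNorm_nonneg _)]
      exact sqNorm_dualVec_stackCols_le hp hp0 _ k)

/-- The correlation with the padded pilot is ‖p_k‖²‖u‖², so Jensen for the square reduces it to the
bound on E‖u‖². -/
lemma lintegral_norm_star_dualVec_stack_dotProduct_ge
    (hp : ∀ i j, i ≠ j → star (p i) ⬝ᵥ p j = 0) (hp0 : ∀ i, p i ≠ 0) :
    ENNReal.ofReal ((sqNorm (p k) / (sqNorm (p k) + c k ^ 2 * v k * Fintype.card D)) ^ 2)
      ≤ ∫⁻ g, ENNReal.ofReal (‖star (dualVec (stackGaussCols p c g) k) ⬝ᵥ Sum.elim (p k) 0‖ ^ 2)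
        ∂gaussFam D v := by
  have hN := sqNorm_pos (hp0 k)
  have h := ofReal_sq_le_lintegral_sq (ν := gaussFam D v)
    (Y := fun g => sqNorm (dualVec (stackGaussCols p c g) k))
    (Measurable.aestronglyMeasurable (by fun_prop)) (by positivity)
    (integrable_sqNorm_dualVec_stack hp hp0) (fun g => sqNorm_nonneg _)
    (lintegral_sqNorm_dualVec_stack_ge (c := c) (v := v) hp hp0)
  have h1 (g : ι → D → ℂ) :
      ENNReal.ofReal (‖star (dualVec (stackGaussCols p c g) k) ⬝ᵥ Sum.elim (p k) 0‖ ^ 2)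
        = ENNReal.ofReal (sqNorm (p k) ^ 2)
          * ENNReal.ofReal (sqNorm (dualVec (stackGaussCols p c g) k) ^ 2) := by
    rw [stackGaussCols, star_dualVec_stackCols_dotProduct_pilot hp hp0, norm_mul,
      Complex.norm_real, Complex.norm_real, Real.norm_eq_abs, Real.norm_eq_abs, mul_pow, sq_abs,
      sq_abs, ENNReal.ofReal_mul (by positivity)]
  simp only [h1]
  rw [lintegral_const_mul' _ _ ENNReal.ofReal_ne_top]
  calc _ = ENNReal.ofReal (sqNorm (p k) ^ 2)
        * ENNReal.ofReal ((1 / (sqNorm (p k) + c k ^ 2 * v k * Fintype.card D)) ^ 2) := by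
        rw [← ENNReal.ofReal_mul (by positivity)]
        congr 1
        ring
    _ ≤ _ := by gcongr

/-- Given the other data blocks, 1/S has mean at most 1/(w d) and the data part of column k has mean
energy w card D, where w = c²v. Together with 2‖p_k‖² they form the denominator, to which Jensen for
1/x applies. -/
lemma lintegral_sqNorm_inr_dualVec_stack_ge
    (hp : ∀ i j, i ≠ j → star (p i) ⬝ᵥ p j = 0) (hp0 : ∀ i, p i ≠ 0) (hd : 1 ≤ d)
    (hD : Fintype.card D = Fintype.card ι + d) (hw : 0 < c k ^ 2 * v k) :
    ENNReal.ofReal (1 / (sqNorm (p k) ^ 2 / (c k ^ 2 * v k * d) + 2 * sqNorm (p k)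
        + c k ^ 2 * v k * Fintype.card D))
      ≤ ∫⁻ g, ENNReal.ofReal (sqNorm (dualVec (stackGaussCols p c g) k ∘ Sum.inr))
        ∂gaussFam D v := by
  have hN := sqNorm_pos (hp0 k)
  have hd0 : (0 : ℝ) < d := by exact_mod_cast hd
  have hmeas : Measurable fun g : ι → D → ℂ =>
      sqNorm (dualVec (stackGaussCols p c g) k ∘ Sum.inr) := by
    have h : Measurable fun g : ι → D → ℂ => dualVec (stackGaussCols p c g) k := by fun_prop
    simp only [sqNorm, Function.comp_apply]
    fun_prop
  rw [lintegral_gaussFam_update v k (by fun_prop)]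
  refine le_trans (le_of_eq (by simp)) (lintegral_mono
    (f := fun _ => ENNReal.ofReal (1 / (sqNorm (p k) ^ 2 / (c k ^ 2 * v k * d) + 2 * sqNorm (p k)
        + c k ^ 2 * v k * Fintype.card D))) fun g => ?_)
  obtain ⟨e, he, hes⟩ := exists_orthonormal_complement (fun j => (c j : ℂ) • g j) k hD
  set S : (D → ℂ) → ℝ := fun y => ∑ a, ‖star (e a) ⬝ᵥ (c k : ℂ) • y‖ ^ 2 with hSdef
  have hS0 (y : D → ℂ) : 0 ≤ S y := Finset.sum_nonneg fun _ _ => by positivity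
  have hSm : Measurable S := by simp only [hSdef, dotProduct]; fun_prop
  have hSint := lintegral_inv_orthonormal_energy_le hd e he 0 (c k) (v k) hw
  have hSne := ae_orthonormal_energy_ne_zero hd e he 0 (c k) (v k) hw
  simp only [zero_add] at hSint hSne
  refine ofReal_inv_le_lintegral
    (X := fun y : D → ℂ => sqNorm (p k) ^ 2 * (S y)⁻¹ + 2 * sqNorm (p k) + c k ^ 2 * sqNorm y)
    (Measurable.aestronglyMeasurable (by fun_prop))
    (fun y => by have := sqNorm_nonneg y; have := hS0 y; positivity)
    (Measurable.aestronglyMeasurable (hmeas.comp (by fun_prop)))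
    (fun g => sqNorm_nonneg _) (by positivity) ?_ ?_
  · calc _ ≤ ∫⁻ y, (ENNReal.ofReal (sqNorm (p k) ^ 2) * (ENNReal.ofReal (S y))⁻¹
          + (ENNReal.ofReal (2 * sqNorm (p k))
            + ENNReal.ofReal (c k ^ 2) * ENNReal.ofReal (sqNorm y))) ∂gaussVec D (v k) := by
          refine lintegral_mono_ae ?_
          filter_upwards [hSne] with y hy
          have hSp : 0 < S y := lt_of_le_of_ne (hS0 y) (Ne.symm hy)
          have := sqNorm_nonneg y
          rw [← ENNReal.ofReal_inv_of_pos hSp, ← ENNReal.ofReal_mul (by positivity),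
            ← ENNReal.ofReal_mul (by positivity), ← ENNReal.ofReal_add (by positivity)
            (by positivity), ← ENNReal.ofReal_add (by positivity) (by positivity), add_assoc]
      _ ≤ ENNReal.ofReal (sqNorm (p k) ^ 2) * ENNReal.ofReal (1 / (c k ^ 2 * v k * d))
          + (ENNReal.ofReal (2 * sqNorm (p k))
            + ENNReal.ofReal (c k ^ 2) * ENNReal.ofReal (v k * Fintype.card D)) := by
          rw [lintegral_add_right _ (by fun_prop), lintegral_const_mul' _ _ ENNReal.ofReal_ne_top,
            lintegral_add_left measurable_const, lintegral_const_mul' _ _ ENNReal.ofReal_ne_top,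
            lintegral_sqNorm_gaussVec, lintegral_const, measure_univ, mul_one]
          gcongr
      _ = _ := by
          rw [← ENNReal.ofReal_mul (by positivity), ← ENNReal.ofReal_mul (by positivity),
            ← ENNReal.ofReal_add (by positivity) (by positivity),
            ← ENNReal.ofReal_add (by positivity) (by positivity)]
          congr 1
          ring
  · filter_upwards [hSne] with y hy
    have h := one_le_sqNorm_inr_mul_of_orthonormal hp hp0
      (fun j => (c j : ℂ) • Function.update g k y j) he
      (fun a j hj => by rw [Function.update_of_ne hj]; exact hes a j hj)
      (by simpa only [Function.update_self] using hy)
    simp only [Function.update_self] at h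
    rw [sqNorm_smul, Complex.norm_real, Real.norm_eq_abs, sq_abs] at h
    exact h

end Stacked

/-! ### Bounds for superimposed deterministic and Gaussian columns -/

section Superimposed

variable {T ι : Type*} [Fintype T] [DecidableEq T] [Fintype ι] [DecidableEq ι]

lemma ae_smul_gaussVec_eq_zero {c : ℝ} {v : ℝ≥0} (hw : ¬0 < c ^ 2 * (v : ℝ)) :
    ∀ᵐ g ∂gaussVec T v, (c : ℂ) • g = 0 := by
  by_cases hc : c = 0
  · exact ae_of_all _ fun y => by simp [hc]
  · have hv : v = 0 := by
      by_contra hv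
      exact hw (by positivity)
    filter_upwards [ae_gaussVec_eq_zero hv] with y hy
    simp [hy]

lemma lintegral_norm_sq_affine_complexGaussian (b : ℂ) {c : ℝ} {v : ℝ≥0}
    (hw : 0 < c ^ 2 * (v : ℝ)) :
    ∫⁻ z, ENNReal.ofReal (‖b + c * z‖ ^ 2) ∂complexGaussian v
      = ENNReal.ofReal (c ^ 2 * v + ‖b‖ ^ 2) := by
  simpa using lintegral_norm_sq_mul_exp_neg_norm_sq_complexGaussian b c v le_rfl hw

lemma lintegral_sqNorm_affine_gaussVec (m : T → ℂ) (c : ℝ) (v : ℝ≥0) :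
    ∫⁻ g, ENNReal.ofReal (sqNorm (m + (c : ℂ) • g)) ∂gaussVec T v
      = ENNReal.ofReal (sqNorm m + c ^ 2 * v * Fintype.card T) := by
  by_cases hw : 0 < c ^ 2 * (v : ℝ)
  · simp only [sqNorm]
    simp_rw [ENNReal.ofReal_sum_of_nonneg fun (i : T) _ => sq_nonneg _]
    rw [lintegral_finsetSum _ fun i _ => by fun_prop]
    have h (t : T) : ∫⁻ g, ENNReal.ofReal (‖(m + (c : ℂ) • g) t‖ ^ 2) ∂gaussVec T v
        = ENNReal.ofReal (c ^ 2 * v + ‖m t‖ ^ 2) := by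
      rw [← lintegral_norm_sq_affine_complexGaussian (m t) hw]
      exact (measurePreserving_eval (fun _ : T => complexGaussian v) t).lintegral_comp
        (f := fun z : ℂ => ENNReal.ofReal (‖m t + c * z‖ ^ 2)) (by fun_prop)
    simp only [h]
    rw [← ENNReal.ofReal_sum_of_nonneg fun i _ => by positivity, Finset.sum_add_distrib]
    congr 1
    simp only [Finset.sum_const, Finset.card_univ, nsmul_eq_mul]
    ring
  · have hw0 : c ^ 2 * (v : ℝ) = 0 := le_antisymm (not_lt.mp hw) (by positivity)
    rw [lintegral_congr_ae (g := fun _ => ENNReal.ofReal (sqNorm m)), hw0]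
    · simp
    · filter_upwards [ae_smul_gaussVec_eq_zero hw] with g hg
      rw [hg, add_zero]

variable {m : ι → T → ℂ} {c : ι → ℝ} {v : ι → ℝ≥0} {d : ℕ} {k : ι}

/-- Covers zero data energy or zero estimate variance: the column is then almost surely its mean. -/
lemma ae_gaussCols_eq_update (hw : ¬0 < c k ^ 2 * (v k : ℝ)) :
    ∀ᵐ g ∂gaussFam T v, gaussCols m c g = gaussCols m (Function.update c k 0) g := by
  have h := (measurePreserving_eval (fun k => gaussVec T (v k)) k).quasiMeasurePreserving.ae
    (ae_smul_gaussVec_eq_zero hw)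
  filter_upwards [h] with g hg
  ext j t
  by_cases hj : j = k
  · subst hj
    have := congrFun hg t
    simp only [Function.eval, Pi.smul_apply, Pi.zero_apply, smul_eq_mul] at this
    simp [gaussCols, this]
  · simp [gaussCols, hj]

lemma integrable_sqNorm_dualVec_gaussCols (hm : ∀ i j, i ≠ j → star (m i) ⬝ᵥ m j = 0)
    (hm0 : ∀ i, m i ≠ 0) (hd : 1 ≤ d) (hT : Fintype.card T = Fintype.card ι + d) :
    Integrable (fun g => sqNorm (dualVec (gaussCols m c g) k)) (gaussFam T v) := by
  by_cases hw : 0 < c k ^ 2 * (v k : ℝ)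
  · exact integrable_of_lintegral_ofReal_le (Measurable.aestronglyMeasurable (by fun_prop))
      (fun g => sqNorm_nonneg _) ENNReal.ofReal_ne_top
      (lintegral_sqNorm_dualVec_gaussCols_le hm hm0 hd hT hw)
  · refine (integrable_of_lintegral_ofReal_le (Measurable.aestronglyMeasurable (by fun_prop))
      (fun g => sqNorm_nonneg _) ENNReal.ofReal_ne_top
      (lintegral_sqNorm_dualVec_of_deterministic_le (c := Function.update c k 0) (k := k) hm hm0 hd
        hT (by simp))).congr ?_
    filter_upwards [ae_gaussCols_eq_update (m := m) hw] with g hg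
    rw [hg]

lemma lintegral_sqNorm_dualVec_gaussCols_ge (hm : ∀ i j, i ≠ j → star (m i) ⬝ᵥ m j = 0)
    (hm0 : ∀ i, m i ≠ 0) (hd : 1 ≤ d) (hT : Fintype.card T = Fintype.card ι + d) :
    ENNReal.ofReal (1 / (sqNorm (m k) + c k ^ 2 * v k * Fintype.card T))
      ≤ ∫⁻ g, ENNReal.ofReal (sqNorm (dualVec (gaussCols m c g) k)) ∂gaussFam T v := by
  have hN := sqNorm_pos (hm0 k)
  refine ofReal_inv_le_lintegral
    (X := fun g : ι → T → ℂ => sqNorm (m k + (c k : ℂ) • g k))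
    (Measurable.aestronglyMeasurable (by fun_prop)) (fun g => sqNorm_nonneg _)
    (Measurable.aestronglyMeasurable (by fun_prop)) (fun g => sqNorm_nonneg _) (by positivity)
    (le_of_eq ?_) ?_
  · rw [lintegral_gaussFam_apply v k (F := fun y => ENNReal.ofReal (sqNorm (m k + (c k : ℂ) • y)))
      (by fun_prop), lintegral_sqNorm_affine_gaussVec]
  · filter_upwards [ae_gramDet_gaussCols_ne_zero hm hm0 hd hT c v] with g hg
    exact one_le_sqNorm_dualVec_mul hg k

lemma lintegral_norm_star_dualVec_gaussCols_dotProduct_ge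
    (hm : ∀ i j, i ≠ j → star (m i) ⬝ᵥ m j = 0) (hm0 : ∀ i, m i ≠ 0) (hd : 1 ≤ d)
    (hT : Fintype.card T = Fintype.card ι + d) :
    ENNReal.ofReal (1 / (1 + c k ^ 2 * v k * (Fintype.card T - 1) / sqNorm (m k)) ^ 2)
      ≤ ∫⁻ g, ENNReal.ofReal (‖star (dualVec (gaussCols m c g) k) ⬝ᵥ m k‖ ^ 2) ∂gaussFam T v := by
  by_cases hw : 0 < c k ^ 2 * (v k : ℝ)
  · exact lintegral_norm_star_dualVec_dotProduct_ge hm hm0 hd hT hw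
  · have hw0 : c k ^ 2 * (v k : ℝ) = 0 := le_antisymm (not_lt.mp hw) (by positivity)
    -- In the degenerate case column k is almost surely m k, and uᴴ m_k = 1 by duality.
    rw [lintegral_congr_ae (g := fun _ => 1), hw0]
    · simp
    · filter_upwards [ae_gaussCols_eq_update (m := m) hw,
        ae_gramDet_gaussCols_ne_zero hm hm0 hd hT c v] with g hg hg'
      have h : gaussCols m c g k = m k := by rw [hg]; simp [gaussCols]
      have h2 := star_dualVec_dotProduct hg' k k
      rw [h, if_pos rfl] at h2
      rw [h2]
      simp

end Superimposed

/-! ### Second moments -/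

section Moments

variable {Ω : Type*} [MeasurableSpace Ω] {μ : Measure Ω} [IsProbabilityMeasure μ]

lemma memLp_mul_star {X Y : Ω → ℂ} (hX : MemLp X 2 μ) (hY : MemLp Y 2 μ) :
    Integrable (fun ω => X ω * star (Y ω)) μ :=
  hX.integrable_mul hY.star

lemma integral_mul_star_self (X : Ω → ℂ) :
    ∫ ω, X ω * star (X ω) ∂μ = ((∫ ω, ‖X ω‖ ^ 2 ∂μ : ℝ) : ℂ) := by
  rw [← integral_complex_ofReal]
  congr 1
  ext ω
  push_cast
  exact Complex.mul_conj' _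

lemma HasLaw_gaussianReal_memLp {X : Ω → ℝ} {v : ℝ≥0} (hX : HasLaw X (gaussianReal 0 v) μ) :
    MemLp X 2 μ := by
  have h := memLp_id_gaussianReal' (μ := 0) (v := v) 2 (by simp)
  rw [← hX.map_eq] at h
  exact h.comp_of_map hX.aemeasurable

lemma HasLaw_gaussianReal_integral {X : Ω → ℝ} {v : ℝ≥0} (hX : HasLaw X (gaussianReal 0 v) μ) :
    ∫ ω, X ω ∂μ = 0 := by
  rw [hX.integral_eq, integral_id_gaussianReal]

lemma HasLaw_gaussianReal_integral_sq {X : Ω → ℝ} {v : ℝ≥0} (hX : HasLaw X (gaussianReal 0 v) μ) :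
    ∫ ω, X ω ^ 2 ∂μ = v := by
  have h := hX.variance_eq
  rw [variance_id_gaussianReal, variance_of_integral_eq_zero hX.aemeasurable
    (HasLaw_gaussianReal_integral hX)] at h
  exact h

/-- Moments of a complex random variable with centered Gaussian real and imaginary parts. -/
lemma moments_of_gaussian_parts {X : Ω → ℂ} {a b : ℝ≥0} (hX : AEMeasurable X μ)
    (hre : HasLaw (fun ω => (X ω).re) (gaussianReal 0 a) μ)
    (him : HasLaw (fun ω => (X ω).im) (gaussianReal 0 b) μ) :
    MemLp X 2 μ ∧ ∫ ω, X ω ∂μ = 0 ∧ ∫ ω, ‖X ω‖ ^ 2 ∂μ = a + b := by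
  have h1 := HasLaw_gaussianReal_memLp hre
  have h2 := HasLaw_gaussianReal_memLp him
  have hn (ω : Ω) : ‖X ω‖ ^ 2 = (X ω).re ^ 2 + (X ω).im ^ 2 := by
    rw [← Complex.normSq_eq_norm_sq, Complex.normSq_apply]; ring
  have hL : MemLp X 2 μ := by
    rw [memLp_two_iff_integrable_sq_norm hX.aestronglyMeasurable]
    simp only [hn]
    exact h1.integrable_sq.add h2.integrable_sq
  refine ⟨hL, ?_, ?_⟩
  · have hi : Integrable X μ := hL.integrable (by norm_num)
    rw [← integral_re_add_im hi]
    have e1 : ∫ ω, RCLike.re (X ω) ∂μ = 0 := HasLaw_gaussianReal_integral hre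
    have e2 : ∫ ω, RCLike.im (X ω) ∂μ = 0 := HasLaw_gaussianReal_integral him
    rw [e1, e2]
    simp
  · simp only [hn]
    rw [integral_add h1.integrable_sq h2.integrable_sq, HasLaw_gaussianReal_integral_sq hre,
      HasLaw_gaussianReal_integral_sq him]

lemma moments_of_hasLaw_complexGaussian {X : Ω → ℂ} {v : ℝ≥0}
    (hX : HasLaw X (complexGaussian v) μ) :
    MemLp X 2 μ ∧ ∫ ω, X ω ∂μ = 0 ∧ ∫ ω, ‖X ω‖ ^ 2 ∂μ = v := by
  have hre : HasLaw Complex.re (gaussianReal 0 (v / 2)) (complexGaussian v) :=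
    ⟨by fun_prop, by
      rw [complexGaussian, Measure.map_map (by fun_prop) (by fun_prop)]
      exact Measure.map_fst_prod.trans (by simp)⟩
  have him : HasLaw Complex.im (gaussianReal 0 (v / 2)) (complexGaussian v) :=
    ⟨by fun_prop, by
      rw [complexGaussian, Measure.map_map (by fun_prop) (by fun_prop)]
      exact Measure.map_snd_prod.trans (by simp)⟩
  obtain ⟨h1, h2, h3⟩ := moments_of_gaussian_parts hX.aemeasurable (hre.comp hX) (him.comp hX)
  refine ⟨h1, h2, h3.trans ?_⟩
  push_cast
  ring

variable {ι : Type*} [Fintype ι]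

namespace IsComplexGaussianVec

variable {X : Ω → ι → ℂ} {R : Matrix ι ι ℂ}

/-- Only real parts have a prescribed law. The imaginary part is the real part belonging to I • t,
which has the same quadratic form. -/
lemma dotProduct_moments (hX : IsComplexGaussianVec μ X R) (t : ι → ℂ) :
    MemLp (fun ω => star t ⬝ᵥ X ω) 2 μ ∧ ∫ ω, star t ⬝ᵥ X ω ∂μ = 0 ∧
      ∫ ω, ‖star t ⬝ᵥ X ω‖ ^ 2 ∂μ = (star t ⬝ᵥ R *ᵥ t).re := by
  have hm : AEMeasurable (fun ω => star t ⬝ᵥ X ω) μ := by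
    have := hX.aemeasurable
    simp only [dotProduct]
    fun_prop
  have hi : (fun ω => (star (Complex.I • t) ⬝ᵥ X ω).re) = fun ω => (star t ⬝ᵥ X ω).im := by
    ext ω
    simp [star_smul, smul_dotProduct]
  have hq : star (Complex.I • t) ⬝ᵥ R *ᵥ (Complex.I • t) = star t ⬝ᵥ R *ᵥ t := by
    rw [mulVec_smul, star_smul, smul_dotProduct, dotProduct_smul, smul_smul]
    simp
  have him := hX.law (Complex.I • t)
  rw [hi, hq] at him
  obtain ⟨h1, h2, h3⟩ := moments_of_gaussian_parts hm (hX.law t) him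
  refine ⟨h1, h2, h3.trans ?_⟩
  have h0 : 0 ≤ (star t ⬝ᵥ R *ᵥ t).re :=
    (Complex.nonneg_iff.mp (hX.posSemidef.dotProduct_mulVec_nonneg t)).1
  rw [Real.coe_toNNReal _ (by positivity)]
  ring

lemma memLp (hX : IsComplexGaussianVec μ X R) (a : ι) : MemLp (fun ω => X ω a) 2 μ := by
  classical
  have h := (hX.dotProduct_moments (Pi.single a 1)).1
  simpa [← Pi.single_star] using h

lemma integral_eq_zero (hX : IsComplexGaussianVec μ X R) (a : ι) : ∫ ω, X ω a ∂μ = 0 := by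
  classical
  have h := (hX.dotProduct_moments (Pi.single a 1)).2.1
  simpa [← Pi.single_star] using h

/-- The second-moment matrix and R have the same quadratic form. Polarisation with weights (1, 1)
and (1, I) on two basis vectors identifies the entries. -/
lemma integral_mul_star (hX : IsComplexGaussianVec μ X R) (a b : ι) :
    ∫ ω, X ω a * star (X ω b) ∂μ = R a b := by
  classical
  set C : Matrix ι ι ℂ := Matrix.of fun a b => ∫ ω, X ω a * star (X ω b) ∂μ with hC
  have hint (a b : ι) : Integrable (fun ω => X ω a * star (X ω b)) μ :=
    memLp_mul_star (hX.memLp a) (hX.memLp b)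
  have hquad (t : ι → ℂ) : star t ⬝ᵥ C *ᵥ t = star t ⬝ᵥ R *ᵥ t := by
    have h1 := (hX.dotProduct_moments t).2.2
    have h2 : ((star t ⬝ᵥ R *ᵥ t).re : ℂ) = star t ⬝ᵥ R *ᵥ t :=
      Complex.ext (by simp)
        (by simpa using (Complex.nonneg_iff.mp (hX.posSemidef.dotProduct_mulVec_nonneg t)).2)
    rw [← h2, ← h1, ← integral_mul_star_self]
    have h3 (ω : Ω) : (star t ⬝ᵥ X ω) * star (star t ⬝ᵥ X ω)
        = ∑ a, ∑ b, (star (t a) * t b) * (X ω a * star (X ω b)) := by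
      simp only [dotProduct, star_sum, Finset.sum_mul_sum, star_mul', Pi.star_apply, star_star]
      refine Finset.sum_congr rfl fun a _ => Finset.sum_congr rfl fun b _ => by ring
    simp only [h3]
    rw [integral_finsetSum _ fun a _ => integrable_finsetSum _ fun b _ =>
      (hint a b).const_mul _]
    simp only [dotProduct, mulVec, Pi.star_apply, Finset.mul_sum]
    refine Finset.sum_congr rfl fun a _ => ?_
    rw [integral_finsetSum _ fun b _ => (hint a b).const_mul _]
    refine Finset.sum_congr rfl fun b _ => ?_
    rw [integral_const_mul, hC, Matrix.of_apply]
    ring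
  have hpol (x y : ℂ) : star x * y * (C a b - R a b) + star y * x * (C b a - R b a) = 0 := by
    have e (A : Matrix ι ι ℂ) (t s : ι → ℂ) : star (t + s) ⬝ᵥ A *ᵥ (t + s)
        = star t ⬝ᵥ A *ᵥ t + star s ⬝ᵥ A *ᵥ s + star t ⬝ᵥ A *ᵥ s + star s ⬝ᵥ A *ᵥ t := by
      rw [mulVec_add, star_add, add_dotProduct, dotProduct_add, dotProduct_add]
      ring
    have f (A : Matrix ι ι ℂ) (i j : ι) (x y : ℂ) :
        star (x • Pi.single i (1 : ℂ) : ι → ℂ) ⬝ᵥ A *ᵥ (y • Pi.single j (1 : ℂ))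
          = star x * y * A i j := by
      rw [mulVec_smul, star_smul, smul_dotProduct, dotProduct_smul, ← Pi.single_star]
      simp
      ring
    have h := hquad (x • Pi.single a 1 + y • Pi.single b 1)
    rw [e, e, hquad, hquad, f, f, f, f, f, f] at h
    linear_combination h
  have h1 := hpol 1 1
  have h2 := hpol 1 Complex.I
  simp only [star_one, RCLike.star_def, Complex.conj_I, one_mul, mul_one, neg_mul] at h1 h2
  have h3 : Complex.I * (2 * (C a b - R a b)) = 0 := by linear_combination h2 + Complex.I * h1
  have h4 : C a b - R a b = 0 := by simpa using h3
  exact sub_eq_zero.mp h4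

end IsComplexGaussianVec

/-! ### Linear combinations with independent random coefficients -/

lemma memLp_mul_of_indepFun {A B : Ω → ℂ} (hA : MemLp A 2 μ) (hB : MemLp B 2 μ)
    (h : IndepFun A B μ) : MemLp (fun ω => A ω * B ω) 2 μ := by
  have hm : AEStronglyMeasurable (fun ω => A ω * B ω) μ :=
    hA.aestronglyMeasurable.mul hB.aestronglyMeasurable
  rw [memLp_two_iff_integrable_sq_norm hm]
  have h1 := (h.comp (φ := fun z : ℂ => ‖z‖ ^ 2) (ψ := fun z : ℂ => ‖z‖ ^ 2) (by fun_prop)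
    (by fun_prop)).integrable_mul
    ((memLp_two_iff_integrable_sq_norm hA.aestronglyMeasurable).mp hA)
    ((memLp_two_iff_integrable_sq_norm hB.aestronglyMeasurable).mp hB)
  refine h1.congr (ae_of_all _ fun ω => ?_)
  simp [mul_pow]

lemma memLp_sum_mul_of_indepFun {A B : ι → Ω → ℂ}
    (hA : ∀ i, MemLp (A i) 2 μ) (hB : ∀ i, MemLp (B i) 2 μ)
    (h : ∀ i, IndepFun (A i) (B i) μ) : MemLp (fun ω => ∑ i, A i ω * B i ω) 2 μ :=
  memLp_finsetSum _ fun i _ => memLp_mul_of_indepFun (hA i) (hB i) (h i)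

/-- Second moments of `∑ A i * B i` when the `A i` are uncorrelated and independent of the `B i`. -/
lemma integral_sum_mul_star_sum [DecidableEq ι] {A A' B : ι → Ω → ℂ} {r : ι → ℂ}
    (hA : ∀ i, MemLp (A i) 2 μ) (hA' : ∀ i, MemLp (A' i) 2 μ) (hB : ∀ i, MemLp (B i) 2 μ)
    (h : ∀ i j, IndepFun (fun ω => (A i ω, A' j ω)) (fun ω => (B i ω, B j ω)) μ)
    (hcov : ∀ i j, ∫ ω, A i ω * star (A' j ω) ∂μ = if i = j then r i else 0) :
    ∫ ω, (∑ i, A i ω * B i ω) * star (∑ j, A' j ω * B j ω) ∂μ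
      = ∑ i, r i * ((∫ ω, ‖B i ω‖ ^ 2 ∂μ : ℝ) : ℂ) := by
  have hij (i j : ι) : Integrable (fun ω => (A i ω * B i ω) * star (A' j ω * B j ω)) μ :=
    memLp_mul_star
      (memLp_mul_of_indepFun (hA i) (hB i) ((h i i).comp measurable_fst measurable_fst))
      (memLp_mul_of_indepFun (hA' j) (hB j) ((h j j).comp measurable_snd measurable_snd))
  simp only [star_sum, Finset.sum_mul_sum]
  rw [integral_finsetSum _ fun i _ => integrable_finsetSum _ fun j _ => hij i j]
  refine Finset.sum_congr rfl fun i _ => ?_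
  rw [integral_finsetSum _ fun j _ => hij i j]
  have hterm (j : ι) : ∫ ω, (A i ω * B i ω) * star (A' j ω * B j ω) ∂μ
      = (if i = j then r i else 0) * ∫ ω, B i ω * star (B j ω) ∂μ := by
    rw [← hcov]
    have hind := (h i j).comp (φ := fun p : ℂ × ℂ => p.1 * star p.2)
      (ψ := fun p : ℂ × ℂ => p.1 * star p.2) (by fun_prop) (by fun_prop)
    have := hind.integral_fun_mul_eq_mul_integral
      (memLp_mul_star (hA i) (hA' j)).aestronglyMeasurable
      (memLp_mul_star (hB i) (hB j)).aestronglyMeasurable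
    simp only [Function.comp_def] at this
    rw [← this]
    congr 1
    ext ω
    simp only [star_mul']
    ring
  simp only [hterm, ite_mul, zero_mul, Finset.sum_ite_eq, Finset.mem_univ, if_true,
    integral_mul_star_self]

/-- Energy of a random variable plus a white sum with independent coefficients. -/
lemma memLp_add_sum_mul [DecidableEq ι] {W V : ι → Ω → ℂ} {a : Ω → ℂ} {r β : ℝ}
    (hW : ∀ j, MemLp (W j) 2 μ) (hV : ∀ j, MemLp (V j) 2 μ) (ha : MemLp a 2 μ)
    (h0 : ∀ j, ∫ ω, W j ω ∂μ = 0)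
    (hcov : ∀ i j, ∫ ω, W i ω * star (W j ω) ∂μ = if i = j then (r : ℂ) else 0)
    (h : IndepFun (fun ω j => W j ω) (fun ω => (a ω, fun j => V j ω)) μ) :
    MemLp (fun ω => a ω + β * ∑ j, V j ω * W j ω) 2 μ ∧
      ∫ ω, ‖a ω + β * ∑ j, V j ω * W j ω‖ ^ 2 ∂μ
        = ∫ ω, ‖a ω‖ ^ 2 ∂μ + β ^ 2 * r * ∑ j, ∫ ω, ‖V j ω‖ ^ 2 ∂μ := by
  -- The summand a is given the index `none` with constant factor 1. As the W j are centred, it is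
  -- uncorrelated with the rest and the general moment formula applies.
  set A : Option ι → Ω → ℂ := fun i ω => i.elim 1 fun j => β * W j ω with hAdef
  set B : Option ι → Ω → ℂ := fun i ω => i.elim (a ω) fun j => V j ω with hBdef
  have hA (i) : MemLp (A i) 2 μ := by
    rcases i with _ | j
    · exact memLp_const 1
    · exact (hW j).const_mul _
  have hB (i) : MemLp (B i) 2 μ := by
    rcases i with _ | j
    · exact ha
    · exact hV j
  have hmA (i : Option ι) : Measurable fun w : ι → ℂ => (i.elim 1 fun j => β * w j : ℂ) := by
    rcases i with _ | j
    · exact measurable_const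
    · simp only [Option.elim_some]; fun_prop
  have hmB (i : Option ι) : Measurable fun p : ℂ × (ι → ℂ) => (i.elim p.1 fun j => p.2 j : ℂ) := by
    rcases i with _ | j
    · exact measurable_fst
    · simp only [Option.elim_some]; fun_prop
  have hind (i j) : IndepFun (fun ω => (A i ω, A j ω)) (fun ω => (B i ω, B j ω)) μ :=
    h.comp ((hmA i).prodMk (hmA j)) ((hmB i).prodMk (hmB j))
  have hsum (ω : Ω) : a ω + β * ∑ j, V j ω * W j ω = ∑ i, A i ω * B i ω := by
    rw [Fintype.sum_option, Finset.mul_sum]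
    simp only [hAdef, hBdef, Option.elim_none, Option.elim_some, one_mul]
    congr 1
    exact Finset.sum_congr rfl fun j _ => by ring
  have hL : MemLp (fun ω => ∑ i, A i ω * B i ω) 2 μ :=
    memLp_sum_mul_of_indepFun hA hB fun i => (hind i i).comp measurable_fst measurable_fst
  refine ⟨by simpa only [hsum] using hL, ?_⟩
  have hm := integral_sum_mul_star_sum (r := fun i => i.elim 1 fun _ => (β ^ 2 * r : ℂ)) hA hA hB
    hind (by
      rintro (_ | i) (_ | j)
      · simp [hAdef]
      · simp only [hAdef, Option.elim_none, Option.elim_some, one_mul, reduceCtorEq, if_false,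
          star_mul']
        rw [integral_const_mul]
        have : ∫ ω, star (W j ω) ∂μ = 0 := by
          have := integral_conj (μ := μ) (f := W j)
          rw [h0, map_zero] at this
          exact this
        rw [this, mul_zero]
      · simp only [hAdef, Option.elim_none, Option.elim_some, star_one, mul_one, reduceCtorEq,
          if_false]
        rw [integral_const_mul, h0, mul_zero]
      · simp only [hAdef, Option.elim_some, Option.some.injEq, star_mul', RCLike.star_def,
          Complex.conj_ofReal]
        have (ω : Ω) : (β : ℂ) * W i ω * (β * (starRingEnd ℂ) (W j ω))
            = β ^ 2 * (W i ω * star (W j ω)) := by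
          rw [RCLike.star_def]; ring
        simp only [this]
        rw [integral_const_mul, hcov]
        split_ifs <;> simp)
  rw [integral_mul_star_self, Fintype.sum_option] at hm
  simp only [Option.elim_none, Option.elim_some, hBdef, one_mul] at hm
  simp only [hsum]
  have : ((∫ ω, ‖∑ i, A i ω * B i ω‖ ^ 2 ∂μ : ℝ) : ℂ)
      = ((∫ ω, ‖a ω‖ ^ 2 ∂μ + β ^ 2 * r * ∑ j, ∫ ω, ‖V j ω‖ ^ 2 ∂μ : ℝ) : ℂ) := by
    rw [hm]
    push_cast
    rw [Finset.mul_sum]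
  exact_mod_cast this

end Moments

/-! ### Symbols and estimates in the uplink model -/

section Symbols

variable {Ω : Type*} [MeasurableSpace Ω] {μ : Measure Ω} [IsProbabilityMeasure μ]

lemma integral_mul_star_eq_zero_of_indepFun {X Y : Ω → ℂ} (hX : MemLp X 2 μ) (hY : MemLp Y 2 μ)
    (h : IndepFun X Y μ) (h0 : ∫ ω, X ω ∂μ = 0) : ∫ ω, X ω * star (Y ω) ∂μ = 0 := by
  have h1 := (h.comp (φ := id) (ψ := star) measurable_id
    (by fun_prop)).integral_fun_mul_eq_mul_integral hX.aestronglyMeasurable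
    hY.star.aestronglyMeasurable
  simp only [Function.comp_def, id] at h1
  rw [h1, h0, zero_mul]

/-- Centered uncorrelated random variables of variance `r`. -/
structure IsWhite {D : Type*} [DecidableEq D] (μ : Measure Ω) (W : D → Ω → ℂ) (r : ℝ) : Prop where
  memLp : ∀ j, MemLp (W j) 2 μ
  integral_eq_zero : ∀ j, ∫ ω, W j ω ∂μ = 0
  covariance : ∀ i j, ∫ ω, W i ω * star (W j ω) ∂μ = if i = j then (r : ℂ) else 0

lemma IsWhite.of_indepFun {D : Type*} [DecidableEq D] {W : D → Ω → ℂ} {r : ℝ}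
    (h1 : ∀ j, MemLp (W j) 2 μ) (h2 : ∀ j, ∫ ω, W j ω ∂μ = 0) (h3 : ∀ j, ∫ ω, ‖W j ω‖ ^ 2 ∂μ = r)
    (h4 : ∀ i j, i ≠ j → IndepFun (W i) (W j) μ) : IsWhite μ W r where
  memLp := h1
  integral_eq_zero := h2
  covariance i j := by
    split_ifs with hij
    · rw [hij, integral_mul_star_self, h3]
    · exact integral_mul_star_eq_zero_of_indepFun (h1 i) (h1 j) (h4 i j hij) (h2 i)

/-- The family of all data estimates. -/
def estFam {K : ℕ} {D : Type*} (sHat : Fin K → D → Ω → ℂ) (ω : Ω) : Fin K → D → ℂ :=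
  fun k j => sHat k j ω

variable {Φ T D : Type*} [Fintype Φ] [Fintype T] [DecidableEq T] [Fintype D] [DecidableEq D]
  {M K : ℕ} {l : Φ} {R : Φ × Fin K → Matrix (Fin M) (Fin M) ℂ} {noiseVar : ℝ≥0}
  {v : Fin K → ℝ≥0} {h : Φ × Fin K → Ω → Fin M → ℂ} {N : T → Ω → Fin M → ℂ}
  {s : Φ × Fin K → D → Ω → ℂ} {sHat : Fin K → D → Ω → ℂ}

namespace IsGaussianUplink

/-- Transfers expectations of functions of the estimates to `gaussFam`, where the moment bounds are
stated. -/
lemma hasLaw_estFam (hU : IsGaussianUplink μ l R noiseVar v h N s sHat) :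
    HasLaw (estFam sHat) (gaussFam D v) μ := by
  have h1 : iIndepFun (fun p : Fin K × D => sHat p.1 p.2) μ :=
    hU.indep_symbols.precomp Sum.inl_injective
  have h2 := h1.hasLaw_pi (μ := fun p : Fin K × D => complexGaussian (v p.1))
    fun p => hU.est_law p.1 p.2
  have h3 : HasLaw (MeasurableEquiv.curry (Fin K) D ℂ) (gaussFam D v)
      (Measure.pi fun p : Fin K × D => complexGaussian (v p.1)) := by
    refine ⟨by fun_prop, ?_⟩
    have := Measure.infinitePi_map_curry (ι := Fin K) (κ := D) fun k _ => complexGaussian (v k)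
    simp only [Measure.infinitePi_eq_pi] at this
    exact this
  exact h3.comp h2

lemma aemeasurable_symbols (hU : IsGaussianUplink μ l R noiseVar v h N s sHat) (i) :
    AEMeasurable ((Sum.elim (fun p : Fin K × D => sHat p.1 p.2)
      (Sum.elim (fun p : Fin K × D => fun ω => s (l, p.1) p.2 ω - sHat p.1 p.2 ω)
        (fun p : {c : Φ × Fin K // c.1 ≠ l} × D => s p.1.1 p.2))) i) μ := by
  rcases i with i | i | i
  · exact (hU.est_law i.1 i.2).aemeasurable
  · exact (hU.data_law _ _).aemeasurable.sub (hU.est_law i.1 i.2).aemeasurable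
  · exact (hU.data_law _ _).aemeasurable

/-- The dual vector depends on the estimates alone, so this makes the errors and foreign data
jointly independent of it. -/
lemma indepFun_estFam (hU : IsGaussianUplink μ l R noiseVar v h N s sHat) :
    IndepFun (fun ω (i : (Fin K × D) ⊕ ({c : Φ × Fin K // c.1 ≠ l} × D)) =>
      Sum.elim (fun p : Fin K × D => fun ω => s (l, p.1) p.2 ω - sHat p.1 p.2 ω)
        (fun p : {c : Φ × Fin K // c.1 ≠ l} × D => s p.1.1 p.2) i ω) (estFam sHat) μ := by
  classical
  let S : Finset ((Fin K × D) ⊕ ((Fin K × D) ⊕ ({c : Φ × Fin K // c.1 ≠ l} × D))) :=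
    Finset.univ.map ⟨Sum.inr, Sum.inr_injective⟩
  let S' : Finset ((Fin K × D) ⊕ ((Fin K × D) ⊕ ({c : Φ × Fin K // c.1 ≠ l} × D))) :=
    Finset.univ.map ⟨Sum.inl, Sum.inl_injective⟩
  have hS (i) : Sum.inr i ∈ S := by simp [S]
  have hS' (i) : Sum.inl i ∈ S' := by simp [S']
  have hdisj : Disjoint S S' := by
    rw [Finset.disjoint_left]
    intro a ha hb
    simp only [S, S', Finset.mem_map, Finset.mem_univ, true_and,
      Function.Embedding.coeFn_mk] at ha hb
    obtain ⟨b, rfl⟩ := ha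
    obtain ⟨c, hc⟩ := hb
    cases hc
  have h1 := hU.indep_symbols.indepFun_finset₀ S S' hdisj hU.aemeasurable_symbols
  have hφ : Measurable fun (w : S → ℂ) i => w ⟨Sum.inr i, hS i⟩ :=
    measurable_pi_lambda _ fun i => measurable_pi_apply (⟨Sum.inr i, hS i⟩ : S)
  have hψ : Measurable fun (w : S' → ℂ) (k : Fin K) (j : D) => w ⟨Sum.inl (k, j), hS' (k, j)⟩ :=
    measurable_pi_lambda _ fun k => measurable_pi_lambda _ fun j =>
      measurable_pi_apply (⟨Sum.inl (k, j), hS' (k, j)⟩ : S')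
  exact h1.comp hφ hψ

/-- Symbol = estimate + error with independent centred parts, so the variances add up to 1. -/
lemma isWhite_error (hU : IsGaussianUplink μ l R noiseVar v h N s sHat) (k : Fin K) :
    IsWhite μ (fun j ω => s (l, k) j ω - sHat k j ω) (1 - v k) := by
  have hs (j) := moments_of_hasLaw_complexGaussian (hU.data_law (l, k) j)
  have he (j) := moments_of_hasLaw_complexGaussian (hU.est_law k j)
  have hd (j) : MemLp (fun ω => s (l, k) j ω - sHat k j ω) 2 μ := (hs j).1.sub (he j).1
  have hmean (j) : ∫ ω, (s (l, k) j ω - sHat k j ω) ∂μ = 0 := by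
    rw [integral_sub ((hs j).1.integrable (by norm_num)) ((he j).1.integrable (by norm_num)),
      (hs j).2.1, (he j).2.1, sub_zero]
  refine IsWhite.of_indepFun hd hmean (fun j => ?_) fun i j hij => ?_
  · have hind : IndepFun (fun ω => s (l, k) j ω - sHat k j ω) (sHat k j) μ :=
      hU.indep_symbols.indepFun (i := Sum.inr (Sum.inl (k, j))) (j := Sum.inl (k, j)) (by simp)
    have h1 := integral_mul_star_eq_zero_of_indepFun (hd j) (he j).1 hind (hmean j)
    have h2 := integral_mul_star_eq_zero_of_indepFun (he j).1 (hd j) hind.symm (he j).2.1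
    have h3 : ∫ ω, s (l, k) j ω * star (s (l, k) j ω) ∂μ
        = ∫ ω, (s (l, k) j ω - sHat k j ω) * star (s (l, k) j ω - sHat k j ω) ∂μ
          + ∫ ω, sHat k j ω * star (sHat k j ω) ∂μ := by
      have e (ω : Ω) : s (l, k) j ω * star (s (l, k) j ω)
          = ((s (l, k) j ω - sHat k j ω) * star (s (l, k) j ω - sHat k j ω)
            + sHat k j ω * star (sHat k j ω))
            + ((s (l, k) j ω - sHat k j ω) * star (sHat k j ω)
            + sHat k j ω * star (s (l, k) j ω - sHat k j ω)) := by
        simp only [star_sub]; ring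
      simp only [e]
      have i1 := memLp_mul_star (hd j) (hd j)
      have i2 := memLp_mul_star (he j).1 (he j).1
      have i3 := memLp_mul_star (hd j) (he j).1
      have i4 := memLp_mul_star (he j).1 (hd j)
      refine (integral_add (i1.add i2) (i3.add i4)).trans ?_
      simp only [Pi.add_apply]
      rw [integral_add i1 i2, integral_add i3 i4, h1, h2]
      simp
    rw [integral_mul_star_self, integral_mul_star_self, integral_mul_star_self, (hs j).2.2,
      (he j).2.2] at h3
    have h4 : (1 : ℝ) = ∫ ω, ‖s (l, k) j ω - sHat k j ω‖ ^ 2 ∂μ + v k := by exact_mod_cast h3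
    linarith
  · exact hU.indep_symbols.indepFun (i := Sum.inr (Sum.inl (k, i))) (j := Sum.inr (Sum.inl (k, j)))
      (by simpa using hij)

lemma isWhite_data (hU : IsGaussianUplink μ l R noiseVar v h N s sHat) {c : Φ × Fin K}
    (hc : c.1 ≠ l) : IsWhite μ (s c) 1 := by
  have hs (j) := moments_of_hasLaw_complexGaussian (hU.data_law c j)
  refine IsWhite.of_indepFun (fun j => (hs j).1) (fun j => (hs j).2.1)
    (fun j => by simpa using (hs j).2.2) fun i j hij => ?_
  exact hU.indep_symbols.indepFun (i := Sum.inr (Sum.inr (⟨c, hc⟩, i)))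
    (j := Sum.inr (Sum.inr (⟨c, hc⟩, j))) (by simpa using hij)

/-- The error variance 1 - v cannot be negative. This gives the sign of the own-cell weights in the
final comparison. -/
lemma variance_le_one (hU : IsGaussianUplink μ l R noiseVar v h N s sHat) [Nonempty D]
    (k : Fin K) : (v k : ℝ) ≤ 1 := by
  obtain ⟨j⟩ := ‹Nonempty D›
  have h1 := (hU.isWhite_error k).covariance j j
  rw [if_pos rfl, integral_mul_star_self] at h1
  have h2 : ∫ ω, ‖s (l, k) j ω - sHat k j ω‖ ^ 2 ∂μ = 1 - v k := by exact_mod_cast h1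
  have h3 : 0 ≤ ∫ ω, ‖s (l, k) j ω - sHat k j ω‖ ^ 2 ∂μ := integral_nonneg fun _ => by positivity
  linarith

/-- Energy of a function of the estimates plus a white sum whose coefficients depend on the
estimates. -/
lemma memLp_add_white (hU : IsGaussianUplink μ l R noiseVar v h N s sHat) {W : D → Ω → ℂ} {r : ℝ}
    (hW : IsWhite μ W r) (hind : IndepFun (fun ω j => W j ω) (estFam sHat) μ)
    {a : (Fin K → D → ℂ) → ℂ} {V : D → (Fin K → D → ℂ) → ℂ} (ha : Measurable a)
    (hV : ∀ j, Measurable (V j)) (haL : MemLp a 2 (gaussFam D v))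
    (hVL : ∀ j, MemLp (V j) 2 (gaussFam D v)) (β : ℝ) :
    MemLp (fun ω => a (estFam sHat ω) + β * ∑ j, V j (estFam sHat ω) * W j ω) 2 μ ∧
      ∫ ω, ‖a (estFam sHat ω) + β * ∑ j, V j (estFam sHat ω) * W j ω‖ ^ 2 ∂μ
        = ∫ g, ‖a g‖ ^ 2 ∂gaussFam D v + β ^ 2 * r * ∑ j, ∫ g, ‖V j g‖ ^ 2 ∂gaussFam D v := by
  have hlaw := hU.hasLaw_estFam
  have hmem {f : (Fin K → D → ℂ) → ℂ} (hf : MemLp f 2 (gaussFam D v)) :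
      MemLp (fun ω => f (estFam sHat ω)) 2 μ := by
    rw [← hlaw.map_eq] at hf
    exact hf.comp_of_map hlaw.aemeasurable
  have hint {f : (Fin K → D → ℂ) → ℂ} (hf : Measurable f) :
      ∫ g, ‖f g‖ ^ 2 ∂gaussFam D v = ∫ ω, ‖f (estFam sHat ω)‖ ^ 2 ∂μ :=
    (hlaw.integral_comp (f := fun g => ‖f g‖ ^ 2)
      (Measurable.aestronglyMeasurable (by fun_prop))).symm
  rw [hint ha]
  simp only [hint (hV _)]
  exact memLp_add_sum_mul hW.memLp (fun j => hmem (hVL j)) (hmem haL) hW.integral_eq_zero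
    hW.covariance (hind.comp (φ := id) (ψ := fun g => (a g, fun j => V j g)) measurable_id
      (ha.prodMk (measurable_pi_lambda _ hV)))

end IsGaussianUplink

end Symbols

/-! ### The correlation matrix of the channel observation -/

section Correlation

variable {Ω : Type*} [MeasurableSpace Ω] {μ : Measure Ω} [IsProbabilityMeasure μ]
  {Φ T D : Type*} [Fintype Φ] [DecidableEq Φ] [Fintype T] [DecidableEq T] [Fintype D]
  [DecidableEq D]
  {M K : ℕ} {l : Φ} {R : Φ × Fin K → Matrix (Fin M) (Fin M) ℂ} {noiseVar : ℝ≥0}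
  {v : Fin K → ℝ≥0} {h : Φ × Fin K → Ω → Fin M → ℂ} {N : T → Ω → Fin M → ℂ}
  {s : Φ × Fin K → D → Ω → ℂ} {sHat : Fin K → D → Ω → ℂ}
  {p : Φ × Fin K → T → ℂ} {ρ : Φ × Fin K → ℝ} {e : D → T}
  {cols : (Fin K → D → ℂ) → Fin K → T → ℂ} {x : Φ × Fin K → Ω → T → ℂ}
  {xHat : Fin K → Ω → T → ℂ} {k : Fin K}

/-- Signals made of pilots `p c` and data symbols with energies `ρ c` in the slots `e j`, together
with their estimates `cols` as functions of the data estimates. -/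
structure IsAffineSignal (l : Φ) (p : Φ × Fin K → T → ℂ) (ρ : Φ × Fin K → ℝ) (e : D → T)
    (cols : (Fin K → D → ℂ) → Fin K → T → ℂ) (s : Φ × Fin K → D → Ω → ℂ)
    (sHat : Fin K → D → Ω → ℂ) (x : Φ × Fin K → Ω → T → ℂ) (xHat : Fin K → Ω → T → ℂ) :
    Prop where
  energy_nonneg : ∀ c, 0 ≤ ρ c
  measurable_cols : Measurable cols
  xHat_eq : ∀ k ω, xHat k ω = cols (estFam sHat ω) k
  dotProduct_x : ∀ c ω (V : T → ℂ),
    V ⬝ᵥ x c ω = V ⬝ᵥ p c + (√(ρ c) : ℂ) * ∑ j, V (e j) * s c j ω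
  dotProduct_sub : ∀ k ω (V : T → ℂ),
    V ⬝ᵥ (x (l, k) ω - xHat k ω)
      = (√(ρ (l, k)) : ℂ) * ∑ j, V (e j) * (s (l, k) j ω - sHat k j ω)

/-- The energy of the dual vector in the data slots. -/
def dataEnergy (v : Fin K → ℝ≥0) (e : D → T) (cols : (Fin K → D → ℂ) → Fin K → T → ℂ)
    (k : Fin K) : ℝ :=
  ∑ j, ∫ g, ‖dualVec (cols g) k (e j)‖ ^ 2 ∂gaussFam D v

namespace IsAffineSignal

lemma projVec_eq (hx : IsAffineSignal l p ρ e cols s sHat x xHat) (k : Fin K) (ω : Ω) :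
    projVec xHat k ω = dualVec (cols (estFam sHat ω)) k := by
  have h : (fun k => xHat k ω) = cols (estFam sHat ω) := funext fun k => hx.xHat_eq k ω
  rw [← h]
  rfl

lemma measurable_dualVec_cols (hx : IsAffineSignal l p ρ e cols s sHat x xHat) :
    Measurable fun g => dualVec (cols g) k :=
  (measurable_dualVec k).comp hx.measurable_cols

lemma memLp_dualVec (hx : IsAffineSignal l p ρ e cols s sHat x xHat)
    (hint : Integrable (fun g => sqNorm (dualVec (cols g) k)) (gaussFam D v)) (t : T) :
    MemLp (fun g => star (dualVec (cols g) k) t) 2 (gaussFam D v) := by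
  have hm : Measurable fun g => dualVec (cols g) k t :=
    (measurable_pi_apply t).comp hx.measurable_dualVec_cols
  refine MemLp.star ?_
  rw [memLp_two_iff_integrable_sq_norm hm.aestronglyMeasurable]
  refine hint.mono' (hm.norm.pow_const 2).aestronglyMeasurable (ae_of_all _ fun g => ?_)
  rw [Real.norm_eq_abs, abs_of_nonneg (by positivity)]
  exact Finset.single_le_sum (f := fun t => ‖dualVec (cols g) k t‖ ^ 2)
    (fun _ _ => by positivity) (Finset.mem_univ t)

lemma measurable_star_dualVec (hx : IsAffineSignal l p ρ e cols s sHat x xHat) (t : T) :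
    Measurable fun g => star (dualVec (cols g) k) t :=
  continuous_star.measurable.comp ((measurable_pi_apply t).comp hx.measurable_dualVec_cols)

lemma dataEnergy_eq (k : Fin K) : ∑ j, ∫ g, ‖star (dualVec (cols g) k) (e j)‖ ^ 2 ∂gaussFam D v
    = dataEnergy v e cols k := by
  simp only [dataEnergy, Pi.star_apply, norm_star]

lemma memLp_star_projVec (hx : IsAffineSignal l p ρ e cols s sHat x xHat)
    (hU : IsGaussianUplink μ l R noiseVar v h N s sHat)
    (hint : Integrable (fun g => sqNorm (dualVec (cols g) k)) (gaussFam D v)) (t : T) :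
    MemLp (fun ω => star (projVec xHat k ω) t) 2 μ := by
  have hm := hx.memLp_dualVec hint t
  have hlaw := hU.hasLaw_estFam
  rw [← hlaw.map_eq] at hm
  simp only [hx.projVec_eq]
  exact hm.comp_of_map hlaw.aemeasurable

lemma memLp_projVec (hx : IsAffineSignal l p ρ e cols s sHat x xHat)
    (hU : IsGaussianUplink μ l R noiseVar v h N s sHat)
    (hint : Integrable (fun g => sqNorm (dualVec (cols g) k)) (gaussFam D v)) (t : T) :
    MemLp (fun ω => projVec xHat k ω t) 2 μ := by
  simpa only [Pi.star_def, star_star] using (hx.memLp_star_projVec hU hint t).star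

lemma integral_projVec (hx : IsAffineSignal l p ρ e cols s sHat x xHat)
    (hU : IsGaussianUplink μ l R noiseVar v h N s sHat) :
    ∫ ω, ∑ t, ‖projVec xHat k ω t‖ ^ 2 ∂μ
      = ∫ g, sqNorm (dualVec (cols g) k) ∂gaussFam D v := by
  simp only [hx.projVec_eq]
  exact hU.hasLaw_estFam.integral_comp (f := fun g => sqNorm (dualVec (cols g) k))
    (measurable_sqNorm.comp hx.measurable_dualVec_cols).aestronglyMeasurable

lemma indepFun_error (hU : IsGaussianUplink μ l R noiseVar v h N s sHat) (k' : Fin K) :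
    IndepFun (fun ω j => s (l, k') j ω - sHat k' j ω) (estFam sHat) μ :=
  hU.indepFun_estFam.comp (φ := fun w j => w (Sum.inl (k', j))) (ψ := id)
    (measurable_pi_lambda _ fun _ => measurable_pi_apply _) measurable_id

lemma indepFun_data (hU : IsGaussianUplink μ l R noiseVar v h N s sHat) {c : Φ × Fin K}
    (hc : c.1 ≠ l) : IndepFun (fun ω j => s c j ω) (estFam sHat) μ :=
  hU.indepFun_estFam.comp (φ := fun w j => w (Sum.inr (⟨c, hc⟩, j))) (ψ := id)
    (measurable_pi_lambda _ fun _ => measurable_pi_apply _) measurable_id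

/-- Residual interference of a user of the own cell. -/
lemma integral_error (hx : IsAffineSignal l p ρ e cols s sHat x xHat)
    (hU : IsGaussianUplink μ l R noiseVar v h N s sHat)
    (hint : Integrable (fun g => sqNorm (dualVec (cols g) k)) (gaussFam D v)) (k' : Fin K) :
    ∫ ω, ‖star (projVec xHat k ω) ⬝ᵥ (x (l, k') ω - xHat k' ω)‖ ^ 2 ∂μ
      = ρ (l, k') * (1 - v k') * dataEnergy v e cols k := by
  have hm := (hU.memLp_add_white (hU.isWhite_error k') (indepFun_error hU k')
    (a := fun _ => 0) (V := fun j g => star (dualVec (cols g) k) (e j)) measurable_const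
    (fun j => hx.measurable_star_dualVec (e j)) MemLp.zero (fun j => hx.memLp_dualVec hint (e j))
    √(ρ (l, k'))).2
  simp only [hx.dotProduct_sub, hx.projVec_eq]
  simp only [zero_add, norm_zero, Real.sq_sqrt (hx.energy_nonneg _), dataEnergy_eq] at hm
  rw [hm]
  simp

/-- Received energy of a user of the own cell. -/
lemma integral_own (hx : IsAffineSignal l p ρ e cols s sHat x xHat)
    (hU : IsGaussianUplink μ l R noiseVar v h N s sHat)
    (hint : Integrable (fun g => sqNorm (dualVec (cols g) k)) (gaussFam D v))
    (hdet : ∀ᵐ g ∂gaussFam D v, gramDet (cols g) ≠ 0) (k' : Fin K) :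
    MemLp (fun ω => star (projVec xHat k ω) ⬝ᵥ x (l, k') ω) 2 μ ∧
      ∫ ω, ‖star (projVec xHat k ω) ⬝ᵥ x (l, k') ω‖ ^ 2 ∂μ
        = (if k' = k then 1 else 0)
          + ∫ ω, ‖star (projVec xHat k ω) ⬝ᵥ (x (l, k') ω - xHat k' ω)‖ ^ 2 ∂μ := by
  have hm := hU.memLp_add_white (hU.isWhite_error k') (indepFun_error hU k')
    (a := fun _ => if k' = k then 1 else 0) (V := fun j g => star (dualVec (cols g) k) (e j))
    measurable_const (fun j => hx.measurable_star_dualVec (e j)) (memLp_const _)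
    (fun j => hx.memLp_dualVec hint (e j)) √(ρ (l, k'))
  -- Almost surely the estimated columns are independent, and then duality turns uᴴ x into a
  -- constant 0 or 1 plus the error contribution.
  have hae : (fun ω => (if k' = k then (1 : ℂ) else 0) + (√(ρ (l, k')) : ℂ)
        * ∑ j, star (dualVec (cols (estFam sHat ω)) k) (e j) * (s (l, k') j ω - sHat k' j ω))
      =ᵐ[μ] fun ω => star (projVec xHat k ω) ⬝ᵥ x (l, k') ω := by
    have hlaw := hU.hasLaw_estFam
    rw [← hlaw.map_eq] at hdet
    filter_upwards [ae_of_ae_map hlaw.aemeasurable hdet] with ω hω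
    have h1 : gramDet (cols (estFam sHat ω)) ≠ 0 := hω
    have h2 := star_dualVec_dotProduct h1 k' k
    rw [← hx.xHat_eq] at h2
    have h3 := hx.dotProduct_sub k' ω (star (dualVec (cols (estFam sHat ω)) k))
    simp only [← h3, _root_.dotProduct_sub, hx.projVec_eq, h2]
    ring
  refine ⟨hm.1.ae_eq hae, ?_⟩
  refine (integral_congr_ae (hae.fun_comp fun z => ‖z‖ ^ 2)).symm.trans (hm.2.trans ?_)
  rw [dataEnergy_eq, hx.integral_error hU hint, Real.sq_sqrt (hx.energy_nonneg _)]
  split_ifs <;> simp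

/-- Received energy of a user of another cell. -/
lemma integral_other (hx : IsAffineSignal l p ρ e cols s sHat x xHat)
    (hU : IsGaussianUplink μ l R noiseVar v h N s sHat)
    (hint : Integrable (fun g => sqNorm (dualVec (cols g) k)) (gaussFam D v)) {c : Φ × Fin K}
    (hc : c.1 ≠ l) :
    MemLp (fun ω => star (projVec xHat k ω) ⬝ᵥ x c ω) 2 μ ∧
      ∫ ω, ‖star (projVec xHat k ω) ⬝ᵥ x c ω‖ ^ 2 ∂μ
        = ∫ g, ‖star (dualVec (cols g) k) ⬝ᵥ p c‖ ^ 2 ∂gaussFam D v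
          + ρ c * dataEnergy v e cols k := by
  have ha : Measurable fun g => star (dualVec (cols g) k) ⬝ᵥ p c := by
    have := fun t => hx.measurable_star_dualVec (k := k) t
    simp only [dotProduct]
    fun_prop
  have haL : MemLp (fun g => star (dualVec (cols g) k) ⬝ᵥ p c) 2 (gaussFam D v) := by
    simp only [dotProduct]
    exact memLp_finsetSum _ fun t _ => (hx.memLp_dualVec hint t).mul_const _
  have hm := hU.memLp_add_white (hU.isWhite_data hc) (indepFun_data hU hc) ha
    (V := fun j g => star (dualVec (cols g) k) (e j))
    (fun j => hx.measurable_star_dualVec (e j)) haL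
    (fun j => hx.memLp_dualVec hint (e j)) √(ρ c)
  simp only [hx.dotProduct_x, hx.projVec_eq]
  refine ⟨hm.1, hm.2.trans ?_⟩
  rw [dataEnergy_eq, Real.sq_sqrt (hx.energy_nonneg _), mul_one]

lemma memLp_dotProduct (hx : IsAffineSignal l p ρ e cols s sHat x xHat)
    (hU : IsGaussianUplink μ l R noiseVar v h N s sHat)
    (hint : Integrable (fun g => sqNorm (dualVec (cols g) k)) (gaussFam D v))
    (hdet : ∀ᵐ g ∂gaussFam D v, gramDet (cols g) ≠ 0) (c : Φ × Fin K) :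
    MemLp (fun ω => star (projVec xHat k ω) ⬝ᵥ x c ω) 2 μ := by
  by_cases hc : c.1 = l
  · obtain ⟨c1, k'⟩ := c
    subst hc
    exact (hx.integral_own hU hint hdet k').1
  · exact (hx.integral_other hU hint hc).1

end IsAffineSignal

/-- Coefficients of the channels and noise columns in the channel observation. -/
def obsCoeff (x : Φ × Fin K → Ω → T → ℂ) (xHat : Fin K → Ω → T → ℂ) (k : Fin K) :
    (Φ × Fin K) ⊕ T → Ω → ℂ :=
  Sum.elim (fun c ω => star (projVec xHat k ω) ⬝ᵥ x c ω) (fun t ω => star (projVec xHat k ω) t)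

/-- Channels and noise columns are treated as one independent family, so that a single second-moment
formula covers both. -/
lemma chanObs_eq (h : Φ × Fin K → Ω → Fin M → ℂ) (N : T → Ω → Fin M → ℂ)
    (x : Φ × Fin K → Ω → T → ℂ) (xHat : Fin K → Ω → T → ℂ) (k : Fin K) (ω : Ω) (a : Fin M) :
    chanObs h N x xHat k ω a = ∑ i, Sum.elim h N i ω a * obsCoeff x xHat k i ω := by
  rw [chanObs, received, add_mulVec, Pi.add_apply, Fintype.sum_sum_type, sum_mulVec,
    Finset.sum_apply]
  congr 1
  refine Finset.sum_congr rfl fun c _ => ?_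
  rw [vecMulVec_mulVec, obsCoeff, Sum.elim_inl, Sum.elim_inl, dotProduct_comm]
  simp

namespace IsAffineSignal

lemma memLp_obsCoeff (hx : IsAffineSignal l p ρ e cols s sHat x xHat)
    (hU : IsGaussianUplink μ l R noiseVar v h N s sHat)
    (hint : Integrable (fun g => sqNorm (dualVec (cols g) k)) (gaussFam D v))
    (hdet : ∀ᵐ g ∂gaussFam D v, gramDet (cols g) ≠ 0) (i) :
    MemLp (obsCoeff x xHat k i) 2 μ := by
  rcases i with c | t
  · exact hx.memLp_dotProduct hU hint hdet c
  · exact hx.memLp_star_projVec hU hint t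

/-- The coefficients are measurable functions of the symbols and estimates only (B below), which are
independent of all channels and noise. -/
lemma indepFun_obsCoeff (hx : IsAffineSignal l p ρ e cols s sHat x xHat)
    (hU : IsGaussianUplink μ l R noiseVar v h N s sHat) (a b : Fin M) (i j) :
    IndepFun (fun ω => (Sum.elim h N i ω a, Sum.elim h N j ω b))
      (fun ω => (obsCoeff x xHat k i ω, obsCoeff x xHat k j ω)) μ := by
  let A : ((Φ × Fin K) ⊕ T) → Fin M → ((Φ × Fin K → Fin M → ℂ) × (T → Fin M → ℂ)) → ℂ :=
    fun i a w => Sum.elim (fun c => w.1 c a) (fun t => w.2 t a) i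
  let U : ((Φ × Fin K) × D → ℂ) × (Fin K × D → ℂ) → T → ℂ :=
    fun w => star (dualVec (cols fun k j => w.2 (k, j)) k)
  let B : ((Φ × Fin K) ⊕ T) → (((Φ × Fin K) × D → ℂ) × (Fin K × D → ℂ)) → ℂ :=
    fun i w => Sum.elim (fun c => U w ⬝ᵥ p c + (√(ρ c) : ℂ) * ∑ j, U w (e j) * w.1 (c, j))
      (fun t => U w t) i
  have hUm (t : T) : Measurable fun w => U w t :=
    (hx.measurable_star_dualVec t).comp (by fun_prop)
  have hA (i a) : Measurable (A i a) := by
    rcases i with c | t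
    · simp only [A, Sum.elim_inl]; fun_prop
    · simp only [A, Sum.elim_inr]; fun_prop
  have hB (i) : Measurable (B i) := by
    rcases i with c | t
    · simp only [B, Sum.elim_inl, dotProduct]; fun_prop
    · exact hUm t
  have key := hU.indep_channel_symbols.comp ((hA i a).prodMk (hA j b)) ((hB i).prodMk (hB j))
  have e1 (i a) (ω : Ω) : A i a ((fun c => h c ω), (fun t => N t ω)) = Sum.elim h N i ω a := by
    rcases i with c | t <;> rfl
  have e2 (i) (ω : Ω) : B i ((fun p : (Φ × Fin K) × D => s p.1 p.2 ω),
      (fun p : Fin K × D => sHat p.1 p.2 ω)) = obsCoeff x xHat k i ω := by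
    rcases i with c | t
    · simp only [obsCoeff, Sum.elim_inl, hx.dotProduct_x, hx.projVec_eq]
      rfl
    · simp only [obsCoeff, Sum.elim_inr, hx.projVec_eq]
      rfl
  simp only [Function.comp_def, e1, e2] at key
  exact key

lemma chanLaw (hU : IsGaussianUplink μ l R noiseVar v h N s sHat) (i) :
    IsComplexGaussianVec μ (Sum.elim h N i)
      (Sum.elim R (fun _ : T => (noiseVar : ℝ) • (1 : Matrix (Fin M) (Fin M) ℂ)) i) := by
  rcases i with c | t
  · exact hU.channel_law c
  · exact hU.noise_law t

lemma memLp_chanObs (hx : IsAffineSignal l p ρ e cols s sHat x xHat)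
    (hU : IsGaussianUplink μ l R noiseVar v h N s sHat)
    (hint : Integrable (fun g => sqNorm (dualVec (cols g) k)) (gaussFam D v))
    (hdet : ∀ᵐ g ∂gaussFam D v, gramDet (cols g) ≠ 0) (a : Fin M) :
    MemLp (fun ω => chanObs h N x xHat k ω a) 2 μ := by
  simp only [chanObs_eq]
  exact memLp_sum_mul_of_indepFun (A := fun i ω => Sum.elim h N i ω a)
    (fun i => (chanLaw hU i).memLp a) (fun i => hx.memLp_obsCoeff hU hint hdet i)
    fun i => (hx.indepFun_obsCoeff hU a a i i).comp measurable_fst measurable_fst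

/-- Distinct members of the channel and noise family are independent and centred, so only diagonal
terms survive. -/
lemma corrMatrix_apply (hx : IsAffineSignal l p ρ e cols s sHat x xHat)
    (hU : IsGaussianUplink μ l R noiseVar v h N s sHat)
    (hint : Integrable (fun g => sqNorm (dualVec (cols g) k)) (gaussFam D v))
    (hdet : ∀ᵐ g ∂gaussFam D v, gramDet (cols g) ≠ 0) (a b : Fin M) :
    corrMatrix μ (chanObs h N x xHat k) a b
      = ∑ i, Sum.elim R (fun _ : T => (noiseVar : ℝ) • (1 : Matrix (Fin M) (Fin M) ℂ)) i a b
        * ((∫ ω, ‖obsCoeff x xHat k i ω‖ ^ 2 ∂μ : ℝ) : ℂ) := by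
  classical
  rw [corrMatrix, Matrix.of_apply]
  simp only [chanObs_eq]
  refine integral_sum_mul_star_sum (A := fun i ω => Sum.elim h N i ω a)
    (A' := fun i ω => Sum.elim h N i ω b)
    (r := fun i => Sum.elim R (fun _ : T => (noiseVar : ℝ) • (1 : Matrix (Fin M) (Fin M) ℂ)) i a b)
    (fun i => (chanLaw hU i).memLp a) (fun i => (chanLaw hU i).memLp b)
    (fun i => hx.memLp_obsCoeff hU hint hdet i) (fun i j => hx.indepFun_obsCoeff hU a b i j)
    fun i j => ?_
  split_ifs with hij
  · subst hij
    exact (chanLaw hU i).integral_mul_star a b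
  · exact integral_mul_star_eq_zero_of_indepFun ((chanLaw hU i).memLp a) ((chanLaw hU j).memLp b)
      ((hU.indep_channel_noise.indepFun hij).comp (measurable_pi_apply a) (measurable_pi_apply b))
      ((chanLaw hU i).integral_eq_zero a)

lemma corrMatrix_eq (hx : IsAffineSignal l p ρ e cols s sHat x xHat)
    (hU : IsGaussianUplink μ l R noiseVar v h N s sHat)
    (hint : Integrable (fun g => sqNorm (dualVec (cols g) k)) (gaussFam D v))
    (hdet : ∀ᵐ g ∂gaussFam D v, gramDet (cols g) ≠ 0) :
    corrMatrix μ (chanObs h N x xHat k) = corrDecomposition μ l k R noiseVar x xHat := by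
  ext a b
  rw [hx.corrMatrix_apply hU hint hdet, Fintype.sum_sum_type, Fintype.sum_prod_type,
    ← Finset.add_sum_erase _ _ (Finset.mem_univ l)]
  simp only [corrDecomposition, obsCoeff, Sum.elim_inl, Sum.elim_inr, Matrix.add_apply,
    Matrix.sum_apply, Matrix.smul_apply, Complex.real_smul, (hx.integral_own hU hint hdet _).2]
  push_cast
  simp only [mul_add, Finset.sum_add_distrib]
  have h1 : ∑ k' : Fin K, R (l, k') a b * ((if k' = k then 1 else 0 : ℝ) : ℂ) = R (l, k) a b := by
    rw [Finset.sum_eq_single k (fun k' _ hk => by rw [if_neg hk, Complex.ofReal_zero, mul_zero])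
      (fun hk => absurd (Finset.mem_univ k) hk), if_pos rfl, Complex.ofReal_one, mul_one]
  have h2 : ∑ t : T, (noiseVar : ℂ) * (1 : Matrix (Fin M) (Fin M) ℂ) a b
        * ((∫ ω, ‖star (projVec xHat k ω) t‖ ^ 2 ∂μ : ℝ) : ℂ)
      = (noiseVar : ℂ) * ((∫ ω, ∑ t, ‖projVec xHat k ω t‖ ^ 2 ∂μ : ℝ) : ℂ)
        * (1 : Matrix (Fin M) (Fin M) ℂ) a b := by
    rw [integral_finsetSum _ fun t _ => by
      have h := hx.memLp_star_projVec hU hint t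
      simpa using (memLp_two_iff_integrable_sq_norm h.aestronglyMeasurable).mp h]
    push_cast
    rw [← Finset.mul_sum]
    simp only [Pi.star_apply, norm_star]
    ring
  rw [h1, h2]
  simp only [mul_comm (R _ a b)]

end IsAffineSignal

end Correlation

/-! ### The matrix bounds -/

section LowerBound

variable {Ω : Type*} [MeasurableSpace Ω] {μ : Measure Ω} [IsProbabilityMeasure μ]
  {Φ T D : Type*} [Fintype Φ] [DecidableEq Φ] [Fintype T] [DecidableEq T] [Fintype D]
  [DecidableEq D]
  {M K : ℕ} {l : Φ} {R : Φ × Fin K → Matrix (Fin M) (Fin M) ℂ} {noiseVar : ℝ≥0}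
  {v : Fin K → ℝ≥0} {h : Φ × Fin K → Ω → Fin M → ℂ} {N : T → Ω → Fin M → ℂ}
  {s : Φ × Fin K → D → Ω → ℂ} {sHat : Fin K → D → Ω → ℂ}
  {p : Φ × Fin K → T → ℂ} {ρ : Φ × Fin K → ℝ} {e : D → T}
  {cols : (Fin K → D → ℂ) → Fin K → T → ℂ} {x : Φ × Fin K → Ω → T → ℂ}
  {xHat : Fin K → Ω → T → ℂ} {k : Fin K}

lemma le_integral_of_ofReal_le {α : Type*} [MeasurableSpace α] {ν : Measure α} {f : α → ℝ} {a : ℝ}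
    (hf : Integrable f ν) (hf0 : ∀ x, 0 ≤ f x)
    (h : ENNReal.ofReal a ≤ ∫⁻ x, ENNReal.ofReal (f x) ∂ν) : a ≤ ∫ x, f x ∂ν := by
  rw [← ofReal_integral_eq_lintegral_ofReal hf (ae_of_all _ hf0)] at h
  exact (ENNReal.ofReal_le_ofReal_iff (integral_nonneg hf0)).mp h

/-- Users of the own cell do not share the pilot, so contamination comes from other cells only and
can be matched with the intercell terms. -/
lemma pilotContamination_eq {τ : ℕ} {φ : Φ × Fin K → Fin τ → ℂ} (q : Φ × Fin K → ℝ)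
    (hown : ∀ k', k' ≠ k → (l, k') ∉ pilotSharing φ (l, k)) :
    pilotContamination l k R q φ = ∑ ℓ ∈ Finset.univ.erase l, ∑ k' : Fin K,
      (if (ℓ, k') ∈ pilotSharing φ (l, k) then q (ℓ, k') else 0) • R (ℓ, k') := by
  have h1 : pilotContamination l k R q φ
      = ∑ c, (if c ∈ (pilotSharing φ (l, k)).erase (l, k) then q c else 0) • R c := by
    simp only [ite_smul, zero_smul, Finset.sum_ite_mem, Finset.univ_inter]
    rfl
  rw [h1, Fintype.sum_prod_type, ← Finset.add_sum_erase _ _ (Finset.mem_univ l),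
    Finset.sum_eq_zero, zero_add]
  · refine Finset.sum_congr rfl fun ℓ hℓ => Finset.sum_congr rfl fun k' _ => ?_
    have hne : (ℓ, k') ≠ (l, k) := fun h => Finset.ne_of_mem_erase hℓ (congrArg Prod.fst h)
    simp only [Finset.mem_erase, hne, ne_eq, not_false_eq_true, true_and]
  · intro k' _
    rw [if_neg, zero_smul]
    intro h
    rw [Finset.mem_erase] at h
    exact hown k' (fun hk => h.1 (by rw [hk])) h.2

/-- Comparison of the correlation matrix with a bound whose coefficients are dominated termwise. -/
lemma IsAffineSignal.posSemidef_corrMatrix_sub (hx : IsAffineSignal l p ρ e cols s sHat x xHat)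
    (hU : IsGaussianUplink μ l R noiseVar v h N s sHat) [Nonempty D]
    (hint : Integrable (fun g => sqNorm (dualVec (cols g) k)) (gaussFam D v))
    (hdet : ∀ᵐ g ∂gaussFam D v, gramDet (cols g) ≠ 0)
    {τ : ℕ} {φ : Φ × Fin K → Fin τ → ℂ} {q : Φ × Fin K → ℝ} (hq : ∀ c, 0 ≤ q c)
    (hqk : 0 < q (l, k)) (hown : ∀ k', k' ≠ k → (l, k') ∉ pilotSharing φ (l, k))
    (hp : ∀ c ∈ pilotSharing φ (l, k),
      p c = ((√(q c) / √(q (l, k)) : ℝ) : ℂ) • p (l, k)) {a b γ : ℝ}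
    (ha : ENNReal.ofReal a
      ≤ ∫⁻ g, ENNReal.ofReal (∑ j, ‖dualVec (cols g) k (e j)‖ ^ 2) ∂gaussFam D v)
    (hb : ENNReal.ofReal (b * q (l, k))
      ≤ ∫⁻ g, ENNReal.ofReal (‖star (dualVec (cols g) k) ⬝ᵥ p (l, k)‖ ^ 2) ∂gaussFam D v)
    (hγ : ENNReal.ofReal γ ≤ ∫⁻ g, ENNReal.ofReal (sqNorm (dualVec (cols g) k)) ∂gaussFam D v) :
    (corrMatrix μ (chanObs h N x xHat k)
      - (R (l, k) + (ρ (l, k) * (1 - (v k : ℝ)) * a) • R (l, k)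
        + (a • dataInterference l k R ρ v + b • pilotContamination l k R q φ
          + ((noiseVar : ℝ) * γ) • (1 : Matrix (Fin M) (Fin M) ℂ)))).PosSemidef := by
  have hsq (t : T) : Integrable (fun g => ‖dualVec (cols g) k t‖ ^ 2) (gaussFam D v) := by
    have h := hx.memLp_dualVec hint t
    simpa using (memLp_two_iff_integrable_sq_norm h.aestronglyMeasurable).mp h
  have hEd : a ≤ dataEnergy v e cols k := by
    rw [dataEnergy, ← integral_finsetSum _ fun j _ => hsq (e j)]
    exact le_integral_of_ofReal_le (integrable_finsetSum _ fun j _ => hsq (e j))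
      (fun g => Finset.sum_nonneg fun _ _ => by positivity) ha
  have hpint (f : T → ℂ) : MemLp (fun g => star (dualVec (cols g) k) ⬝ᵥ f) 2 (gaussFam D v) := by
    simp only [dotProduct]
    exact memLp_finsetSum _ fun t _ => (hx.memLp_dualVec hint t).mul_const _
  have hκ : b * q (l, k) ≤ ∫ g, ‖star (dualVec (cols g) k) ⬝ᵥ p (l, k)‖ ^ 2 ∂gaussFam D v :=
    le_integral_of_ofReal_le ((memLp_two_iff_integrable_sq_norm
      (hpint _).aestronglyMeasurable).mp (hpint _)) (fun g => by positivity) hb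
  have hEu : γ ≤ ∫ g, sqNorm (dualVec (cols g) k) ∂gaussFam D v :=
    le_integral_of_ofReal_le hint (fun g => sqNorm_nonneg _) hγ
  -- A user sharing the pilot has pilot part √(q c / q (l, k)) times that of the target user, so its
  -- correlation scales by q c / q (l, k); for any other user nonnegativity is enough.
  have hshare (c : Φ × Fin K) : b * (if c ∈ pilotSharing φ (l, k) then q c else 0)
      ≤ ∫ g, ‖star (dualVec (cols g) k) ⬝ᵥ p c‖ ^ 2 ∂gaussFam D v := by
    split_ifs with hc
    · rw [hp c hc]
      simp only [dotProduct_smul, smul_eq_mul, norm_mul, Complex.norm_real, mul_pow,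
        Real.norm_eq_abs, sq_abs, div_pow, Real.sq_sqrt (hq _)]
      rw [integral_const_mul]
      calc b * q c = q c / q (l, k) * (b * q (l, k)) := by field_simp
        _ ≤ _ := mul_le_mul_of_nonneg_left hκ (div_nonneg (hq c) hqk.le)
    · rw [mul_zero]
      exact integral_nonneg fun _ => by positivity
  have hR (c) : (R c).PosSemidef := (hU.channel_law c).posSemidef
  rw [hx.corrMatrix_eq hU hint hdet]
  -- Each weight on the right is a gap in one of the scalar bounds times a nonnegative factor, or a
  -- sum of such gaps.
  have hdiff : corrDecomposition μ l k R noiseVar x xHat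
      - (R (l, k) + (ρ (l, k) * (1 - (v k : ℝ)) * a) • R (l, k)
        + (a • dataInterference l k R ρ v + b • pilotContamination l k R q φ
          + ((noiseVar : ℝ) * γ) • (1 : Matrix (Fin M) (Fin M) ℂ)))
      = ∑ k' : Fin K, (ρ (l, k') * (1 - v k') * (dataEnergy v e cols k - a)) • R (l, k')
        + ∑ ℓ ∈ Finset.univ.erase l, ∑ k' : Fin K,
          ((∫ g, ‖star (dualVec (cols g) k) ⬝ᵥ p (ℓ, k')‖ ^ 2 ∂gaussFam D v
            - b * (if (ℓ, k') ∈ pilotSharing φ (l, k) then q (ℓ, k') else 0))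
            + ρ (ℓ, k') * (dataEnergy v e cols k - a)) • R (ℓ, k')
        + ((noiseVar : ℝ) * (∫ g, sqNorm (dualVec (cols g) k) ∂gaussFam D v - γ))
          • (1 : Matrix (Fin M) (Fin M) ℂ) := by
    have e1 : ∑ ℓ ∈ Finset.univ.erase l, ∑ k' : Fin K,
          (∫ ω, ‖star (projVec xHat k ω) ⬝ᵥ x (ℓ, k') ω‖ ^ 2 ∂μ) • R (ℓ, k')
        = ∑ ℓ ∈ Finset.univ.erase l, ∑ k' : Fin K,
          (∫ g, ‖star (dualVec (cols g) k) ⬝ᵥ p (ℓ, k')‖ ^ 2 ∂gaussFam D v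
            + ρ (ℓ, k') * dataEnergy v e cols k) • R (ℓ, k') :=
      Finset.sum_congr rfl fun ℓ hℓ => Finset.sum_congr rfl fun k' _ => by
        rw [(hx.integral_other hU hint (c := (ℓ, k')) (Finset.ne_of_mem_erase hℓ)).2]
    have e2 : (ρ (l, k) * (1 - (v k : ℝ)) * a) • R (l, k)
        + a • ∑ k' ∈ Finset.univ.erase k, (ρ (l, k') * (1 - (v k' : ℝ))) • R (l, k')
        = ∑ k' : Fin K, (ρ (l, k') * (1 - v k') * a) • R (l, k') := by
      rw [← Finset.add_sum_erase _ _ (Finset.mem_univ k), Finset.smul_sum]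
      simp only [smul_smul, mul_comm a]
    rw [corrDecomposition, e1, hx.integral_projVec hU, dataInterference,
      pilotContamination_eq q hown, smul_add]
    simp only [hx.integral_error hU hint]
    -- The products ρ(1 - v) are made opaque, so that distributing over differences does not split 1
    -- - v.
    obtain ⟨er, her⟩ : ∃ er : Fin K → ℝ, ∀ k', ρ (l, k') * (1 - (v k' : ℝ)) = er k' :=
      ⟨_, fun _ => rfl⟩
    simp only [her] at e2 ⊢
    simp only [mul_sub, sub_smul, add_smul, Finset.sum_add_distrib, Finset.sum_sub_distrib]
    rw [← e2]
    simp only [Finset.smul_sum, smul_smul, mul_comm a]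
    abel
  rw [hdiff]
  have hv (k') : 0 ≤ 1 - (v k' : ℝ) := sub_nonneg.mpr (hU.variance_le_one k')
  refine ((posSemidef_sum _ fun k' _ => (hR _).smul ?_).add
    (posSemidef_sum _ fun ℓ _ => posSemidef_sum _ fun k' _ => (hR _).smul ?_)).add
    (PosSemidef.one.smul ?_)
  · exact mul_nonneg (mul_nonneg (hx.energy_nonneg _) (hv _)) (sub_nonneg.mpr hEd)
  · exact add_nonneg (sub_nonneg.mpr (hshare _))
      (mul_nonneg (hx.energy_nonneg _) (sub_nonneg.mpr hEd))
  · exact mul_nonneg noiseVar.2 (sub_nonneg.mpr hEu)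

end LowerBound

/-! ### Pilots -/

section Pilots

variable {τ : ℕ} {U : Set (Fin τ → ℂ)}

lemma IsPilotBook.pos (hB : IsPilotBook U) {a : Fin τ → ℂ} (ha : a ∈ U) : 0 < τ := by
  rcases Nat.eq_zero_or_pos τ with h | h
  · subst h
    have h1 := (Set.ncard_eq_zero U.toFinite).mp hB.ncard_eq
    rw [h1] at ha
    exact absurd ha (Set.notMem_empty a)
  · exact h

lemma IsPilotBook.sqNorm_eq (hB : IsPilotBook U) {a : Fin τ → ℂ} (ha : a ∈ U) : sqNorm a = τ := by
  simp [sqNorm, hB.unit_modulus a ha]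

variable {Φ : Type*} [Fintype Φ] {K : ℕ} {φ : Φ × Fin K → Fin τ → ℂ} {l : Φ} {k : Fin K}

lemma IsPilotBook.eq_of_mem_pilotSharing (hB : IsPilotBook U) (hφ : ∀ c, φ c ∈ U) {c c₀ : Φ × Fin K}
    (h : c ∈ pilotSharing φ c₀) : φ c = φ c₀ := by
  by_contra hne
  rw [pilotSharing, Finset.mem_filter] at h
  exact h.2 (hB.orthogonal _ (hφ c) _ (hφ c₀) hne)

lemma IsPilotBook.notMem_pilotSharing (hB : IsPilotBook U) (hφ : ∀ c, φ c ∈ U)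
    (hinj : Function.Injective fun k' => φ (l, k')) {k' : Fin K} (hk : k' ≠ k) :
    (l, k') ∉ pilotSharing φ (l, k) :=
  fun h => hk (hinj (hB.eq_of_mem_pilotSharing hφ h))

/-- The scaled pilots of the users of a cell. -/
def cellPilots (q : Φ × Fin K → ℝ) (φ : Φ × Fin K → Fin τ → ℂ) (l : Φ) (k : Fin K) : Fin τ → ℂ :=
  (√(q (l, k)) : ℂ) • φ (l, k)

variable {q : Φ × Fin K → ℝ}

lemma IsPilotBook.sqNorm_cellPilots (hB : IsPilotBook U) (hφ : ∀ c, φ c ∈ U)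
    (hq : 0 ≤ q (l, k)) : sqNorm (cellPilots q φ l k) = q (l, k) * τ := by
  rw [cellPilots, sqNorm_smul, hB.sqNorm_eq (hφ _), Complex.norm_real, Real.norm_eq_abs, sq_abs,
    Real.sq_sqrt hq]

lemma IsPilotBook.cellPilots_ne_zero (hB : IsPilotBook U) (hφ : ∀ c, φ c ∈ U)
    (hq : 0 < q (l, k)) : cellPilots q φ l k ≠ 0 := by
  have hτ : (0 : ℝ) < τ := by exact_mod_cast hB.pos (hφ (l, k))
  intro h
  have h1 := hB.sqNorm_cellPilots hφ hq.le
  rw [sqNorm_eq_zero.mpr h] at h1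
  exact (mul_pos hq hτ).ne h1

lemma IsPilotBook.cellPilots_orthogonal (hB : IsPilotBook U) (hφ : ∀ c, φ c ∈ U)
    (hinj : Function.Injective fun k' => φ (l, k')) {i j : Fin K} (hij : i ≠ j) :
    star (cellPilots q φ l i) ⬝ᵥ cellPilots q φ l j = 0 := by
  rw [cellPilots, cellPilots, star_smul, smul_dotProduct, dotProduct_smul,
    hB.orthogonal _ (hφ _) _ (hφ _) fun h => hij (hinj h)]
  simp

end Pilots

/-! ### Regular and superimposed pilots -/

section Pilot

variable {Ω : Type*} [MeasurableSpace Ω] {μ : Measure Ω} [IsProbabilityMeasure μ]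
  {Φ : Type*} [Fintype Φ] [DecidableEq Φ]
  {M K : ℕ} {l : Φ} {R : Φ × Fin K → Matrix (Fin M) (Fin M) ℂ} {noiseVar : ℝ≥0}
  {v : Fin K → ℝ≥0} {k : Fin K} {q ρ : Φ × Fin K → ℝ} {h : Φ × Fin K → Ω → Fin M → ℂ}

section Regular

variable {τp τd : ℕ} {U : Set (Fin τp → ℂ)} {φ : Φ × Fin K → Fin τp → ℂ}
  {N : Fin τp ⊕ Fin τd → Ω → Fin M → ℂ} {s : Φ × Fin K → Fin τd → Ω → ℂ}
  {sHat : Fin K → Fin τd → Ω → ℂ}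

lemma isAffineSignal_rp (l : Φ) (q ρ : Φ × Fin K → ℝ) (φ : Φ × Fin K → Fin τp → ℂ)
    (s : Φ × Fin K → Fin τd → Ω → ℂ) (sHat : Fin K → Fin τd → Ω → ℂ) (hρ : ∀ c, 0 ≤ ρ c) :
    IsAffineSignal l (fun c => Sum.elim ((√(q c) : ℂ) • φ c) 0) ρ Sum.inr
      (stackGaussCols (cellPilots q φ l) fun k' => √(ρ (l, k'))) s sHat (rpTx q ρ φ s)
      (rpEst l q ρ φ sHat) where
  energy_nonneg := hρ
  measurable_cols := measurable_stackGaussCols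
  xHat_eq k ω := by
    ext (t | t)
    · simp [rpEst, rpSignal, stackGaussCols, stackCols, cellPilots]
    · simp [rpEst, rpSignal, stackGaussCols, stackCols, estFam]
  dotProduct_x c ω V := by
    simp only [rpTx, rpSignal, dotProduct, Fintype.sum_sum_type, Sum.elim_inl, Sum.elim_inr,
      Pi.smul_apply, Pi.zero_apply, smul_eq_mul, mul_zero, Finset.sum_const_zero, add_zero,
      Finset.mul_sum]
    congr 1
    exact Finset.sum_congr rfl fun j _ => by ring
  dotProduct_sub k ω V := by
    simp only [rpTx, rpEst, rpSignal, dotProduct, Fintype.sum_sum_type, Sum.elim_inl, Sum.elim_inr,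
      Pi.sub_apply, sub_self, mul_zero, Finset.sum_const_zero, zero_add, Finset.mul_sum]
    exact Finset.sum_congr rfl fun j _ => by ring

lemma integrable_sqNorm_rp (hB : IsPilotBook U) (hφ : ∀ c, φ c ∈ U)
    (hinj : Function.Injective fun k' => φ (l, k')) (hq : ∀ k', 0 < q (l, k')) (c : Fin K → ℝ) :
    Integrable (fun g : Fin K → Fin τd → ℂ =>
      sqNorm (dualVec (stackGaussCols (cellPilots q φ l) c g) k)) (gaussFam (Fin τd) v) :=
  integrable_sqNorm_dualVec_stack (fun _ _ hij => hB.cellPilots_orthogonal hφ hinj hij)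
    fun i => hB.cellPilots_ne_zero hφ (hq i)

lemma ae_gramDet_rp (hB : IsPilotBook U) (hφ : ∀ c, φ c ∈ U)
    (hinj : Function.Injective fun k' => φ (l, k')) (hq : ∀ k', 0 < q (l, k')) (c : Fin K → ℝ) :
    ∀ᵐ g ∂gaussFam (Fin τd) v, gramDet (stackGaussCols (cellPilots q φ l) c g) ≠ 0 :=
  ae_of_all _ fun _ => gramDet_stackCols_ne_zero
    (fun _ _ hij => hB.cellPilots_orthogonal hφ hinj hij)
    (fun i => hB.cellPilots_ne_zero hφ (hq i)) _

lemma posSemidef_rp (hd : K < τd) (hB : IsPilotBook U) (hφ : ∀ c, φ c ∈ U)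
    (hinj : Function.Injective fun k' => φ (l, k')) (hq : ∀ c, 0 ≤ q c) (hρ : ∀ c, 0 ≤ ρ c)
    (hql : ∀ k', 0 < q (l, k')) (hρk : 0 < ρ (l, k)) (hvk : 0 < v k)
    (hU : IsGaussianUplink μ l R noiseVar v h N s sHat) :
    (corrMatrix μ (chanObs h N (rpTx q ρ φ s) (rpEst l q ρ φ sHat) k)
      - (R (l, k) + (ρ (l, k) * (1 - (v k : ℝ)) / rpDenom K τp τd (q (l, k)) (ρ (l, k)) (v k))
            • R (l, k)
          + psiBarRP τd l k R noiseVar v q ρ φ)).PosSemidef := by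
  have hτ : (0 : ℝ) < τp := by exact_mod_cast hB.pos (hφ (l, k))
  have hqk := hql k
  have hv : (0 : ℝ) < v k := hvk
  have hτd : (0 : ℝ) < τd := by exact_mod_cast (Nat.zero_le K).trans_lt hd
  have : Nonempty (Fin τd) := ⟨⟨0, (Nat.zero_le K).trans_lt hd⟩⟩
  have horth : ∀ i j : Fin K, i ≠ j → star (cellPilots q φ l i) ⬝ᵥ cellPilots q φ l j = 0 :=
    fun i j hij => hB.cellPilots_orthogonal hφ hinj hij
  have hne : ∀ i : Fin K, cellPilots q φ l i ≠ 0 := fun i => hB.cellPilots_ne_zero hφ (hql i)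
  obtain ⟨d, hd'⟩ := Nat.exists_eq_add_of_le hd.le
  have hd1 : 1 ≤ d := by omega
  have hdr : (τd : ℝ) - K = d := by rw [hd']; push_cast; ring
  have hd0 : (0 : ℝ) < d := by exact_mod_cast hd1
  have hN := hB.sqNorm_cellPilots (q := q) (l := l) (k := k) hφ hqk.le
  have hsq : √(ρ (l, k)) ^ 2 = ρ (l, k) := Real.sq_sqrt hρk.le
  have ha := lintegral_sqNorm_inr_dualVec_stack_ge (D := Fin τd)
    (c := fun k' => √(ρ (l, k'))) (v := v) (k := k) horth hne hd1 (by simpa using hd')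
    (by rw [hsq]; positivity)
  have hb := lintegral_norm_star_dualVec_stack_dotProduct_ge (D := Fin τd)
    (c := fun k' => √(ρ (l, k'))) (v := v) (k := k) horth hne
  have hγ := lintegral_sqNorm_dualVec_stack_ge (D := Fin τd)
    (c := fun k' => √(ρ (l, k'))) (v := v) (k := k) horth hne
  simp only [hN, hsq, Fintype.card_fin] at ha hb hγ
  have key := (isAffineSignal_rp l q ρ φ s sHat hρ).posSemidef_corrMatrix_sub hU
    (integrable_sqNorm_rp (k := k) hB hφ hinj hql _) (ae_gramDet_rp hB hφ hinj hql _) hq hqk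
    (fun k' hk => hB.notMem_pilotSharing hφ hinj hk)
    (fun c hc => by
      have hs : (√(q (l, k)) : ℂ) ≠ 0 := by exact_mod_cast (Real.sqrt_pos.mpr hqk).ne'
      rw [hB.eq_of_mem_pilotSharing hφ hc]
      push_cast
      ext (t | t)
      · simp only [Sum.elim_inl, Pi.smul_apply, smul_eq_mul]
        field_simp
      · simp)
    (a := (rpDenom K τp τd (q (l, k)) (ρ (l, k)) (v k))⁻¹)
    (b := (q (l, k) + 2 * τd * (ρ (l, k) * v k) / τp
        + (ρ (l, k) * v k) ^ 2 * τd * ((τd : ℝ) + 1) / (q (l, k) * (τp : ℝ) ^ 2))⁻¹)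
    (γ := (q (l, k) * τp + ρ (l, k) * v k * τd)⁻¹)
    (by
      refine le_trans (ENNReal.ofReal_le_ofReal (le_of_eq ?_)) ha
      rw [rpDenom, hdr, inv_eq_one_div]
      congr 1
      ring)
    (by
      refine le_trans (ENNReal.ofReal_le_ofReal ?_) hb
      rw [div_pow, inv_mul_eq_div, div_le_div_iff₀ (by positivity) (by positivity)]
      -- Jensen alone would give τd² where the stated denominator has τd(τd + 1). After clearing
      -- denominators the slack is q w² τd with w = ρ v.
      have e : (q (l, k) * τp) ^ 2 * (q (l, k) + 2 * τd * (ρ (l, k) * v k) / τp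
          + (ρ (l, k) * v k) ^ 2 * τd * ((τd : ℝ) + 1) / (q (l, k) * (τp : ℝ) ^ 2))
          = q (l, k) * (q (l, k) * τp + ρ (l, k) * v k * τd) ^ 2
            + q (l, k) * (ρ (l, k) * v k) ^ 2 * τd := by
        field_simp
        ring
      rw [e]
      exact le_add_of_nonneg_right (by positivity))
    (by rwa [inv_eq_one_div])
  simpa only [psiBarRP, div_eq_mul_inv] using key

end Regular

section Superposed

variable {τc : ℕ} {U : Set (Fin τc → ℂ)} {φ : Φ × Fin K → Fin τc → ℂ}
  {N : Fin τc → Ω → Fin M → ℂ} {s : Φ × Fin K → Fin τc → Ω → ℂ} {sHat : Fin K → Fin τc → Ω → ℂ}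

lemma isAffineSignal_sp (l : Φ) (q ρ : Φ × Fin K → ℝ) (φ : Φ × Fin K → Fin τc → ℂ)
    (s : Φ × Fin K → Fin τc → Ω → ℂ) (sHat : Fin K → Fin τc → Ω → ℂ) (hρ : ∀ c, 0 ≤ ρ c) :
    IsAffineSignal l (fun c => (√(q c) : ℂ) • φ c) ρ id
      (gaussCols (cellPilots q φ l) fun k' => √(ρ (l, k'))) s sHat (spTx q ρ φ s)
      (spEst l q ρ φ sHat) where
  energy_nonneg := hρ
  measurable_cols := measurable_gaussCols _ _
  xHat_eq k ω := by
    ext t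
    simp [spEst, spSignal, gaussCols, cellPilots, estFam]
  dotProduct_x c ω V := by
    simp only [spTx, spSignal, dotProduct, Pi.smul_apply, smul_eq_mul, Finset.mul_sum, id,
      ← Finset.sum_add_distrib]
    exact Finset.sum_congr rfl fun j _ => by ring
  dotProduct_sub k ω V := by
    simp only [spTx, spEst, spSignal, dotProduct, Pi.sub_apply, Finset.mul_sum, id]
    exact Finset.sum_congr rfl fun j _ => by ring

lemma integrable_sqNorm_sp (hd : K < τc) (hB : IsPilotBook U) (hφ : ∀ c, φ c ∈ U)
    (hinj : Function.Injective fun k' => φ (l, k')) (hq : ∀ k', 0 < q (l, k')) (c : Fin K → ℝ) :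
    Integrable (fun g : Fin K → Fin τc → ℂ =>
      sqNorm (dualVec (gaussCols (cellPilots q φ l) c g) k)) (gaussFam (Fin τc) v) :=
  integrable_sqNorm_dualVec_gaussCols (fun _ _ hij => hB.cellPilots_orthogonal hφ hinj hij)
    (fun i => hB.cellPilots_ne_zero hφ (hq i)) (d := τc - K) (by omega)
    (by simp only [Fintype.card_fin]; omega)

lemma ae_gramDet_sp (hd : K < τc) (hB : IsPilotBook U) (hφ : ∀ c, φ c ∈ U)
    (hinj : Function.Injective fun k' => φ (l, k')) (hq : ∀ k', 0 < q (l, k')) (c : Fin K → ℝ) :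
    ∀ᵐ g ∂gaussFam (Fin τc) v, gramDet (gaussCols (cellPilots q φ l) c g) ≠ 0 :=
  ae_gramDet_gaussCols_ne_zero (fun _ _ hij => hB.cellPilots_orthogonal hφ hinj hij)
    (fun i => hB.cellPilots_ne_zero hφ (hq i)) (d := τc - K) (by omega)
    (by simp only [Fintype.card_fin]; omega) _ _

/-- Every slot carries data, so the energy of u in the data slots is ‖u‖² and one bound serves for
both data interference and noise. -/
lemma posSemidef_sp (hd : K < τc) (hB : IsPilotBook U) (hφ : ∀ c, φ c ∈ U)
    (hinj : Function.Injective fun k' => φ (l, k')) (hq : ∀ c, 0 ≤ q c) (hρ : ∀ c, 0 ≤ ρ c)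
    (hql : ∀ k', 0 < q (l, k')) (hU : IsGaussianUplink μ l R noiseVar v h N s sHat) :
    (corrMatrix μ (chanObs h N (spTx q ρ φ s) (spEst l q ρ φ sHat) k)
      - (R (l, k) + (ρ (l, k) * (1 - (v k : ℝ)) / (τc * (q (l, k) + ρ (l, k) * v k))) • R (l, k)
          + psiBarSP l k R noiseVar v q ρ φ)).PosSemidef := by
  have hτ1 : (1 : ℝ) ≤ τc := by exact_mod_cast hB.pos (hφ (l, k))
  have hτ : (0 : ℝ) < τc := by linarith
  have hqk := hql k
  have : Nonempty (Fin τc) := ⟨⟨0, (Nat.zero_le K).trans_lt hd⟩⟩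
  have horth : ∀ i j : Fin K, i ≠ j → star (cellPilots q φ l i) ⬝ᵥ cellPilots q φ l j = 0 :=
    fun i j hij => hB.cellPilots_orthogonal hφ hinj hij
  have hne : ∀ i : Fin K, cellPilots q φ l i ≠ 0 := fun i => hB.cellPilots_ne_zero hφ (hql i)
  have hd1 : 1 ≤ τc - K := by omega
  have hT : Fintype.card (Fin τc) = Fintype.card (Fin K) + (τc - K) := by
    simp only [Fintype.card_fin]; omega
  have hN := hB.sqNorm_cellPilots (q := q) (l := l) (k := k) hφ hqk.le
  have hsq : √(ρ (l, k)) ^ 2 = ρ (l, k) := Real.sq_sqrt (hρ _)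
  have hw : 0 ≤ ρ (l, k) * v k := mul_nonneg (hρ _) (v k).2
  have hγ := lintegral_sqNorm_dualVec_gaussCols_ge (T := Fin τc)
    (c := fun k' => √(ρ (l, k'))) (v := v) (k := k) horth hne hd1 hT
  have hb := lintegral_norm_star_dualVec_gaussCols_dotProduct_ge (T := Fin τc)
    (c := fun k' => √(ρ (l, k'))) (v := v) (k := k) horth hne hd1 hT
  simp only [hN, hsq, Fintype.card_fin] at hb hγ
  have hγ' : ENNReal.ofReal ((τc : ℝ) * (q (l, k) + ρ (l, k) * v k))⁻¹
      ≤ ∫⁻ g, ENNReal.ofReal (sqNorm (dualVec (gaussCols (cellPilots q φ l)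
        (fun k' => √(ρ (l, k'))) g) k)) ∂gaussFam (Fin τc) v := by
    refine le_trans (ENNReal.ofReal_le_ofReal (le_of_eq ?_)) hγ
    rw [inv_eq_one_div]
    congr 1
    ring
  have key := (isAffineSignal_sp l q ρ φ s sHat hρ).posSemidef_corrMatrix_sub hU
    (integrable_sqNorm_sp (k := k) hd hB hφ hinj hql _) (ae_gramDet_sp hd hB hφ hinj hql _) hq hqk
    (fun k' hk => hB.notMem_pilotSharing hφ hinj hk)
    (fun c hc => by
      have hs : (√(q (l, k)) : ℂ) ≠ 0 := by exact_mod_cast (Real.sqrt_pos.mpr hqk).ne'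
      rw [hB.eq_of_mem_pilotSharing hφ hc]
      push_cast
      rw [smul_smul, div_mul_cancel₀ _ hs])
    (a := ((τc : ℝ) * (q (l, k) + ρ (l, k) * v k))⁻¹)
    (b := ((q (l, k) + ρ (l, k) * v k) ^ 2 / q (l, k)
        + ρ (l, k) * v k * (2 * q (l, k) + ρ (l, k) * v k) / (q (l, k) * τc))⁻¹)
    (γ := ((τc : ℝ) * (q (l, k) + ρ (l, k) * v k))⁻¹) hγ'
    (by
      refine le_trans (ENNReal.ofReal_le_ofReal ?_) hb
      generalize ρ (l, k) * (v k : ℝ) = w at hw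
      generalize q (l, k) = Q at hqk
      have hτ' : (0 : ℝ) ≤ τc - 1 := by linarith
      -- The explicit gap between the stated denominator and the sharper one Q(1 + w(τc - 1)/(Qτc))²
      -- coming from the pilot correlation; it is nonnegative because τc ≥ 1.
      have e : Q * (1 + w * (τc - 1) / (Q * τc)) ^ 2
          + (w * (τc * (4 * Q + 3 * w) - w)) / (Q * τc ^ 2)
          = (Q + w) ^ 2 / Q + w * (2 * Q + w) / (Q * τc) := by
        field_simp
        ring
      have hpos : 0 ≤ (w * (τc * (4 * Q + 3 * w) - w)) / (Q * τc ^ 2) := by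
        refine div_nonneg (mul_nonneg hw ?_) (by positivity)
        have h1 : 4 * Q + 3 * w ≤ τc * (4 * Q + 3 * w) :=
          le_mul_of_one_le_left (by positivity) hτ1
        linarith
      rw [inv_mul_eq_div, div_le_div_iff₀ (by positivity) (by positivity)]
      linarith)
    hγ'
  simpa only [psiBarSP, div_eq_mul_inv] using key

end Superposed

end Pilot

end DataAided

end

/-! ### Assembly for the two pilot schemes -/

theorem theorem1 {Ω Φ : Type*} [MeasurableSpace Ω] (μ : Measure Ω) [IsProbabilityMeasure μ]
    [Fintype Φ] [DecidableEq Φ] {M K : ℕ} (l : Φ) (k : Fin K)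
    (R : Φ × Fin K → Matrix (Fin M) (Fin M) ℂ) (noiseVar : ℝ≥0) (v : Fin K → ℝ≥0) :
    -- regular pilots
    (∀ (τp τd : ℕ) (U : Set (Fin τp → ℂ)) (φ : Φ × Fin K → Fin τp → ℂ) (q ρ : Φ × Fin K → ℝ)
      (h : Φ × Fin K → Ω → Fin M → ℂ) (N : Fin τp ⊕ Fin τd → Ω → Fin M → ℂ)
      (s : Φ × Fin K → Fin τd → Ω → ℂ) (sHat : Fin K → Fin τd → Ω → ℂ),
      K < τd →
      DataAided.IsPilotBook U → (∀ c, φ c ∈ U) → (Function.Injective fun k' => φ (l, k')) →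
      (∀ c, 0 ≤ q c) → (∀ c, 0 ≤ ρ c) → (∀ k', 0 < q (l, k')) → 0 < ρ (l, k) → 0 < v k →
      DataAided.IsGaussianUplink μ l R noiseVar v h N s sHat →
      (∀ t, MemLp (fun ω => DataAided.projVec (DataAided.rpEst l q ρ φ sHat) k ω t) 2 μ) ∧
      (∀ a, MemLp (fun ω => DataAided.chanObs h N (DataAided.rpTx q ρ φ s)
        (DataAided.rpEst l q ρ φ sHat) k ω a) 2 μ) ∧
      DataAided.corrMatrix μ (DataAided.chanObs h N (DataAided.rpTx q ρ φ s)
          (DataAided.rpEst l q ρ φ sHat) k)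
        = DataAided.corrDecomposition μ l k R noiseVar (DataAided.rpTx q ρ φ s)
          (DataAided.rpEst l q ρ φ sHat) ∧
      (DataAided.corrMatrix μ (DataAided.chanObs h N (DataAided.rpTx q ρ φ s)
          (DataAided.rpEst l q ρ φ sHat) k)
        - (R (l, k)
          + (ρ (l, k) * (1 - (v k : ℝ)) / DataAided.rpDenom K τp τd (q (l, k)) (ρ (l, k)) (v k))
              • R (l, k)
          + DataAided.psiBarRP τd l k R noiseVar v q ρ φ)).PosSemidef) ∧
    -- superimposed pilots
    (∀ (τc : ℕ) (U : Set (Fin τc → ℂ)) (φ : Φ × Fin K → Fin τc → ℂ) (q ρ : Φ × Fin K → ℝ)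
      (h : Φ × Fin K → Ω → Fin M → ℂ) (N : Fin τc → Ω → Fin M → ℂ)
      (s : Φ × Fin K → Fin τc → Ω → ℂ) (sHat : Fin K → Fin τc → Ω → ℂ),
      K < τc →
      DataAided.IsPilotBook U → (∀ c, φ c ∈ U) → (Function.Injective fun k' => φ (l, k')) →
      (∀ c, 0 ≤ q c) → (∀ c, 0 ≤ ρ c) → (∀ k', 0 < q (l, k')) →
      DataAided.IsGaussianUplink μ l R noiseVar v h N s sHat →
      (∀ t, MemLp (fun ω => DataAided.projVec (DataAided.spEst l q ρ φ sHat) k ω t) 2 μ) ∧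
      (∀ a, MemLp (fun ω => DataAided.chanObs h N (DataAided.spTx q ρ φ s)
        (DataAided.spEst l q ρ φ sHat) k ω a) 2 μ) ∧
      DataAided.corrMatrix μ (DataAided.chanObs h N (DataAided.spTx q ρ φ s)
          (DataAided.spEst l q ρ φ sHat) k)
        = DataAided.corrDecomposition μ l k R noiseVar (DataAided.spTx q ρ φ s)
          (DataAided.spEst l q ρ φ sHat) ∧
      (DataAided.corrMatrix μ (DataAided.chanObs h N (DataAided.spTx q ρ φ s)
          (DataAided.spEst l q ρ φ sHat) k)
        - (R (l, k)
          + (ρ (l, k) * (1 - (v k : ℝ)) / (τc * (q (l, k) + ρ (l, k) * v k))) • R (l, k)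
          + DataAided.psiBarSP l k R noiseVar v q ρ φ)).PosSemidef) := by
  refine ⟨fun τp τd U φ q ρ h N s sHat hd hB hφ hinj hq hρ hql hρk hvk hU => ?_,
    fun τc U φ q ρ h N s sHat hd hB hφ hinj hq hρ hql hU => ?_⟩
  · have hx := DataAided.isAffineSignal_rp l q ρ φ s sHat hρ
    have hint := DataAided.integrable_sqNorm_rp (k := k) (v := v) (τd := τd) hB hφ hinj hql
      fun k' => √(ρ (l, k'))
    have hdet := DataAided.ae_gramDet_rp (v := v) (τd := τd) hB hφ hinj hql fun k' => √(ρ (l, k'))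
    exact ⟨fun t => hx.memLp_projVec hU hint t,
      fun a => hx.memLp_chanObs hU hint hdet a, hx.corrMatrix_eq hU hint hdet,
      DataAided.posSemidef_rp hd hB hφ hinj hq hρ hql hρk hvk hU⟩
  · have hx := DataAided.isAffineSignal_sp l q ρ φ s sHat hρ
    have hint := DataAided.integrable_sqNorm_sp (k := k) (v := v) hd hB hφ hinj hql
      fun k' => √(ρ (l, k'))
    have hdet := DataAided.ae_gramDet_sp (v := v) hd hB hφ hinj hql fun k' => √(ρ (l, k'))
    exact ⟨fun t => hx.memLp_projVec hU hint t,
      fun a => hx.memLp_chanObs hU hint hdet a, hx.corrMatrix_eq hU hint hdet,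
      DataAided.posSemidef_sp hd hB hφ hinj hq hρ hql hU⟩
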